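/- **Adequacy of ISPCF.** *Types and domains.* Types are $\sigma,\tau ::= \mathtt{unit}\mid\mathtt{void}\mid\mathtt{int}\mid\mathtt{real}\mid\sigma+\tau\mid\sigma\times\tau\mid\sigma\to\tau\mid D\tau$. They denote pointed dcpos: $[\![\mathtt{unit}]\!]=\{*\}_\bot$, $[\![\mathtt{void}]\!]=\{\bot\}$, $[\![\mathtt{int}]\!]=\mathbb Z_\bot$, $[\![\mathtt{real}]\!]=\mathbf{IR}_\bot$, where $\mathbf{IR}$ is the set of compact intervals $[a,b]$, $a\le b$, ordered by reverse inclusion; $[\![\sigma+\tau]\!]=([\![\sigma]\!]+[\![\tau]\!])_\bot$; $[\![\sigma\times\tau]\!]$ is the product; $[\![\sigma\to\tau]\!]$ is the dcpo of Scott-continuous maps, ordered pointwise; and $[\![D\tau]\!]$ is the dcpo of minimal valuations on $[\![\tau]\!]$. A continuous valuation on a poset $X$ is a strict, modular, Scott-continuous map from the Scott-open subsets of $X$ to $[0,\infty]$; these maps are ordered pointwise. The minimal valuations form the smallest set of continuous valuations that contains the finite linear combinations, with coefficients in $[0,\infty)$, of Dirac valuations $\delta_x$, and that is closed under directed suprema.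 Integrals of Scott-continuous $h:X\to[0,\infty]$ are given by $\int h\,d\nu=\int_0^\infty \nu(\{x\mid h(x)>t\})\,dt$, and $f^\dagger(\nu)(V)=\int f(x)(V)\,d\nu(x)$. *Terms.* Fix a set $\Sigma$ of typed constants $\underline f$, each with a denotation $f$ in the denotation of its type, and a set of measures on $\mathbb R$. $\Sigma$ contains $\underline *:\mathtt{unit}$ denoting $*$ and, for each $n\in\mathbb Z$, $\underline n:\mathtt{int}$ denoting $n$. The constants of type $\mathtt{real}$ are exactly $\underline{\mathbf a}$, one for each $\mathbf a\in\mathbf{IR}$, denoting $\mathbf a$. Terms are $$M,N,P::=x\mid\underline f\mid\mathsf{sample}[\mu]\mid\mathsf{score}\,M\mid\lambda x.M\mid MN\mid\mathsf{rec}\,M\mid\mathsf{ret}\,M\mid\mathsf{do}\,x\leftarrow M;N\mid\langle M,N\rangle\mid\pi_iM\mid\iota_iM\mid\mathsf{case}\,M\,N\,P,$$ with $\mathsf{sample}[\mu]:D\,\mathtt{real}$; $\mathsf{score}\,M:D\,\mathtt{unit}$ for $M:\mathtt{real}$; $\mathsf{rec}\,M:\sigma$ for $M:\sigma\to\sigma$;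 $\mathsf{ret}\,M:D\tau$ for $M:\tau$; $\mathsf{do}\,x\leftarrow M;N:D\tau$ for $M:D\sigma$ and $N:D\tau$ with $x:\sigma$; $\mathsf{case}\,M\,N\,P:\upsilon$ for $M:\sigma+\tau$, $N:\sigma\to\upsilon$, $P:\tau\to\upsilon$; and the usual rules for the other constructs. The generalized ISPCF terms are the closed well-typed terms. They are topologized by the Scott topology of the following order: $M\le N$ if $M$ and $N$ differ only in their constants of type $\mathtt{real}$, and each such constant $\underline{\mathbf a}$ of $M$ and the corresponding $\underline{\mathbf b}$ of $N$ satisfy $\mathbf a\le\mathbf b$. *Denotational semantics.* $[\![\mathsf{sample}[\mu]]\!](U)=\mu\{t\mid[t,t]\in U\}$; $[\![\mathsf{score}\,M]\!]=|[\![M]\!]|\cdot\delta_*$, where $|[a,b]|$ is $a$ if $a\ge0$, $-b$ if $b\le0$, and $0$ otherwise, and $|\bot|=0$; $[\![\mathsf{rec}\,M]\!]=\sup_n[\![M]\!]^n(\bot)$; $[\![\mathsf{ret}\,M]\!]=\delta_{[\![M]\!]}$; $[\![\mathsf{do}\,x\leftarrow M;N]\!]=[\![\lambda x.N]\!]^\dagger([\![M]\!])$;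 $[\![\mathsf{case}\,M\,N\,P]\!]$ is $[\![N]\!](a)$ if $[\![M]\!]=(1,a)$, $[\![P]\!](b)$ if $[\![M]\!]=(2,b)$, and $\bot$ if $[\![M]\!]=\bot$; the other constructs (in an environment for the free variables) are interpreted as usual. *Observability.* The basic types are $\mathtt{unit},\mathtt{void},\mathtt{int},\mathtt{real}$. The observable types are those without $\to$ and $D$. Observable elements: all elements except $\bot$ at basic types; the pairs of observable elements at $\beta_1\times\beta_2$; the elements $(i,b)$ with $b$ observable at $\beta_1+\beta_2$. For an observable element $a$, the term $\underline a$ is defined by $\underline{(a,b)}=\langle\underline a,\underline b\rangle$, $\underline{(i,a)}=\iota_i\underline a$ and the constants above. $\Sigma$ *consists of strictly observable first-order constants* if every constant $\underline f$ has a type $\sigma_1\to\cdots\to\sigma_k\to\tau$ with each $\sigma_i$ basic and $\tau$ observable ($k=\alpha(\underline f)$ is its arity); $f(v_1)\cdots(v_k)$ is always observable or $\bot$, and is $\bot$ if some $v_i=\bot$; and if $k=0$ then the type of $\underline f$ is basic and $f$ is observable. *Operational semantics.* Below, $\underline a,\underline{a_j}$ range over zero-ary constants of basic types. Weak evaluation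 contexts $E^0$, evaluation contexts $E$ and values $V$ are $$E^0::=[\,]\mid\mathsf{score}\,E^0\mid E^0N\mid\mathsf{do}\,x\leftarrow E^0;N\mid\underline f\,\underline{a_1}\cdots\underline{a_{i-1}}\,E^0\ (i\le\alpha(\underline f))\mid\mathsf{case}\,E^0NP\mid\pi_iE^0,$$ $$E::=E^0\mid\mathsf{ret}\,E\mid\langle E,M\rangle\mid\langle V,E\rangle\mid\iota_iE,$$ $$V::=\underline a\mid\lambda x.M\mid\mathsf{ret}\,V\mid\langle V,V\rangle\mid\iota_iV\mid\underline f\,\underline{a_1}\cdots\underline{a_i}\ (i<\alpha(\underline f)).$$ The map $Next$ sends each generalized term to a continuous valuation on the space of generalized terms (of the same type): - $Next(E^0[\mathsf{sample}[\mu]])(U)=\mu\{t\in\mathbb R\mid E^0[\mathsf{ret}\,\underline{[t,t]}]\in U\}$; - $Next(E^0[\mathsf{score}\,\underline{\mathbf a}])=|\mathbf a|\cdot\delta_{E^0[\mathsf{ret}\,\underline *]}$; - $Next(L)=\delta_R$ for each of the rules $L\to R$: $E^0[\mathsf{do}\,x\leftarrow\mathsf{ret}\,M;N]\to E^0[N[x:=M]]$,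 $E[\mathsf{rec}\,M]\to E[M(\mathsf{rec}\,M)]$, $E[(\lambda x.M)N]\to E[M[x:=N]]$, $E[\pi_1\langle M,N\rangle]\to E[M]$, $E[\pi_2\langle M,N\rangle]\to E[N]$, $E[\mathsf{case}(\iota_1M)NP]\to E[NM]$, $E[\mathsf{case}(\iota_2M)NP]\to E[PM]$, and $E[\underline f\,\underline{a_1}\cdots\underline{a_k}]\to E[\underline{f(a_1)\cdots(a_k)}]$ if $k=\alpha(\underline f)\ne0$ and $f(a_1)\cdots(a_k)$ is observable; - $Next(M)=0$ for every other $M$. A redex is a term of one of the forms on the left above (for the last rule, including its side condition); a blocked term is a term $E[\underline f\,\underline{a_1}\cdots\underline{a_k}]$ with $k=\alpha(\underline f)\neq 0$ and $f(a_1)\cdots(a_k)$ not observable; a normal form is a term that is neither a redex nor blocked. Put $Next^{\le0}(M)=\delta_M$ if $M$ is a normal form and $0$ otherwise, $Next^{\le1}=Next+Next^{\le0}$, $Next^{\le n+1}=(Next^{\le n})^\dagger\circ Next^{\le1}$ for $n\ge1$, and $Next^*(M)(W)=\sup_{n\ge1}Next^{\le n}(M)(W\cap Norm)$, where $Norm$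 is the (open) set of normal forms. **Theorem.** Let $\Sigma$ consist of strictly observable first-order constants. For every observable type $\beta$, every generalized ISPCF term $M:D\beta$, and every Scott-open subset $U$ of $[\![\beta]\!]$ all of whose elements are observable, the set $U'$ of terms $\mathsf{ret}\,V$, with $V:\beta$ a normal form such that $[\![V]\!]\in U$, is Scott-open in the space of generalized terms of type $D\beta$, and $$[\![M]\!](U)=Next^*(M)(U').$$ -/

import Mathlib

open Set MeasureTheory TopologicalSpace Topology
open scoped ENNReal NNReal

universe u

namespace ISPCF

/-! ### Dcpos, Scott-open sets -/

open Classical in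
/-- A partial order in which every directed set has a least upper bound, as a
`CompletePartialOrder` (a pointed dcpo). -/
@[reducible] noncomputable def cpoOfExists (X : Type*) [PartialOrder X]
    (h : ∀ d : Set X, DirectedOn (· ≤ ·) d → ∃ a, IsLUB d a) : CompletePartialOrder X :=
  letI : SupSet X := ⟨fun d =>
    if hd : DirectedOn (· ≤ ·) d then (h d hd).choose
    else (h ∅ (fun _ hx => hx.elim)).choose⟩
  CompletePartialOrder.ofLubOfDirected X fun d hd => by
    show IsLUB d (dite _ _ _)
    rw [dif_pos hd]
    exact (h d hd).choose_spec

/-- The lattice of Scott-open subsets of `X`. -/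
abbrev SOpens (X : Type*) [Preorder X] := @Opens X (Topology.scott X univ)

section Scott
variable {X Y : Type*} [Preorder X] [Preorder Y]

/-- Scott-open subsets: upwards closed, and inaccessible by directed suprema. -/
abbrev IsScottOpen (s : Set X) : Prop := @IsOpen X (Topology.scott X univ) s

theorem isScottOpen_iff {s : Set X} : IsScottOpen s ↔
    IsUpperSet s ∧ ∀ d : Set X, d.Nonempty → DirectedOn (· ≤ ·) d → ∀ a, IsLUB d a → a ∈ s →
      (d ∩ s).Nonempty := by
  let _ : TopologicalSpace X := Topology.scott X univ
  have : Topology.IsScott X univ := ⟨rfl⟩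
  show IsOpen s ↔ _
  rw [Topology.IsScott.isOpen_iff_isUpperSet_and_dirSupInaccOn (D := univ)]
  constructor
  · rintro ⟨h1, h2⟩
    exact ⟨h1, fun d hd hd' a ha has => h2 (mem_univ _) hd hd' ha has⟩
  · rintro ⟨h1, h2⟩
    exact ⟨h1, fun d _ hd hd' a ha has => h2 d hd hd' a ha has⟩

theorem SOpens.upper (U : SOpens X) {x y : X} (h : x ≤ y) (hx : x ∈ U) : y ∈ U :=
  (isScottOpen_iff.1 (@Opens.is_open' X (Topology.scott X univ) U)).1 h hx

theorem SOpens.inacc (U : SOpens X) {d : Set X} (hd : d.Nonempty) (hd' : DirectedOn (· ≤ ·) d)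
    {a : X} (ha : IsLUB d a) (haU : a ∈ U) : ∃ x ∈ d, x ∈ U :=
  (isScottOpen_iff.1 (@Opens.is_open' X (Topology.scott X univ) U)).2 d hd hd' a ha haU

theorem isScottOpen_level {h : X → ℝ≥0∞} (hh : ScottContinuous h) (r : ℝ≥0∞) :
    IsScottOpen {x | r < h x} := by
  rw [isScottOpen_iff]
  refine ⟨fun x y hxy hx => lt_of_lt_of_le hx (hh.monotone hxy), fun d hd hd' a ha hra => ?_⟩
  obtain ⟨_, ⟨x, hx, rfl⟩, hlt⟩ := (lt_isLUB_iff (hh hd hd' ha)).1 hra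
  exact ⟨x, hx, hlt⟩

theorem ScottContinuous.mk' {f : X → Y} (hm : Monotone f)
    (h : ∀ d : Set X, d.Nonempty → DirectedOn (· ≤ ·) d → ∀ a, IsLUB d a → ∀ b,
      (∀ x ∈ d, f x ≤ b) → f a ≤ b) : ScottContinuous f := by
  intro d hd hd' a ha
  refine ⟨?_, fun b hb => h d hd hd' a ha b fun x hx => hb ⟨x, hx, rfl⟩⟩
  rintro _ ⟨x, hx, rfl⟩
  exact hm (ha.1 hx)

end Scott

/-! ### Continuous valuations -/

/-- A continuous valuation on a poset `X` with its Scott topology: a strict, modular,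
Scott-continuous map from the Scott-open sets to `[0, ∞]`. -/
structure Val (X : Type*) [Preorder X] where
  toFun : SOpens X → ℝ≥0∞
  empty' : toFun ⊥ = 0
  modular' : ∀ U V, toFun (U ⊔ V) + toFun (U ⊓ V) = toFun U + toFun V
  cont' : ScottContinuous toFun

namespace Val
variable {X Y : Type*} [Preorder X] [Preorder Y]

instance : CoeFun (Val X) (fun _ => SOpens X → ℝ≥0∞) := ⟨Val.toFun⟩

@[ext] theorem ext {μ ν : Val X} (h : ∀ U, μ U = ν U) : μ = ν := by
  cases μ; cases ν; congr; exact funext h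

/-- The stochastic order. -/
instance : PartialOrder (Val X) :=
  PartialOrder.lift Val.toFun fun _ _ h => ext fun U => congrFun h U

theorem le_def {μ ν : Val X} : μ ≤ ν ↔ ∀ U, μ U ≤ ν U := Iff.rfl

theorem mono (ν : Val X) {U V : SOpens X} (h : U ≤ V) : ν U ≤ ν V := ν.cont'.monotone h

/-- Continuity on directed unions. -/
theorem iSup_eq {ι : Type*} [Nonempty ι] (ν : Val X) (U : ι → SOpens X)
    (hU : Directed (· ≤ ·) U) : ν (⨆ i, U i) = ⨆ i, ν (U i) := by
  have := ν.cont' (range_nonempty U) hU.directedOn_range (isLUB_iSup)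
  rw [← range_comp] at this
  exact (this.iSup_eq).symm

theorem cont_of_iSup (f : SOpens X → ℝ≥0∞)
    (h : ∀ (d : Set (SOpens X)), d.Nonempty → DirectedOn (· ≤ ·) d →
      f (sSup d) = ⨆ U : d, f U) : ScottContinuous f := by
  intro d hd hd' a ha
  rw [← ha.sSup_eq, h d hd hd', ← sSup_image']
  exact isLUB_sSup _

instance : Zero (Val X) := ⟨⟨fun _ => 0, rfl, by simp, ScottContinuous.const 0⟩⟩

theorem directed_iSup_eq (ν : Val X) (d : Set (SOpens X)) (hd : d.Nonempty)
    (hd' : DirectedOn (· ≤ ·) d) : ν (sSup d) = ⨆ U : d, ν U := by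
  have := hd.to_subtype
  rw [sSup_eq_iSup', ν.iSup_eq _ hd'.directed_val]

instance : Add (Val X) := ⟨fun μ ν => ⟨fun U => μ U + ν U, by simp [empty'], fun U V => by
    have h1 := μ.modular' U V
    have h2 := ν.modular' U V
    calc _ = (μ (U ⊔ V) + μ (U ⊓ V)) + (ν (U ⊔ V) + ν (U ⊓ V)) := by ring
      _ = _ := by rw [h1, h2]; ring, cont_of_iSup _ fun d hd hd' => by
    rw [μ.directed_iSup_eq d hd hd', ν.directed_iSup_eq d hd hd',
      ENNReal.iSup_add_iSup]
    rintro ⟨U, hU⟩ ⟨V, hV⟩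
    obtain ⟨W, hW, h1, h2⟩ := hd' U hU V hV
    exact ⟨⟨W, hW⟩, add_le_add (μ.mono h1) (ν.mono h2)⟩⟩⟩

/-- Multiplication by an element of `[0, ∞]`, with `0 * ∞ = 0`. -/
noncomputable instance : SMul ℝ≥0∞ (Val X) := ⟨fun r μ => ⟨fun U => r * μ U, by simp [empty'],
  fun U V => by rw [← mul_add, μ.modular', mul_add], cont_of_iSup _ fun d hd hd' => by
    rw [μ.directed_iSup_eq d hd hd', ENNReal.mul_iSup]⟩⟩

open Classical in
/-- The Dirac valuation at `x`. -/
noncomputable def dirac (x : X) : Val X where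
  toFun U := if x ∈ U then 1 else 0
  empty' := by simp
  modular' U V := by
    by_cases h1 : x ∈ U <;> by_cases h2 : x ∈ V <;> simp [h1, h2]
  cont' := cont_of_iSup _ fun d hd hd' => by
    have key : x ∈ sSup d ↔ ∃ U ∈ d, x ∈ U := by simp
    by_cases h : x ∈ sSup d
    · rw [if_pos h]
      obtain ⟨U, hU, hx⟩ := key.1 h
      refine le_antisymm ?_ (iSup_le fun U => by split_ifs <;> simp)
      exact le_iSup_of_le ⟨U, hU⟩ (by simp [hx])
    · rw [if_neg h]
      symm
      rw [ENNReal.iSup_eq_zero]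
      rintro ⟨U, hU⟩
      exact if_neg fun hx => h (key.2 ⟨U, hU, hx⟩)

@[simp] theorem zero_apply (U : SOpens X) : (0 : Val X) U = 0 := rfl
@[simp] theorem add_apply (μ ν : Val X) (U : SOpens X) : (μ + ν) U = μ U + ν U := rfl
@[simp] theorem smul_apply (r : ℝ≥0∞) (μ : Val X) (U : SOpens X) : (r • μ) U = r * μ U := rfl
open Classical in
theorem dirac_apply (x : X) (U : SOpens X) : dirac x U = if x ∈ U then 1 else 0 := rfl

/-- Pointwise supremum of a directed set of continuous valuations. -/
noncomputable def dsup (d : Set (Val X)) (hd : DirectedOn (· ≤ ·) d) : Val X where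
  toFun U := ⨆ ν : d, ν.1 U
  empty' := by simp [empty']
  modular' U V := by
    have hdir : ∀ A B : SOpens X, (⨆ ν : d, ν.1 A) + (⨆ ν : d, ν.1 B)
        = ⨆ ν : d, (ν.1 A + ν.1 B) := fun A B => by
      apply ENNReal.iSup_add_iSup
      rintro ⟨μ, hμ⟩ ⟨ν, hν⟩
      obtain ⟨ξ, hξ, h1, h2⟩ := hd μ hμ ν hν
      exact ⟨⟨ξ, hξ⟩, add_le_add (h1 A) (h2 B)⟩
    rw [hdir, hdir]
    exact iSup_congr fun ν => ν.1.modular' U V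
  cont' := cont_of_iSup _ fun e he he' => by
    rw [iSup_comm]
    exact iSup_congr fun ν => ν.1.directed_iSup_eq e he he'

theorem dsup_isLUB (d : Set (Val X)) (hd : DirectedOn (· ≤ ·) d) : IsLUB d (dsup d hd) :=
  ⟨fun ν hν U => le_iSup (fun ν : d => ν.1 U) ⟨ν, hν⟩,
    fun _ h U => iSup_le fun ν : d => h ν.2 U⟩

theorem isLUB_apply {d : Set (Val X)} (hd : DirectedOn (· ≤ ·) d) {μ : Val X} (h : IsLUB d μ)
    (U : SOpens X) : μ U = ⨆ ν : d, ν.1 U := by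
  rw [h.unique (dsup_isLUB d hd)]; rfl

/-- The simple valuations are the finite linear combinations of Dirac valuations with
coefficients in `[0, ∞)`. -/
def IsSimple (ν : Val X) : Prop :=
  ∃ l : List (ℝ≥0 × X), ν = (l.map fun p => (p.1 : ℝ≥0∞) • dirac p.2).sum

/-- The minimal valuations: the smallest set of continuous valuations that contains the simple
ones and is closed under suprema of (nonempty) directed families. -/
inductive IsMinimal : Val X → Prop
  | simple (ν : Val X) : IsSimple ν → IsMinimal ν
  | sup (d : Set (Val X)) (ν : Val X) : d.Nonempty → DirectedOn (· ≤ ·) d →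
      (∀ μ ∈ d, IsMinimal μ) → IsLUB d ν → IsMinimal ν

theorem IsSimple.add {μ ν : Val X} (hμ : IsSimple μ) (hν : IsSimple ν) : IsSimple (μ + ν) := by
  obtain ⟨l, rfl⟩ := hμ
  obtain ⟨m, rfl⟩ := hν
  refine ⟨l ++ m, ?_⟩
  rw [List.map_append]
  induction l with
  | nil => ext U; simp
  | cons p l ih =>
    simp only [List.map_cons, List.sum_cons, List.cons_append, ← ih]
    ext U; simp [add_assoc]

theorem isSimple_zero : IsSimple (0 : Val X) := ⟨[], rfl⟩

theorem isSimple_smul_dirac (r : ℝ≥0) (x : X) : IsSimple ((r : ℝ≥0∞) • dirac x) :=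
  ⟨[(r, x)], by ext U; simp⟩

theorem isSimple_dirac (x : X) : IsSimple (dirac x) := by
  have := isSimple_smul_dirac 1 x
  rwa [show ((1 : ℝ≥0) : ℝ≥0∞) • dirac x = dirac x by ext U; simp] at this

/-- Minimality is preserved by maps that preserve directed suprema pointwise. -/
theorem isMinimal_map (F : Val X → Val Y) (hm : Monotone F)
    (hF : ∀ (d : Set (Val X)) (ν : Val X), d.Nonempty → DirectedOn (· ≤ ·) d → IsLUB d ν →
      ∀ U, F ν U ≤ ⨆ μ : d, F μ U)
    (hs : ∀ ν, IsSimple ν → IsMinimal (F ν)) {ν : Val X} (hν : IsMinimal ν) :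
    IsMinimal (F ν) := by
  induction hν with
  | simple ν h => exact hs ν h
  | sup d ν hd hd' _ hl ih =>
    refine .sup (F '' d) _ (hd.image F) ?_ (by rintro _ ⟨μ, hμ, rfl⟩; exact ih μ hμ) ⟨?_, ?_⟩
    · rintro _ ⟨μ, hμ, rfl⟩ _ ⟨μ', hμ', rfl⟩
      obtain ⟨ξ, hξ, h1, h2⟩ := hd' μ hμ μ' hμ'
      exact ⟨F ξ, ⟨ξ, hξ, rfl⟩, hm h1, hm h2⟩
    · rintro _ ⟨μ, hμ, rfl⟩
      exact hm (hl.1 hμ)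
    · intro b hb U
      exact (hF d ν hd hd' hl U).trans (iSup_le fun μ => hb ⟨μ.1, μ.2, rfl⟩ U)

theorem IsMinimal.add {μ ν : Val X} (hμ : IsMinimal μ) (hν : IsMinimal ν) :
    IsMinimal (μ + ν) := by
  refine isMinimal_map (fun μ => μ + ν) (fun a b h U => by
    simpa using add_le_add_left (h U) _) ?_ ?_ hμ
  · intro d ξ hd hd' hl U
    have := hd.to_subtype
    simp only [add_apply]
    rw [isLUB_apply hd' hl U, ENNReal.iSup_add]
  · intro μ hμ
    refine isMinimal_map (fun ν => μ + ν) (fun a b h U => by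
      simpa using add_le_add_right (h U) _) ?_ ?_ hν
    · intro d ξ hd hd' hl U
      have := hd.to_subtype
      simp only [add_apply]
      rw [isLUB_apply hd' hl U, ENNReal.add_iSup]
    · exact fun ν hν => .simple _ (hμ.add hν)

theorem IsMinimal.smul_dirac (r : ℝ≥0∞) (x : X) : IsMinimal (r • dirac x) := by
  induction r with
  | coe r => exact .simple _ (isSimple_smul_dirac r x)
  | top =>
    refine .sup (range fun n : ℕ => ((n : ℝ≥0) : ℝ≥0∞) • dirac x) _ (range_nonempty _) ?_ ?_ ?_
    · refine Directed.directedOn_range (Monotone.directed_le fun m n h U => ?_)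
      simp only [smul_apply]
      gcongr
    · rintro _ ⟨n, rfl⟩
      exact .simple _ (isSimple_smul_dirac _ x)
    · constructor
      · rintro _ ⟨n, rfl⟩ U
        simp only [smul_apply]
        gcongr
        exact le_top
      · intro b hb U
        have : (⊤ : ℝ≥0∞) = ⨆ n : ℕ, (n : ℝ≥0∞) := ENNReal.iSup_natCast.symm
        simp only [smul_apply]
        rw [this, ENNReal.iSup_mul]
        exact iSup_le fun n => by simpa using hb ⟨n, rfl⟩ U

theorem IsMinimal.smul (r : ℝ≥0∞) {ν : Val X} (hν : IsMinimal ν) : IsMinimal (r • ν) := by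
  refine isMinimal_map (fun ν => r • ν) (fun a b h U => by
    simp only [smul_apply]; exact mul_le_mul_right (h U) r) ?_ ?_ hν
  · intro d ξ hd hd' hl U
    simp only [smul_apply]
    rw [isLUB_apply hd' hl U, ENNReal.mul_iSup]
  · rintro _ ⟨l, rfl⟩
    induction l with
    | nil => exact .simple _ ⟨[], by ext U; simp⟩
    | cons p l ih =>
      rw [List.map_cons, List.sum_cons]
      rw [show ∀ a b : Val X, r • (a + b) = r • a + r • b from fun a b => by
        ext U; simp [mul_add]]
      refine IsMinimal.add ?_ ih
      rw [show r • (p.1 : ℝ≥0∞) • dirac p.2 = (r * p.1) • dirac p.2 by ext U; simp [mul_assoc]]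
      exact .smul_dirac _ _

end Val

/-! ### Integration -/

section Integral
open Filter

/-- The open set `{x | t < h x}` (its interior, for a function `h` that is not known to be
lower semicontinuous). -/
noncomputable def level {X : Type*} [Preorder X] (h : X → ℝ≥0∞) (t : ℝ≥0∞) : SOpens X :=
  @Opens.interior X (Topology.scott X univ) {x | t < h x}

/-- The integral `∫ h dν`, by Choquet's formula `∫₀^∞ ν {x | t < h x} dt`. -/
noncomputable def Val.lint {X : Type*} [Preorder X] (ν : Val X) (h : X → ℝ≥0∞) : ℝ≥0∞ :=
  ∫⁻ t in Ioi (0 : ℝ), ν (level h (ENNReal.ofReal t))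

/-- Dyadic lower sums. -/
noncomputable def lowerSum (n : ℕ) (φ : ℝ → ℝ≥0∞) : ℝ≥0∞ :=
  ∑ k ∈ Finset.range (n * 2 ^ n), φ ((k + 1) / 2 ^ n) * ENNReal.ofReal (1 / 2 ^ n)

theorem lintegral_eq_lowerSum (φ : ℝ → ℝ≥0∞) (hφ : Antitone φ)
    (hr : ∀ t, 0 < t → ∀ c < φ t, ∃ s, t < s ∧ c < φ s) :
    ∫⁻ t in Ioi (0 : ℝ), φ t = ⨆ n, lowerSum n φ := by
  have hvol : ∀ (n k : ℕ), volume (Ioc ((k : ℝ) / 2 ^ n) ((k + 1) / 2 ^ n))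
      = ENNReal.ofReal (1 / 2 ^ n) := fun n k => by
    rw [Real.volume_Ioc]; congr 1; ring
  apply le_antisymm
  · set s : ℕ → ℝ → ℝ≥0∞ := fun n t => ∑ k ∈ Finset.range (n * 2 ^ n),
      (Ioc ((k : ℝ) / 2 ^ n) ((k + 1) / 2 ^ n)).indicator (fun _ => φ ((k + 1) / 2 ^ n)) t with hs
    have hsm : ∀ n, Measurable (s n) := fun n =>
      Finset.measurable_sum _ fun k _ => measurable_const.indicator measurableSet_Ioc
    have hint : ∀ n, ∫⁻ t in Ioi (0 : ℝ), s n t ≤ lowerSum n φ := by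
      intro n
      rw [lintegral_finsetSum _ fun k _ => measurable_const.indicator measurableSet_Ioc]
      refine Finset.sum_le_sum fun k _ => ?_
      rw [lintegral_indicator_const measurableSet_Ioc, ← hvol n k]
      gcongr
      exact Measure.restrict_le_self
    calc ∫⁻ t in Ioi (0 : ℝ), φ t ≤ ∫⁻ t in Ioi (0 : ℝ), liminf (fun n => s n t) atTop := by
          refine setLIntegral_mono' measurableSet_Ioi fun t ht => ?_
          refine le_of_forall_lt fun c hc => ?_
          obtain ⟨c', hcc', hc'⟩ := exists_between hc
          refine lt_of_lt_of_le hcc' ?_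
          obtain ⟨u, htu, hcu⟩ := hr t ht c' hc'
          refine le_liminf_of_le (by isBoundedDefault) ?_
          obtain ⟨N, hN⟩ := exists_nat_gt t
          obtain ⟨N', hN'⟩ := exists_pow_lt_of_lt_one (sub_pos.2 htu) (by norm_num : (1/2:ℝ) < 1)
          filter_upwards [eventually_ge_atTop (max N N')] with n hn
          have hn1 : t < n := hN.trans_le (by exact_mod_cast (le_max_left _ _).trans hn)
          have hn2 : (1 / 2 : ℝ) ^ n < u - t := lt_of_le_of_lt
            (pow_le_pow_of_le_one (by norm_num) (by norm_num) ((le_max_right _ _).trans hn)) hN'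
          have h2 : (0 : ℝ) < 2 ^ n := by positivity
          have htp : (0 : ℝ) < t * 2 ^ n := mul_pos ht h2
          obtain ⟨k, hk⟩ : ∃ k, ⌈t * 2 ^ n⌉₊ = k + 1 :=
            Nat.exists_eq_succ_of_ne_zero (Nat.ceil_pos.2 htp).ne'
          have hk1 : t * 2 ^ n ≤ k + 1 := by
            have := Nat.le_ceil (t * 2 ^ n); rw [hk] at this; exact_mod_cast this
          have hk2 : (k : ℝ) < t * 2 ^ n := by
            have := Nat.ceil_lt_add_one htp.le; rw [hk] at this; push_cast at this; linarith
          have hmem : t ∈ Ioc ((k : ℝ) / 2 ^ n) ((k + 1) / 2 ^ n) :=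
            ⟨by rwa [div_lt_iff₀ h2], by rwa [le_div_iff₀ h2]⟩
          have hkr : k ∈ Finset.range (n * 2 ^ n) := by
            rw [Finset.mem_range]
            have : (k : ℝ) < n * 2 ^ n := hk2.trans (by gcongr)
            exact_mod_cast this
          have hku : ((k : ℝ) + 1) / 2 ^ n ≤ u := by
            rw [div_le_iff₀ h2]
            have : (1 / 2 : ℝ) ^ n * 2 ^ n = 1 := by rw [← mul_pow]; norm_num
            nlinarith
          calc c' ≤ φ u := hcu.le
            _ ≤ φ ((k + 1) / 2 ^ n) := hφ hku
            _ = (Ioc ((k : ℝ) / 2 ^ n) ((k + 1) / 2 ^ n)).indicator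
                  (fun _ => φ ((k + 1) / 2 ^ n)) t := by rw [indicator_of_mem hmem]
            _ ≤ s n t := Finset.single_le_sum
                  (f := fun k : ℕ => (Ioc ((k : ℝ) / 2 ^ n) ((k + 1) / 2 ^ n)).indicator
                    (fun _ => φ ((k + 1) / 2 ^ n)) t) (fun _ _ => zero_le) hkr
      _ ≤ liminf (fun n => ∫⁻ t in Ioi (0 : ℝ), s n t) atTop := lintegral_liminf_le hsm
      _ ≤ ⨆ n, lowerSum n φ := by
          refine (liminf_le_liminf (Eventually.of_forall hint)).trans ?_
          exact (liminf_le_liminf (v := fun _ => ⨆ n, lowerSum n φ)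
            (Eventually.of_forall fun n => le_iSup (fun n => lowerSum n φ) n)).trans
            (by simp)
  · refine iSup_le fun n => ?_
    have hdisj : Pairwise (Function.onFun Disjoint
        fun k : ℕ => Ioc ((k : ℝ) / 2 ^ n) ((k + 1) / 2 ^ n)) := by
      have := Monotone.pairwise_disjoint_on_Ioc_succ (f := fun k : ℕ => (k : ℝ) / 2 ^ n)
        (fun a b h => by dsimp only; gcongr)
      simpa using this
    calc lowerSum n φ ≤ ∑ k ∈ Finset.range (n * 2 ^ n),
          ∫⁻ t in Ioc ((k : ℝ) / 2 ^ n) ((k + 1) / 2 ^ n), φ t := by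
          refine Finset.sum_le_sum fun k _ => ?_
          rw [← hvol n k, ← setLIntegral_const]
          exact setLIntegral_mono' measurableSet_Ioc fun t ht => hφ ht.2
      _ = ∫⁻ t in ⋃ k ∈ Finset.range (n * 2 ^ n), Ioc ((k : ℝ) / 2 ^ n) ((k + 1) / 2 ^ n), φ t :=
          (lintegral_biUnion_finset (fun a _ b _ h => hdisj h)
            (fun _ _ => measurableSet_Ioc) _).symm
      _ ≤ ∫⁻ t in Ioi (0 : ℝ), φ t := by
          refine lintegral_mono_set (iUnion₂_subset fun k _ t ht => ?_)
          exact lt_of_le_of_lt (by positivity) ht.1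

variable {X Y : Type*} [Preorder X] [Preorder Y]

theorem mem_level {h : X → ℝ≥0∞} (hh : ScottContinuous h) {t : ℝ≥0∞} {x : X} :
    x ∈ level h t ↔ t < h x := by
  have := (isScottOpen_level hh t)
  show x ∈ @interior X (Topology.scott X univ) {x | t < h x} ↔ _
  rw [@IsOpen.interior_eq X (Topology.scott X univ) _ this]
  rfl

theorem SOpens.ext' {U V : SOpens X} (h : ∀ x, x ∈ U ↔ x ∈ V) : U = V := SetLike.ext h

theorem Val.lint_eq (ν : Val X) {h : X → ℝ≥0∞} (hh : ScottContinuous h) :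
    ν.lint h = ⨆ n, lowerSum n fun t => ν (level h (ENNReal.ofReal t)) := by
  refine lintegral_eq_lowerSum _ (fun s t hst => ν.mono fun x hx => ?_) fun t ht c hc => ?_
  · exact (mem_level hh).2 (lt_of_le_of_lt (ENNReal.ofReal_le_ofReal hst) ((mem_level hh).1 hx))
  · have hne : Nonempty (Ioi t) := ⟨⟨t + 1, by simp⟩⟩
    have : level h (ENNReal.ofReal t) = ⨆ s : Ioi t, level h (ENNReal.ofReal s) := by
      refine SOpens.ext' fun x => ?_
      simp only [Opens.mem_iSup, mem_level hh]
      constructor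
      · intro hx
        obtain ⟨r, hr, hr'⟩ := ENNReal.lt_iff_exists_real_btwn.1 hx
        exact ⟨⟨r, (ENNReal.ofReal_lt_ofReal_iff_of_nonneg ht.le).1 hr'.1⟩, hr'.2⟩
      · rintro ⟨s, hs⟩
        exact lt_of_le_of_lt (ENNReal.ofReal_le_ofReal (le_of_lt s.2)) hs
    rw [this, ν.iSup_eq] at hc
    · obtain ⟨s, hs⟩ := lt_iSup_iff.1 hc
      exact ⟨s, s.2, hs⟩
    · intro a b
      refine ⟨min a b, ?_, ?_⟩ <;> intro x hx <;> refine (mem_level hh).2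
        (lt_of_le_of_lt (ENNReal.ofReal_le_ofReal ?_) ((mem_level hh).1 hx))
      · exact min_le_left a b
      · exact min_le_right a b

theorem Val.lint_mono {μ ν : Val X} (hμν : μ ≤ ν) {g h : X → ℝ≥0∞} (hgh : ∀ x, g x ≤ h x) :
    μ.lint g ≤ ν.lint h := by
  refine lintegral_mono fun t => (hμν _).trans (ν.mono ?_)
  exact @interior_mono X (Topology.scott X univ) _ _ fun x hx => lt_of_lt_of_le hx (hgh x)

theorem lowerSum_iSup {ι : Type*} (n : ℕ) (φ : ι → ℝ → ℝ≥0∞)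
    (hφ : Directed (fun f g => ∀ t, f t ≤ g t) φ) :
    lowerSum n (fun t => ⨆ i, φ i t) = ⨆ i, lowerSum n (φ i) := by
  unfold lowerSum
  simp only [ENNReal.iSup_mul]
  exact ENNReal.finsetSum_iSup fun i j => (hφ i j).imp fun k hk a =>
    ⟨by gcongr; exact hk.1 _, by gcongr; exact hk.2 _⟩

/-- The integral commutes with directed suprema of functions. -/
theorem Val.lint_iSup_fun {ι : Type*} [Nonempty ι] (ν : Val X) (h : ι → X → ℝ≥0∞)
    (hh : ∀ i, ScottContinuous (h i)) (hd : Directed (· ≤ ·) h) {g : X → ℝ≥0∞}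
    (hg : ScottContinuous g) (hgh : ∀ x, g x = ⨆ i, h i x) :
    ν.lint g = ⨆ i, ν.lint (h i) := by
  have hl : ∀ t, ν (level g t) = ⨆ i, ν (level (h i) t) := fun t => by
    rw [← ν.iSup_eq]
    · congr 1
      refine SOpens.ext' fun x => ?_
      simp [mem_level hg, mem_level (hh _), hgh, lt_iSup_iff]
    · intro i j
      obtain ⟨k, h1, h2⟩ := hd i j
      exact ⟨k, fun x hx => (mem_level (hh k)).2 (((mem_level (hh i)).1 hx).trans_le (h1 x)),
        fun x hx => (mem_level (hh k)).2 (((mem_level (hh j)).1 hx).trans_le (h2 x))⟩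
  simp only [ν.lint_eq hg, ν.lint_eq (hh _), hl]
  rw [iSup_comm]
  refine iSup_congr fun n => lowerSum_iSup n _ fun i j => ?_
  obtain ⟨k, h1, h2⟩ := hd i j
  exact ⟨k, fun t => ν.mono fun x hx =>
      (mem_level (hh k)).2 (((mem_level (hh i)).1 hx).trans_le (h1 x)),
    fun t => ν.mono fun x hx =>
      (mem_level (hh k)).2 (((mem_level (hh j)).1 hx).trans_le (h2 x))⟩

/-- The integral commutes with directed suprema of valuations. -/
theorem Val.lint_iSup_val {ι : Type*} (ν : ι → Val X) (hd : Directed (· ≤ ·) ν) {μ : Val X}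
    (hμ : ∀ U, μ U = ⨆ i, ν i U) {h : X → ℝ≥0∞} (hh : ScottContinuous h) :
    μ.lint h = ⨆ i, (ν i).lint h := by
  simp only [Val.lint_eq _ hh, hμ]
  rw [iSup_comm]
  refine iSup_congr fun n => lowerSum_iSup n _ fun i j => ?_
  obtain ⟨k, h1, h2⟩ := hd i j
  exact ⟨k, fun t => h1 _, fun t => h2 _⟩

theorem Val.lint_zero (h : X → ℝ≥0∞) : (0 : Val X).lint h = 0 := by simp [Val.lint]

theorem Val.antitone_level (ν : Val X) (h : X → ℝ≥0∞) :
    Antitone fun t : ℝ => ν (level h (ENNReal.ofReal t)) := fun _ _ hst => ν.mono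
  (@interior_mono X (Topology.scott X univ) _ _ fun _ hx =>
    lt_of_le_of_lt (ENNReal.ofReal_le_ofReal hst) hx)

theorem Val.lint_add (μ ν : Val X) (h : X → ℝ≥0∞) :
    (μ + ν).lint h = μ.lint h + ν.lint h := by
  simp only [Val.lint, Val.add_apply]
  exact lintegral_add_left (μ.antitone_level h).measurable _

theorem Val.lint_smul (r : ℝ≥0∞) (ν : Val X) (h : X → ℝ≥0∞) :
    (r • ν).lint h = r * ν.lint h := by
  simp only [Val.lint, Val.smul_apply]
  exact lintegral_const_mul _ (ν.antitone_level h).measurable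

theorem Val.lint_dirac (x : X) {h : X → ℝ≥0∞} (hh : ScottContinuous h) :
    (dirac x).lint h = h x := by
  have : ∀ t : ℝ, dirac x (level h (ENNReal.ofReal t))
      = {t : ℝ | ENNReal.ofReal t < h x}.indicator 1 t := fun t => by
    simp [dirac_apply, mem_level hh, indicator_apply]
  simp only [Val.lint, this]
  have hm : MeasurableSet {t : ℝ | ENNReal.ofReal t < h x} :=
    measurableSet_lt ENNReal.measurable_ofReal measurable_const
  rw [lintegral_indicator_one hm, Measure.restrict_apply hm]
  rcases eq_or_ne (h x) ⊤ with h' | h'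
  · simp [h', Real.volume_Ioi]
  · have : {t : ℝ | ENNReal.ofReal t < h x} ∩ Ioi 0 = Ioo 0 (h x).toReal := by
      ext t
      simp only [mem_inter_iff, mem_ofPred_eq, mem_Ioi, mem_Ioo]
      rw [and_comm]
      refine and_congr_right fun ht => ?_
      rw [← ENNReal.ofReal_lt_ofReal_iff_of_nonneg ht.le, ENNReal.ofReal_toReal h']
    rw [this, Real.volume_Ioo, sub_zero, ENNReal.ofReal_toReal h']

end Integral

/-! ### The domain constructions -/

section Lifts
variable {X Y Z : Type*}

/-- Every nonempty directed subset has a least upper bound. -/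
class IsDcpo (X : Type*) [Preorder X] : Prop where
  exists_lub : ∀ d : Set X, d.Nonempty → DirectedOn (· ≤ ·) d → ∃ a, IsLUB d a

theorem isLUB_coe [Preorder X] {d : Set X} (hd : d.Nonempty) {a : X} (ha : IsLUB d a) :
    IsLUB ((↑) '' d : Set (WithBot X)) (a : WithBot X) := by
  refine ⟨?_, fun b hb => ?_⟩
  · rintro _ ⟨x, hx, rfl⟩
    exact WithBot.coe_le_coe.2 (ha.1 hx)
  · obtain ⟨x, hx⟩ := hd
    induction b with
    | bot => exact absurd (hb ⟨x, hx, rfl⟩) (by simp)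
    | coe b => exact WithBot.coe_le_coe.2 (ha.2 fun y hy => WithBot.coe_le_coe.1 (hb ⟨y, hy, rfl⟩))

theorem scottContinuous_coe [Preorder X] : ScottContinuous ((↑) : X → WithBot X) :=
  fun _ hd _ _ ha => isLUB_coe hd ha

/-- The nonbottom part of a directed subset of a lift. -/
theorem directedOn_preimage_coe [Preorder X] {d : Set (WithBot X)} (hd : DirectedOn (· ≤ ·) d) :
    DirectedOn (· ≤ ·) {x : X | (x : WithBot X) ∈ d} := by
  intro x hx y hy
  obtain ⟨z, hz, h1, h2⟩ := hd _ hx _ hy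
  induction z with
  | bot => simp at h1
  | coe z => exact ⟨z, hz, WithBot.coe_le_coe.1 h1, WithBot.coe_le_coe.1 h2⟩

theorem isLUB_of_coe [Preorder X] {d : Set (WithBot X)} {a : X} (ha : IsLUB d (a : WithBot X)) :
    {x : X | (x : WithBot X) ∈ d}.Nonempty ∧ IsLUB {x : X | (x : WithBot X) ∈ d} a := by
  refine ⟨?_, fun x hx => WithBot.coe_le_coe.1 (ha.1 hx), fun b hb => ?_⟩
  · by_contra h
    have : (a : WithBot X) ≤ ⊥ := ha.2 fun x hx => by
      induction x with
      | bot => exact le_rfl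
      | coe x => exact absurd ⟨x, hx⟩ h
    simp at this
  · refine WithBot.coe_le_coe.1 (ha.2 fun x hx => ?_)
    induction x with
    | bot => exact bot_le
    | coe x => exact WithBot.coe_le_coe.2 (hb hx)

/-- The lift of a dcpo is a pointed dcpo. -/
noncomputable instance liftCpo [PartialOrder X] [IsDcpo X] : CompletePartialOrder (WithBot X) :=
  cpoOfExists _ fun d hd => by
    by_cases h : {x : X | (x : WithBot X) ∈ d}.Nonempty
    · obtain ⟨a, ha⟩ := IsDcpo.exists_lub _ h (directedOn_preimage_coe hd)
      refine ⟨a, fun x hx => ?_, fun b hb => ?_⟩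
      · induction x with
        | bot => exact bot_le
        | coe x => exact WithBot.coe_le_coe.2 (ha.1 hx)
      · exact (isLUB_coe h ha).2 (by rintro _ ⟨x, hx, rfl⟩; exact hb hx)
    · refine ⟨⊥, fun x hx => ?_, fun _ _ => bot_le⟩
      induction x with
      | bot => exact le_rfl
      | coe x => exact absurd ⟨x, hx⟩ h

/-- Strict extension to the lift. -/
def strictExt [Bot Z] (f : X → Z) : WithBot X → Z := WithBot.recBotCoe ⊥ f

@[simp] theorem strictExt_bot [Bot Z] (f : X → Z) : strictExt f ⊥ = ⊥ := rfl
@[simp] theorem strictExt_coe [Bot Z] (f : X → Z) (x : X) : strictExt f (x : WithBot X) = f x :=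
  rfl

theorem strictExt_cont [Preorder X] [Preorder Z] [OrderBot Z] {f : X → Z}
    (hf : ScottContinuous f) : ScottContinuous (strictExt f) := by
  refine ScottContinuous.mk' (fun x y hxy => ?_) fun d hd hd' a ha b hb => ?_
  · induction x with
    | bot => exact bot_le
    | coe x =>
      induction y with
      | bot => simp at hxy
      | coe y => exact hf.monotone (WithBot.coe_le_coe.1 hxy)
  · induction a with
    | bot => exact bot_le
    | coe a =>
      obtain ⟨h1, h2⟩ := isLUB_of_coe ha
      refine (hf h1 (directedOn_preimage_coe hd') h2).2 ?_
      rintro _ ⟨x, hx, rfl⟩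
      exact hb _ hx

/-- A set with the discrete order. -/
@[ext] structure Flat (A : Type*) where
  val : A

instance (A : Type*) : PartialOrder (Flat A) where
  le a b := a = b
  le_refl _ := rfl
  le_trans _ _ _ := Eq.trans
  le_antisymm _ _ h _ := h

theorem Flat.le_iff {A : Type*} {a b : Flat A} : a ≤ b ↔ a = b := Iff.rfl

instance (A : Type*) : IsDcpo (Flat A) where
  exists_lub d hd hd' := by
    obtain ⟨a, ha⟩ := hd
    refine ⟨a, fun x hx => ?_, fun b hb => hb ha⟩
    obtain ⟨z, -, h1, h2⟩ := hd' x hx a ha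
    rw [Flat.le_iff] at *
    rw [h1, h2]

/-- Coproducts: `Sum` carries Mathlib's disjoint-sum order. -/
theorem directedOn_sum [Preorder X] [Preorder Y] {d : Set (X ⊕ Y)} (hd : DirectedOn (· ≤ ·) d)
    (hne : d.Nonempty) :
    (∃ e : Set X, e.Nonempty ∧ DirectedOn (· ≤ ·) e ∧ d = Sum.inl '' e) ∨
    (∃ e : Set Y, e.Nonempty ∧ DirectedOn (· ≤ ·) e ∧ d = Sum.inr '' e) := by
  obtain ⟨x | y, h0⟩ := hne
  · refine .inl ⟨Sum.inl ⁻¹' d, ⟨x, h0⟩, fun a ha b hb => ?_, ?_⟩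
    · obtain ⟨z | z, hz, h1, h2⟩ := hd _ ha _ hb
      · exact ⟨z, hz, Sum.inl_le_inl_iff.1 h1, Sum.inl_le_inl_iff.1 h2⟩
      · simp at h1
    · ext w
      rcases w with w | w
      · simp
      · simp only [mem_image, reduceCtorEq, and_false, exists_false, iff_false]
        intro hw
        obtain ⟨z | z, hz, h1, h2⟩ := hd _ h0 _ hw <;> simp at h1 h2
  · refine .inr ⟨Sum.inr ⁻¹' d, ⟨y, h0⟩, fun a ha b hb => ?_, ?_⟩
    · obtain ⟨z | z, hz, h1, h2⟩ := hd _ ha _ hb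
      · simp at h1
      · exact ⟨z, hz, Sum.inr_le_inr_iff.1 h1, Sum.inr_le_inr_iff.1 h2⟩
    · ext w
      rcases w with w | w
      · simp only [mem_image, reduceCtorEq, and_false, exists_false, iff_false]
        intro hw
        obtain ⟨z | z, hz, h1, h2⟩ := hd _ h0 _ hw <;> simp at h1 h2
      · simp

theorem isLUB_inl [Preorder X] [Preorder Y] {e : Set X} (he : e.Nonempty) {a : X}
    (ha : IsLUB e a) : IsLUB (Sum.inl '' e : Set (X ⊕ Y)) (Sum.inl a) := by
  refine ⟨by rintro _ ⟨x, hx, rfl⟩; exact Sum.inl_le_inl_iff.2 (ha.1 hx), ?_⟩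
  obtain ⟨x, hx⟩ := he
  rintro (b | b) hb
  · exact Sum.inl_le_inl_iff.2 (ha.2 fun y hy => Sum.inl_le_inl_iff.1 (hb ⟨y, hy, rfl⟩))
  · have := hb ⟨x, hx, rfl⟩; simp at this

theorem isLUB_inr [Preorder X] [Preorder Y] {e : Set Y} (he : e.Nonempty) {a : Y}
    (ha : IsLUB e a) : IsLUB (Sum.inr '' e : Set (X ⊕ Y)) (Sum.inr a) := by
  refine ⟨by rintro _ ⟨x, hx, rfl⟩; exact Sum.inr_le_inr_iff.2 (ha.1 hx), ?_⟩
  obtain ⟨x, hx⟩ := he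
  rintro (b | b) hb
  · have := hb ⟨x, hx, rfl⟩; simp at this
  · exact Sum.inr_le_inr_iff.2 (ha.2 fun y hy => Sum.inr_le_inr_iff.1 (hb ⟨y, hy, rfl⟩))

instance [PartialOrder X] [PartialOrder Y] [IsDcpo X] [IsDcpo Y] : IsDcpo (X ⊕ Y) where
  exists_lub d hne hd := by
    rcases directedOn_sum hd hne with ⟨e, he, he', rfl⟩ | ⟨e, he, he', rfl⟩
    · obtain ⟨a, ha⟩ := IsDcpo.exists_lub e he he'
      exact ⟨_, isLUB_inl he ha⟩
    · obtain ⟨a, ha⟩ := IsDcpo.exists_lub e he he'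
      exact ⟨_, isLUB_inr he ha⟩

instance (priority := 50) [CompletePartialOrder X] : IsDcpo X where
  exists_lub _ _ hd := ⟨_, hd.isLUB_sSup⟩

theorem sumElim_cont [Preorder X] [Preorder Y] [Preorder Z] {f : X → Z} {g : Y → Z}
    (hf : ScottContinuous f) (hg : ScottContinuous g) : ScottContinuous (Sum.elim f g) := by
  refine ScottContinuous.mk' ?_ fun d hd hd' a ha b hb => ?_
  · rintro (x | x) (y | y) h
    · exact hf.monotone (Sum.inl_le_inl_iff.1 h)
    · simp at h
    · simp at h
    · exact hg.monotone (Sum.inr_le_inr_iff.1 h)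
  · rcases directedOn_sum hd' hd with ⟨e, he, he', rfl⟩ | ⟨e, he, he', rfl⟩
    · rcases a with a | a
      · have hl : IsLUB e a := ⟨fun x hx => Sum.inl_le_inl_iff.1 (ha.1 ⟨x, hx, rfl⟩),
          fun c hc => Sum.inl_le_inl_iff.1 (ha.2 (by
            rintro _ ⟨x, hx, rfl⟩; exact Sum.inl_le_inl_iff.2 (hc hx)))⟩
        refine (hf he he' hl).2 ?_
        rintro _ ⟨x, hx, rfl⟩
        exact hb _ ⟨x, hx, rfl⟩
      · obtain ⟨x, hx⟩ := he
        have := ha.1 ⟨x, hx, rfl⟩; simp at this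
    · rcases a with a | a
      · obtain ⟨x, hx⟩ := he
        have := ha.1 ⟨x, hx, rfl⟩; simp at this
      · have hl : IsLUB e a := ⟨fun x hx => Sum.inr_le_inr_iff.1 (ha.1 ⟨x, hx, rfl⟩),
          fun c hc => Sum.inr_le_inr_iff.1 (ha.2 (by
            rintro _ ⟨x, hx, rfl⟩; exact Sum.inr_le_inr_iff.2 (hc hx)))⟩
        refine (hg he he' hl).2 ?_
        rintro _ ⟨x, hx, rfl⟩
        exact hb _ ⟨x, hx, rfl⟩

noncomputable instance prodCpo [CompletePartialOrder X] [CompletePartialOrder Y] :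
    CompletePartialOrder (X × Y) :=
  cpoOfExists _ fun d hd => by
    have h1 : DirectedOn (· ≤ ·) (Prod.fst '' d) := by
      rintro _ ⟨a, ha, rfl⟩ _ ⟨b, hb, rfl⟩
      obtain ⟨c, hc, h1, h2⟩ := hd a ha b hb
      exact ⟨_, ⟨c, hc, rfl⟩, h1.1, h2.1⟩
    have h2 : DirectedOn (· ≤ ·) (Prod.snd '' d) := by
      rintro _ ⟨a, ha, rfl⟩ _ ⟨b, hb, rfl⟩
      obtain ⟨c, hc, h1, h2⟩ := hd a ha b hb
      exact ⟨_, ⟨c, hc, rfl⟩, h1.2, h2.2⟩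
    exact ⟨(sSup (Prod.fst '' d), sSup (Prod.snd '' d)),
      isLUB_prod.2 ⟨h1.isLUB_sSup, h2.isLUB_sSup⟩⟩

noncomputable instance punitCpo : CompletePartialOrder PUnit.{1} :=
  cpoOfExists _ fun _ _ => ⟨⟨⟩, fun _ _ => le_rfl, fun _ _ => le_rfl⟩

end Lifts

/-! ### Scott-continuous maps -/

/-- The poset `[X → Y]` of Scott-continuous maps, ordered pointwise. -/
structure SCont (X Y : Type*) [Preorder X] [Preorder Y] where
  toFun : X → Y
  cont : ScottContinuous toFun

namespace SCont
variable {X Y Z : Type*} 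

instance [Preorder X] [Preorder Y] : CoeFun (SCont X Y) (fun _ => X → Y) := ⟨SCont.toFun⟩

@[ext] theorem ext [Preorder X] [Preorder Y] {f g : SCont X Y} (h : ∀ x, f x = g x) : f = g := by
  cases f; cases g; congr; exact funext h

instance [Preorder X] [PartialOrder Y] : PartialOrder (SCont X Y) :=
  PartialOrder.lift SCont.toFun fun _ _ h => ext fun x => congrFun h x

theorem le_def [Preorder X] [PartialOrder Y] {f g : SCont X Y} : f ≤ g ↔ ∀ x, f x ≤ g x := Iff.rfl

theorem directedOn_apply [Preorder X] [PartialOrder Y] {d : Set (SCont X Y)}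
    (hd : DirectedOn (· ≤ ·) d) (x : X) :
    DirectedOn (· ≤ ·) ((fun f : SCont X Y => f x) '' d) := by
  rintro _ ⟨f, hf, rfl⟩ _ ⟨g, hg, rfl⟩
  obtain ⟨h, hh, h1, h2⟩ := hd f hf g hg
  exact ⟨_, ⟨h, hh, rfl⟩, h1 x, h2 x⟩

/-- Pointwise directed suprema. -/
theorem exists_lub [Preorder X] [CompletePartialOrder Y] (d : Set (SCont X Y))
    (hd : DirectedOn (· ≤ ·) d) : ∃ F : SCont X Y, IsLUB d F ∧
      ∀ x, IsLUB ((fun f : SCont X Y => f x) '' d) (F x) := by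
  have hl := fun x => (directedOn_apply hd x).isLUB_sSup
  refine ⟨⟨fun x => sSup ((fun f : SCont X Y => f x) '' d), ?_⟩, ⟨?_, ?_⟩, hl⟩
  · refine ScottContinuous.mk' (fun x y hxy => ?_) fun e he he' a ha b hb => ?_
    · refine (hl x).2 ?_
      rintro _ ⟨f, hf, rfl⟩
      exact (f.cont.monotone hxy).trans ((hl y).1 ⟨f, hf, rfl⟩)
    · refine (hl a).2 ?_
      rintro _ ⟨f, hf, rfl⟩
      refine (f.cont he he' ha).2 ?_
      rintro _ ⟨x, hx, rfl⟩
      exact ((hl x).1 ⟨f, hf, rfl⟩).trans (hb x hx)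
  · exact fun f hf x => (hl x).1 ⟨f, hf, rfl⟩
  · intro g hg x
    refine (hl x).2 ?_
    rintro _ ⟨f, hf, rfl⟩
    exact hg hf x

noncomputable instance [Preorder X] [CompletePartialOrder Y] :
    CompletePartialOrder (SCont X Y) :=
  cpoOfExists _ fun d hd => let ⟨F, h, _⟩ := exists_lub d hd; ⟨F, h⟩

theorem apply_cont [Preorder X] [CompletePartialOrder Y] (x : X) :
    ScottContinuous (fun f : SCont X Y => f x) := by
  intro d _ hd' a ha
  obtain ⟨F, h1, h2⟩ := exists_lub d hd'
  rw [ha.unique h1]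
  exact h2 x

/-- A map into `[X → Y]` is Scott-continuous if it is so pointwise. -/
theorem cont_of_apply [Preorder X] [PartialOrder Y] [Preorder Z] {F : Z → SCont X Y}
    (h : ∀ x, ScottContinuous fun z => F z x) : ScottContinuous F := by
  refine ScottContinuous.mk' (fun a b hab x => (h x).monotone hab) fun d hd hd' a ha b hb x => ?_
  refine (h x hd hd' ha).2 ?_
  rintro _ ⟨z, hz, rfl⟩
  exact hb z hz x

theorem eval_cont [Preorder X] [CompletePartialOrder Y] :
    ScottContinuous (fun p : SCont X Y × X => p.1 p.2) :=
  ScottContinuous.fromProd (fun f => f.cont) (fun x => apply_cont x)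

/-- The least fixed point `⨆ n, f^n ⊥`. -/
noncomputable def lfp [CompletePartialOrder X] (f : SCont X X) : X :=
  sSup (range fun n : ℕ => f.toFun^[n] ⊥)

theorem lfp_isLUB [CompletePartialOrder X] (f : SCont X X) :
    IsLUB (range fun n : ℕ => f.toFun^[n] ⊥) (lfp f) :=
  DirectedOn.isLUB_sSup (Directed.directedOn_range
    (monotone_nat_of_le_succ fun n => by
      rw [Function.iterate_succ_apply]
      exact (f.cont.monotone.iterate n) bot_le).directed_le)

theorem lfp_le [CompletePartialOrder X] (f : SCont X X) {a : X} (h : f a ≤ a) : lfp f ≤ a := by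
  refine (lfp_isLUB f).2 ?_
  rintro _ ⟨n, rfl⟩
  induction n with
  | zero => exact bot_le
  | succ n ih =>
    dsimp only
    rw [Function.iterate_succ_apply']
    exact (f.cont.monotone ih).trans h

theorem map_lfp_le [CompletePartialOrder X] (f : SCont X X) : f (lfp f) ≤ lfp f := by
  refine (f.cont (range_nonempty _) (Directed.directedOn_range
    (monotone_nat_of_le_succ fun n => by
      rw [Function.iterate_succ_apply]
      exact (f.cont.monotone.iterate n) bot_le).directed_le) (lfp_isLUB f)).2 ?_
  rintro _ ⟨_, ⟨n, rfl⟩, rfl⟩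
  refine (lfp_isLUB f).1 ⟨n + 1, ?_⟩
  dsimp only
  rw [Function.iterate_succ_apply']

theorem lfp_mono [CompletePartialOrder X] : Monotone (lfp (X := X)) := fun f g h =>
  lfp_le f ((h _).trans (map_lfp_le g))

theorem lfp_cont [CompletePartialOrder X] : ScottContinuous (lfp (X := X)) := by
  refine ScottContinuous.mk' lfp_mono fun d hd hd' f hf b hb => ?_
  have hdir : DirectedOn (· ≤ ·) (lfp '' d) := by
    rintro _ ⟨g, hg, rfl⟩ _ ⟨g', hg', rfl⟩
    obtain ⟨k, hk, h1, h2⟩ := hd' g hg g' hg'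
    exact ⟨_, ⟨k, hk, rfl⟩, lfp_mono h1, lfp_mono h2⟩
  have hl := hdir.isLUB_sSup
  have : lfp f ≤ sSup (lfp '' d) := by
    refine lfp_le f ((apply_cont _ hd hd' hf).2 ?_)
    rintro _ ⟨g, hg, rfl⟩
    refine (g.cont (hd.image _) hdir hl).2 ?_
    rintro _ ⟨_, ⟨g', hg', rfl⟩, rfl⟩
    obtain ⟨k, hk, h1, h2⟩ := hd' g hg g' hg'
    exact ((h1 _).trans (k.cont.monotone (lfp_mono h2))).trans
      ((map_lfp_le k).trans (hl.1 ⟨k, hk, rfl⟩))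
  refine this.trans (hl.2 ?_)
  rintro _ ⟨g, hg, rfl⟩
  exact hb g hg

end SCont

/-! ### The monad of minimal valuations -/

/-- The dcpo of minimal valuations on `X`. -/
structure MVal (X : Type*) [Preorder X] where
  val : Val X
  isMinimal : val.IsMinimal

namespace MVal
variable {X Y : Type*}

instance [Preorder X] : PartialOrder (MVal X) :=
  PartialOrder.lift MVal.val fun μ ξ h => by cases μ; cases ξ; congr

instance [Preorder X] : CoeFun (MVal X) (fun _ => SOpens X → ℝ≥0∞) := ⟨fun ν => ν.1.toFun⟩

theorem exists_lub [Preorder X] (d : Set (MVal X)) (hd : DirectedOn (· ≤ ·) d) :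
    ∃ ν : MVal X, IsLUB d ν ∧ ∀ U, ν U = ⨆ μ : d, μ.1 U := by
  rcases d.eq_empty_or_nonempty with rfl | hne
  · exact ⟨⟨0, .simple _ Val.isSimple_zero⟩,
      ⟨fun _ h => h.elim, fun μ _ U => (zero_le : (0 : ℝ≥0∞) ≤ μ U)⟩, by simp⟩
  · have hd' : DirectedOn (· ≤ ·) (MVal.val '' d : Set (Val X)) := by
      rintro _ ⟨a, ha, rfl⟩ _ ⟨b, hb, rfl⟩
      obtain ⟨c, hc, h1, h2⟩ := hd a ha b hb
      exact ⟨_, ⟨c, hc, rfl⟩, h1, h2⟩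
    have hl := Val.dsup_isLUB _ hd'
    refine ⟨⟨_, .sup _ _ (hne.image _) hd' (by rintro _ ⟨μ, _, rfl⟩; exact μ.isMinimal) hl⟩,
      ⟨fun μ hμ => hl.1 ⟨μ, hμ, rfl⟩, fun b hb => hl.2 ?_⟩, fun U => ?_⟩
    · rintro _ ⟨μ, hμ, rfl⟩
      exact hb hμ
    · exact le_antisymm (iSup_le (by rintro ⟨_, μ, hμ, rfl⟩; exact le_iSup_of_le ⟨μ, hμ⟩ le_rfl))
        (iSup_le fun μ => hl.1 ⟨μ.1, μ.2, rfl⟩ U)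

noncomputable instance [Preorder X] : CompletePartialOrder (MVal X) :=
  cpoOfExists _ fun d hd => let ⟨F, h, _⟩ := exists_lub d hd; ⟨F, h⟩

theorem isLUB_apply [Preorder X] {d : Set (MVal X)} (hd : DirectedOn (· ≤ ·) d) {ν : MVal X}
    (h : IsLUB d ν) (U : SOpens X) : ν U = ⨆ μ : d, μ.1 U := by
  obtain ⟨ξ, h1, h2⟩ := exists_lub d hd
  rw [h.unique h1, h2]

theorem apply_cont [Preorder X] (U : SOpens X) : ScottContinuous fun ν : MVal X => ν U := by
  intro d _ hd' a ha
  dsimp only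
  rw [isLUB_apply hd' ha U, ← sSup_image' (f := fun ν : MVal X => ν U)]
  exact isLUB_sSup _

/-- A map into minimal valuations is Scott-continuous if it is so at every open set. -/
theorem cont_of_apply [Preorder X] [Preorder Y] {F : X → MVal Y}
    (h : ∀ U, ScottContinuous fun x => F x U) : ScottContinuous F := by
  refine ScottContinuous.mk' (fun a b hab U => (h U).monotone hab) fun d hd hd' a ha b hb U => ?_
  refine (h U hd hd' ha).2 ?_
  rintro _ ⟨z, hz, rfl⟩
  exact hb z hz U

/-- The unit of the monad. -/
noncomputable def unit [Preorder X] (x : X) : MVal X :=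
  ⟨Val.dirac x, .simple _ (Val.isSimple_dirac x)⟩

theorem unit_cont [Preorder X] : ScottContinuous (unit (X := X)) := by
  refine cont_of_apply fun U => ScottContinuous.mk' (fun x y h => ?_) fun d hd hd' a ha b hb => ?_
  · show Val.dirac x U ≤ Val.dirac y U
    rw [Val.dirac_apply, Val.dirac_apply]
    split_ifs with h1 h2
    · exact le_rfl
    · exact absurd (U.upper h h1) h2
    · exact zero_le
    · exact le_rfl
  · show Val.dirac a U ≤ b
    rw [Val.dirac_apply]
    split_ifs with h1
    · obtain ⟨x, hx, hxU⟩ := U.inacc hd hd' ha h1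
      refine le_trans ?_ (hb x hx)
      show _ ≤ Val.dirac x U
      rw [Val.dirac_apply, if_pos hxU]
    · exact zero_le

variable [Preorder X] [Preorder Y]

theorem eval_scont (f : SCont X (MVal Y)) (V : SOpens Y) : ScottContinuous fun x => f x V :=
  ScottContinuous.comp f.cont (apply_cont V)

theorem exists_bind (f : SCont X (MVal Y)) {μ : Val X} (hμ : μ.IsMinimal) :
    ∃ ξ : Val Y, ξ.IsMinimal ∧ ∀ V, ξ V = μ.lint fun x => f x V := by
  induction hμ with
  | simple μ h =>
    obtain ⟨l, rfl⟩ := h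
    induction l with
    | nil => exact ⟨0, .simple _ Val.isSimple_zero, fun V => (Val.lint_zero _).symm⟩
    | cons p l ih =>
      obtain ⟨ξ, h1, h2⟩ := ih
      refine ⟨(p.1 : ℝ≥0∞) • (f p.2).1 + ξ, .add (.smul _ (f p.2).isMinimal) h1, fun V => ?_⟩
      rw [List.map_cons, List.sum_cons, Val.lint_add, Val.lint_smul,
        Val.lint_dirac _ (eval_scont f V), ← h2]
      rfl
  | sup d μ hd hd' _ hl ih =>
    choose! g hg1 hg2 using ih
    have hm : ∀ ν ∈ d, ∀ ν' ∈ d, ν ≤ ν' → g ν ≤ g ν' := fun ν hν ν' hν' h V => by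
      rw [hg2 ν hν, hg2 ν' hν']; exact Val.lint_mono h fun _ => le_rfl
    have hdir : DirectedOn (· ≤ ·) (g '' d) := by
      rintro _ ⟨a, ha, rfl⟩ _ ⟨b, hb, rfl⟩
      obtain ⟨c, hc, h1, h2⟩ := hd' a ha b hb
      exact ⟨_, ⟨c, hc, rfl⟩, hm a ha c hc h1, hm b hb c hc h2⟩
    refine ⟨Val.dsup _ hdir, .sup _ _ (hd.image g) hdir
      (by rintro _ ⟨ν, hν, rfl⟩; exact hg1 ν hν) (Val.dsup_isLUB _ hdir), fun V => ?_⟩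
    rw [Val.lint_iSup_val (fun ν : d => ν.1) hd'.directed_val
      (Val.isLUB_apply hd' hl) (eval_scont f V)]
    show (⨆ ν : (g '' d), ν.1 V) = _
    rw [← sSup_image' (f := fun ν : Val Y => ν V), sSup_image, iSup_image, iSup_subtype']
    exact iSup_congr fun ν => hg2 ν ν.2 V

/-- The extension `f† μ` of `f : X → MVal Y` at `μ`, namely `V ↦ ∫ f(x)(V) dμ`. -/
noncomputable def bind (f : SCont X (MVal Y)) (μ : MVal X) : MVal Y :=
  have key : ∃ ξ : Val Y, ξ.IsMinimal ∧ ξ.toFun = fun V => μ.1.lint fun x => f x V :=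
    (exists_bind f μ.isMinimal).imp fun _ h => ⟨h.1, funext h.2⟩
  ⟨{ toFun := fun V => μ.1.lint fun x => f x V
     empty' := by obtain ⟨ξ, -, h⟩ := key; simpa [h] using ξ.empty'
     modular' := by obtain ⟨ξ, -, h⟩ := key; simpa [h] using ξ.modular'
     cont' := by obtain ⟨ξ, -, h⟩ := key; simpa [h] using ξ.cont' }, by
    obtain ⟨ξ, h1, h⟩ := key
    have : ∀ ζ : Val Y, ζ.toFun = ξ.toFun → ζ.IsMinimal := fun ζ hζ =>
      (Val.ext (congrFun hζ) : ζ = ξ) ▸ h1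
    exact this _ h.symm⟩

theorem bind_apply (f : SCont X (MVal Y)) (μ : MVal X) (V : SOpens Y) :
    bind f μ V = μ.1.lint fun x => f x V := rfl

theorem bind_cont :
    ScottContinuous fun p : SCont X (MVal Y) × MVal X => bind p.1 p.2 := by
  refine ScottContinuous.fromProd (fun f => cont_of_apply fun V => ?_)
    (fun μ => cont_of_apply fun V => ?_)
  · intro d hd hd' a ha
    simp only [bind_apply]
    have := Val.lint_iSup_val (fun ν : d => ν.1.1) (fun i j => hd'.directed_val i j)
      (fun U => isLUB_apply hd' ha U) (eval_scont f V)
    rw [this, ← sSup_image' (f := fun ν : MVal X => ν.1.lint fun x => f x V)]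
    exact isLUB_sSup _
  · intro d hd hd' F hF
    simp only [bind_apply]
    have := hd.to_subtype
    have := Val.lint_iSup_fun μ.1 (fun (f : d) x => f.1 x V) (fun f => eval_scont f.1 V)
      (fun i j => let ⟨k, h1, h2⟩ := hd'.directed_val i j; ⟨k, fun x => h1 x V, fun x => h2 x V⟩)
      (eval_scont F V) (fun x => by
        have h := isLUB_apply (SCont.directedOn_apply hd' x) (SCont.apply_cont x hd hd' hF) V
        rw [h, ← sSup_image' (f := fun ν : MVal Y => ν V), sSup_image, iSup_image, iSup_subtype'])
    rw [this, ← sSup_image' (f := fun f : SCont X (MVal Y) => μ.1.lint fun x => f x V)]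
    exact isLUB_sSup _

end MVal

/-! ### Exact reals -/

/-- The dcpo of compact intervals `[a, b]`, `a ≤ b`, ordered by reverse inclusion. -/
abbrev IR := (NonemptyInterval ℝ)ᵒᵈ

namespace IR

/-- The lower end of an interval. -/
def lo (a : IR) : ℝ := (OrderDual.ofDual a).fst
/-- The upper end of an interval. -/
def hi (a : IR) : ℝ := (OrderDual.ofDual a).snd
/-- The interval `[x, y]`. -/
def mk (x y : ℝ) (h : x ≤ y) : IR := OrderDual.toDual ⟨(x, y), h⟩
/-- The embedding `i : t ↦ [t, t]` of the real line. -/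
def point (t : ℝ) : IR := mk t t le_rfl

theorem le_iff {a b : IR} : a ≤ b ↔ a.lo ≤ b.lo ∧ b.hi ≤ a.hi := Iff.rfl
theorem lo_le_hi (a : IR) : a.lo ≤ a.hi := (OrderDual.ofDual a).fst_le_snd
@[simp] theorem lo_mk (x y : ℝ) (h : x ≤ y) : (mk x y h).lo = x := rfl
@[simp] theorem hi_mk (x y : ℝ) (h : x ≤ y) : (mk x y h).hi = y := rfl
@[simp] theorem lo_point (t : ℝ) : (point t).lo = t := rfl
@[simp] theorem hi_point (t : ℝ) : (point t).hi = t := rfl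

instance : IsDcpo IR where
  exists_lub d hd hd' := by
    have hbound : ∀ a ∈ d, ∀ b ∈ d, a.lo ≤ b.hi := fun a ha b hb => by
      obtain ⟨c, -, h1, h2⟩ := hd' a ha b hb
      exact (h1.1.trans c.lo_le_hi).trans h2.2
    obtain ⟨a₀, ha₀⟩ := hd
    have hL : IsLUB (lo '' d) (sSup (lo '' d)) := isLUB_csSup ⟨_, a₀, ha₀, rfl⟩
      ⟨a₀.hi, by rintro _ ⟨a, ha, rfl⟩; exact hbound a ha a₀ ha₀⟩
    have hH : IsGLB (hi '' d) (sInf (hi '' d)) := isGLB_csInf ⟨_, a₀, ha₀, rfl⟩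
      ⟨a₀.lo, by rintro _ ⟨a, ha, rfl⟩; exact hbound a₀ ha₀ a ha⟩
    have hle : sSup (lo '' d) ≤ sInf (hi '' d) := hL.2 (by
      rintro _ ⟨a, ha, rfl⟩
      refine hH.2 ?_
      rintro _ ⟨b, hb, rfl⟩
      exact hbound a ha b hb)
    refine ⟨mk _ _ hle, fun a ha => le_iff.2 ⟨hL.1 ⟨a, ha, rfl⟩, hH.1 ⟨a, ha, rfl⟩⟩, fun b hb => ?_⟩
    refine le_iff.2 ⟨hL.2 ?_, hH.2 ?_⟩
    · rintro _ ⟨a, ha, rfl⟩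
      exact (le_iff.1 (hb ha)).1
    · rintro _ ⟨a, ha, rfl⟩
      exact (le_iff.1 (hb ha)).2

open Classical in
/-- The absolute value of an exact real: the least absolute value of the numbers in the
interval. -/
noncomputable def abs (a : IR) : ℝ :=
  if 0 ≤ a.lo then a.lo else if a.hi ≤ 0 then -a.hi else 0

theorem ofReal_abs (a : IR) :
    ENNReal.ofReal a.abs = max (ENNReal.ofReal a.lo) (ENNReal.ofReal (-a.hi)) := by
  have := a.lo_le_hi
  unfold abs
  split_ifs with h1 h2
  · rw [max_eq_left (ENNReal.ofReal_le_ofReal (by linarith))]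
  · rw [max_eq_right (ENNReal.ofReal_le_ofReal (by linarith))]
  · rw [ENNReal.ofReal_zero, ENNReal.ofReal_of_nonpos (by linarith),
      ENNReal.ofReal_of_nonpos (by linarith), max_self]

theorem abs_cont : ScottContinuous fun a : IR => ENNReal.ofReal a.abs := by
  simp only [ofReal_abs]
  refine ScottContinuous.mk' (fun a b h => ?_) fun d hd hd' a ha b hb => ?_
  · rw [le_iff] at h
    exact max_le_max (ENNReal.ofReal_le_ofReal h.1) (ENNReal.ofReal_le_ofReal (by linarith))
  · rcases eq_or_ne b ⊤ with rfl | hbt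
    · exact le_top
    refine max_le ?_ ?_
    · have h1 : ∀ x ∈ d, x.lo ≤ b.toReal := fun x hx =>
        (ENNReal.ofReal_le_iff_le_toReal hbt).1 ((le_max_left _ _).trans (hb x hx))
      rw [ENNReal.ofReal_le_iff_le_toReal hbt]
      by_contra! h
      have : a ≤ mk b.toReal a.hi (h.le.trans a.lo_le_hi) :=
        ha.2 fun x hx => le_iff.2 ⟨h1 x hx, (le_iff.1 (ha.1 hx)).2⟩
      exact absurd (le_iff.1 this).1 (not_le.2 h)
    · have h1 : ∀ x ∈ d, -x.hi ≤ b.toReal := fun x hx =>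
        (ENNReal.ofReal_le_iff_le_toReal hbt).1 ((le_max_right _ _).trans (hb x hx))
      rw [ENNReal.ofReal_le_iff_le_toReal hbt]
      by_contra! h
      have : a ≤ mk a.lo (-b.toReal) (by have := a.lo_le_hi; linarith) :=
        ha.2 fun x hx => le_iff.2 ⟨(le_iff.1 (ha.1 hx)).1, by
          have := h1 x hx; simp only [hi_mk]; linarith⟩
      have := (le_iff.1 this).2
      simp only [hi_mk] at this
      linarith

/-- Scott-open sets of intervals restrict to open sets of reals. -/
theorem isOpen_preimage (U : SOpens IR) : IsOpen {t : ℝ | point t ∈ U} := by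
  rw [Metric.isOpen_iff]
  intro t ht
  have hpos : ∀ n : ℕ, (0 : ℝ) < 1 / (n + 1) := fun n => by positivity
  obtain ⟨_, ⟨n, rfl⟩, hn⟩ := U.inacc (a := point t) (d := range fun n : ℕ =>
      mk (t - 1 / (n + 1)) (t + 1 / (n + 1)) (by have := hpos n; linarith)) (range_nonempty _)
    (Directed.directedOn_range (Monotone.directed_le fun m n h => by
      have : (1 : ℝ) / (n + 1) ≤ 1 / (m + 1) := by gcongr
      exact le_iff.2 ⟨by simp only [lo_mk]; linarith, by simp only [hi_mk]; linarith⟩))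
    ⟨by rintro _ ⟨n, rfl⟩
        have := hpos n
        exact le_iff.2 ⟨by simp only [lo_mk, lo_point]; linarith,
          by simp only [hi_mk, hi_point]; linarith⟩,
      fun b hb => le_iff.2 ⟨by
        refine le_of_forall_pos_le_add fun ε hε => ?_
        obtain ⟨n, hn⟩ := exists_nat_one_div_lt hε
        have := (le_iff.1 (hb ⟨n, rfl⟩)).1
        simp only [lo_mk, lo_point] at *
        linarith, by
        refine le_of_forall_pos_le_add fun ε hε => ?_
        obtain ⟨n, hn⟩ := exists_nat_one_div_lt hε
        have := (le_iff.1 (hb ⟨n, rfl⟩)).2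
        simp only [hi_mk, hi_point] at *
        linarith⟩⟩ ht
  refine ⟨1 / (n + 1), hpos n, fun s hs => U.upper ?_ hn⟩
  rw [Metric.mem_ball, Real.dist_eq, abs_lt] at hs
  exact le_iff.2 ⟨by simp only [lo_mk, lo_point]; linarith [hs.1],
    by simp only [hi_mk, hi_point]; linarith [hs.2]⟩

end IR

theorem measure_biUnion_le_iSup {ι : Type*} [Nonempty ι] (μ : Measure ℝ) {T : Set ι}
    (hT : T.Countable) (s : ι → Set ℝ) (hs : Directed (· ⊆ ·) s) :
    μ (⋃ i ∈ T, s i) ≤ ⨆ i, μ (s i) := by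
  classical
  rcases T.eq_empty_or_nonempty with rfl | hne
  · simp
  · obtain ⟨u, rfl⟩ := hT.exists_eq_range hne
    rw [biUnion_range, measure_iUnion_eq_iSup_accumulate]
    refine iSup_le fun n => ?_
    obtain ⟨k, hk⟩ := hs.finset_le ((Finset.range (n + 1)).image u)
    refine le_iSup_of_le k (measure_mono ?_)
    refine iUnion₂_subset fun m hm => hk _ (Finset.mem_image.2 ⟨m, ?_, rfl⟩)
    simpa [Nat.lt_succ_iff] using hm

/-- The image valuation `U ↦ μ {t | g [t, t] ∈ U}` of a measure on the real line. -/
noncomputable def Val.ofMeasure {X : Type*} [Preorder X] (μ : Measure ℝ) (g : SCont IR X) :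
    Val X :=
  have hopen : ∀ U : SOpens X, IsOpen {t : ℝ | g (IR.point t) ∈ U} := fun U =>
    IR.isOpen_preimage (@Opens.mk IR (Topology.scott IR univ) {a | g a ∈ U}
      (isScottOpen_iff.2 ⟨fun _ _ h hx => U.upper (g.cont.monotone h) hx,
        fun d hd hd' a ha haU => by
          have hdir : DirectedOn (· ≤ ·) (g.toFun '' d) := hd'.mono_comp g.cont.monotone
          obtain ⟨_, ⟨x, hx, rfl⟩, h⟩ := U.inacc (hd.image _) hdir (g.cont hd hd' ha) haU
          exact ⟨x, hx, h⟩⟩))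
  { toFun := fun U => μ {t | g (IR.point t) ∈ U}
    empty' := by simp
    modular' := fun U V => by
      have h1 : {t : ℝ | g (IR.point t) ∈ U ⊔ V}
          = {t | g (IR.point t) ∈ U} ∪ {t | g (IR.point t) ∈ V} := by ext; simp
      have h2 : {t : ℝ | g (IR.point t) ∈ U ⊓ V}
          = {t | g (IR.point t) ∈ U} ∩ {t | g (IR.point t) ∈ V} := by ext; simp
      rw [h1, h2]
      exact measure_union_add_inter _ (hopen V).measurableSet
    cont' := Val.cont_of_iSup _ fun d hd hd' => by
      have hne := hd.to_subtype
      obtain ⟨T, hT, hTU⟩ := isOpen_iUnion_countable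
        (fun U : d => {t : ℝ | g (IR.point t) ∈ U.1}) fun U => hopen U.1
      have hU : {t : ℝ | g (IR.point t) ∈ sSup d} = ⋃ U : d, {t | g (IR.point t) ∈ U.1} := by
        ext; simp
      refine le_antisymm ?_ (iSup_le fun U => measure_mono fun t ht => ?_)
      · rw [hU, ← hTU]
        exact measure_biUnion_le_iSup μ hT _ fun i j => by
          obtain ⟨k, h1, h2⟩ := hd'.directed_val i j
          exact ⟨k, fun t ht => h1 ht, fun t ht => h2 ht⟩
      · rw [hU]; exact mem_iUnion.2 ⟨U, ht⟩ }

namespace Val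

theorem isMinimal_list {X : Type*} [Preorder X] (l : List (ℝ≥0∞ × X)) :
    IsMinimal (l.map fun p => p.1 • dirac p.2).sum := by
  induction l with
  | nil => exact .simple _ isSimple_zero
  | cons p l ih => exact .add (.smul_dirac _ _) ih

theorem list_sum_apply {X ι : Type*} [Preorder X] (l : List ι) (f : ι → Val X) (U : SOpens X) :
    (l.map f).sum U = (l.map fun i => f i U).sum := by
  induction l with
  | nil => rfl
  | cons p l ih => simp [ih]

/-- The image on the lifted interval domain of a measure on the real line is minimal. -/
theorem isMinimal_ofMeasure (μ : Measure ℝ) :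
    (ofMeasure μ ⟨((↑) : IR → WithBot IR), scottContinuous_coe⟩).IsMinimal := by
  classical
  set J : ℕ → ℤ → IR := fun n k => IR.mk (k / 2 ^ n) ((k + 1) / 2 ^ n) (by gcongr; linarith) with hJ
  set A : ℕ → ℤ → Set ℝ := fun n k => {t | |t| ≤ n ∧ ⌊t * 2 ^ n⌋ = k} with hA
  have hAm : ∀ n k, MeasurableSet (A n k) := fun n k =>
    (measurableSet_le (f := fun t : ℝ => |t|) (by fun_prop) measurable_const).inter
      ((measurable_id.mul_const ((2 : ℝ) ^ n)).floor (measurableSet_singleton k))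
  set F : ℕ → Finset ℤ := fun n => Finset.Icc (-(n * 2 ^ n)) (n * 2 ^ n) with hF
  set ν : ℕ → Val (WithBot IR) := fun n =>
    (((F n).toList.map fun k => (μ (A n k), (J n k : WithBot IR))).map
      fun p => p.1 • dirac p.2).sum with hν
  have hν_apply : ∀ n U, ν n U = μ {t | |t| ≤ n ∧ (J n ⌊t * 2 ^ n⌋ : WithBot IR) ∈ U} := by
    intro n U
    have h1 : ν n U = ∑ k ∈ F n with (J n k : WithBot IR) ∈ U, μ (A n k) := by
      rw [hν]
      dsimp only
      rw [list_sum_apply, List.map_map, Finset.sum_map_toList, Finset.sum_filter]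
      refine Finset.sum_congr rfl fun k _ => ?_
      simp [dirac_apply]
    rw [h1, ← measure_biUnion_finset _ fun k _ => hAm n k]
    · congr 1
      ext t
      simp only [mem_iUnion, Finset.mem_filter, hA, mem_ofPred_eq, exists_prop, hF,
        Finset.mem_Icc]
      constructor
      · rintro ⟨k, ⟨-, hk⟩, ht, rfl⟩
        exact ⟨ht, hk⟩
      · rintro ⟨ht, hk⟩
        refine ⟨_, ⟨⟨?_, ?_⟩, hk⟩, ht, rfl⟩
        · rw [Int.le_floor]
          push_cast
          have := (abs_le.1 ht).1
          have h2 : (0 : ℝ) < 2 ^ n := by positivity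
          nlinarith
        · rw [← Int.cast_le (R := ℝ)]
          push_cast
          have := (abs_le.1 ht).2
          have h2 : (0 : ℝ) < 2 ^ n := by positivity
          exact (Int.floor_le _).trans (by gcongr)
    · intro a _ b _ hab
      exact Set.disjoint_left.2 fun t h1 h2 => hab (h1.2.symm.trans h2.2)
  have hlo : ∀ n (t : ℝ), (⌊t * 2 ^ n⌋ : ℝ) / 2 ^ n ≤ t := fun n t => by
    rw [div_le_iff₀ (by positivity)]; exact Int.floor_le _
  have hhi : ∀ n (t : ℝ), t ≤ ((⌊t * 2 ^ n⌋ : ℝ) + 1) / 2 ^ n := fun n t => by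
    rw [le_div_iff₀ (by positivity)]; exact (Int.lt_floor_add_one _).le
  have hwid : ∀ n (t : ℝ), ((⌊t * 2 ^ n⌋ : ℝ) + 1) / 2 ^ n = (⌊t * 2 ^ n⌋ : ℝ) / 2 ^ n + 1 / 2 ^ n :=
    fun n t => add_div _ _ _
  have hJ_mono : ∀ t : ℝ, Monotone fun n => J n ⌊t * 2 ^ n⌋ := fun t => by
    refine monotone_nat_of_le_succ fun n => IR.le_iff.2 ⟨?_, ?_⟩
    · simp only [hJ, IR.lo_mk]
      rw [pow_succ, ← mul_assoc, div_le_div_iff₀ (by positivity) (by positivity)]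
      have : (2 * ⌊t * 2 ^ n⌋ : ℤ) ≤ ⌊t * 2 ^ n * 2⌋ := by
        rw [Int.le_floor]; push_cast
        have := Int.floor_le (t * 2 ^ n)
        linarith
      have : (2 * ⌊t * 2 ^ n⌋ : ℝ) ≤ ⌊t * 2 ^ n * 2⌋ := by exact_mod_cast this
      have h2 : (0 : ℝ) < 2 ^ n := by positivity
      nlinarith [mul_le_mul_of_nonneg_right this h2.le]
    · simp only [hJ, IR.hi_mk]
      rw [pow_succ, ← mul_assoc, div_le_div_iff₀ (by positivity) (by positivity)]
      have : ⌊t * 2 ^ n * 2⌋ < (2 * (⌊t * 2 ^ n⌋ + 1) : ℤ) := by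
        rw [Int.floor_lt]; push_cast
        have := Int.lt_floor_add_one (t * 2 ^ n)
        linarith
      have : (⌊t * 2 ^ n * 2⌋ : ℝ) + 1 ≤ 2 * (⌊t * 2 ^ n⌋ + 1) := by exact_mod_cast this
      have h2 : (0 : ℝ) < 2 ^ n := by positivity
      nlinarith [mul_le_mul_of_nonneg_right this h2.le]
  have hJ_lub : ∀ t : ℝ, IsLUB (range fun n => J n ⌊t * 2 ^ n⌋) (IR.point t) := fun t => by
    refine ⟨?_, fun b hb => ?_⟩
    · rintro _ ⟨n, rfl⟩
      exact IR.le_iff.2 ⟨hlo n t, hhi n t⟩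
    · have hb' := fun n => IR.le_iff.1 (hb ⟨n, rfl⟩)
      simp only [hJ, IR.lo_mk, IR.hi_mk] at hb'
      refine IR.le_iff.2 ⟨?_, ?_⟩ <;> refine le_of_forall_pos_le_add fun ε hε => ?_ <;>
      obtain ⟨n, hn⟩ := exists_pow_lt_of_lt_one hε (by norm_num : (1 / 2 : ℝ) < 1) <;>
      rw [one_div_pow] at hn <;> have h1 := hb' n <;> have h2 := hwid n t <;>
      have h3 := hlo n t <;> have h4 := hhi n t <;> simp only [IR.lo_point, IR.hi_point] <;>
      linarith [h1.1, h1.2]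
  have hmono : ∀ U : SOpens (WithBot IR),
      Monotone fun n : ℕ => {t : ℝ | |t| ≤ n ∧ (J n ⌊t * 2 ^ n⌋ : WithBot IR) ∈ U} :=
    fun U m n hmn t ht => ⟨ht.1.trans (by exact_mod_cast hmn),
      U.upper (WithBot.coe_le_coe.2 (hJ_mono t hmn)) ht.2⟩
  have hsup : ∀ U, ofMeasure μ ⟨((↑) : IR → WithBot IR), scottContinuous_coe⟩ U = ⨆ n, ν n U := by
    intro U
    simp only [hν_apply]
    rw [← (hmono U).measure_iUnion]
    show μ {t | (IR.point t : WithBot IR) ∈ U} = _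
    congr 1
    ext t
    simp only [mem_iUnion, mem_ofPred_eq]
    constructor
    · intro ht
      have hl := isLUB_coe (range_nonempty _) (hJ_lub t)
      obtain ⟨_, ⟨_, ⟨n, rfl⟩, rfl⟩, hn⟩ := U.inacc ((range_nonempty _).image _)
        (((hJ_mono t).directed_le.directedOn_range).mono_comp
          fun _ _ h => WithBot.coe_le_coe.2 h) hl ht
      obtain ⟨m, hm⟩ := exists_nat_ge |t|
      exact ⟨max m n, hm.trans (by exact_mod_cast le_max_left m n),
        U.upper (WithBot.coe_le_coe.2 (hJ_mono t (le_max_right m n))) hn⟩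
    · rintro ⟨n, -, hn⟩
      exact U.upper (WithBot.coe_le_coe.2 ((hJ_lub t).1 ⟨n, rfl⟩)) hn
  have hνmono : Monotone ν := fun m n hmn U => by
    rw [hν_apply, hν_apply]; exact measure_mono (hmono U hmn)
  refine .sup (range ν) _ (range_nonempty _) hνmono.directed_le.directedOn_range
    (by rintro _ ⟨n, rfl⟩; exact isMinimal_list _) ⟨?_, fun b hb U => ?_⟩
  · rintro _ ⟨n, rfl⟩ U
    rw [hsup]
    exact le_iSup (fun n => ν n U) n
  · rw [hsup]
    exact iSup_le fun n => hb ⟨n, rfl⟩ U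

end Val

/-! ### Types and their denotations -/

/-- The types of ISPCF; `dist τ` is the type `D τ` of distributions over `τ`. -/
inductive Ty : Type
  | unit | void | int | real
  | sum (σ τ : Ty)
  | prod (σ τ : Ty)
  | arrow (σ τ : Ty)
  | dist (τ : Ty)

/-- A bundled pointed dcpo. -/
structure Dom where
  carrier : Type
  [cpo : CompletePartialOrder carrier]

instance : CoeSort Dom Type := ⟨Dom.carrier⟩
noncomputable instance (X : Dom) : CompletePartialOrder X := X.cpo

/-- The denotation of a type. -/
noncomputable def Ty.dom : Ty → Dom
  | .unit => ⟨WithBot (Flat Unit)⟩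
  | .void => ⟨WithBot (Flat Empty)⟩
  | .int => ⟨WithBot (Flat ℤ)⟩
  | .real => ⟨WithBot IR⟩
  | .sum σ τ => ⟨WithBot (σ.dom ⊕ τ.dom)⟩
  | .prod σ τ => ⟨σ.dom × τ.dom⟩
  | .arrow σ τ => ⟨SCont σ.dom τ.dom⟩
  | .dist τ => ⟨MVal τ.dom⟩

/-- The element `*` of the denotation of the unit type. -/
def starD : Ty.unit.dom := ((⟨()⟩ : Flat Unit) : WithBot (Flat Unit))
/-- The integers as elements of the denotation of the type of integers. -/
def intD (n : ℤ) : Ty.int.dom := ((⟨n⟩ : Flat ℤ) : WithBot (Flat ℤ))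
/-- The intervals as elements of the denotation of the type of reals. -/
def realD (a : IR) : Ty.real.dom := (a : WithBot IR)

/-- The basic types. -/
def Ty.IsBasic : Ty → Prop
  | .unit | .void | .int | .real => True
  | _ => False

/-- The observable types: those that contain neither `→` nor `D`. -/
def Ty.IsObservable : Ty → Prop
  | .unit | .void | .int | .real => True
  | .sum σ τ | .prod σ τ => σ.IsObservable ∧ τ.IsObservable
  | .arrow _ _ | .dist _ => False

/-- First-order types `σ₁ → ⋯ → σₖ → τ`, with every `σᵢ` basic and `τ` observable. -/
def Ty.IsFirstOrder : Ty → Prop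
  | .arrow σ τ => σ.IsBasic ∧ τ.IsFirstOrder
  | τ => τ.IsObservable

/-- The observable elements of the denotation of an observable type (there are none at the
other types). -/
def IsObs : (β : Ty) → β.dom → Prop
  | .unit, v => v ≠ (⊥ : WithBot (Flat Unit))
  | .void, v => v ≠ (⊥ : WithBot (Flat Empty))
  | .int, v => v ≠ (⊥ : WithBot (Flat ℤ))
  | .real, v => v ≠ (⊥ : WithBot IR)
  | .prod σ τ, v => IsObs σ v.1 ∧ IsObs τ v.2
  | .sum σ τ, v => WithBot.recBotCoe (C := fun _ => Prop) False
      (Sum.elim (IsObs σ) (IsObs τ)) v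
  | .arrow _ _, _ => False
  | .dist _, _ => False

/-- Strictly observable elements of first-order types `σ₁ → ⋯ → σₖ → τ`: `f v₁ ⋯ vₖ` is
observable or `⊥`, and it is `⊥` as soon as some `vᵢ` is `⊥` (that is, any partial application
`f v₁ ⋯ vᵢ₋₁ ⊥` is the constant `⊥` function). -/
def IsStrictlyObs : (τ : Ty) → τ.dom → Prop
  | .arrow σ τ, f => (∀ v : σ.dom, IsStrictlyObs τ (SCont.toFun (X := σ.dom) (Y := τ.dom) f v)) ∧
      SCont.toFun (X := σ.dom) (Y := τ.dom) f ⊥ = ⊥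
  | τ, v => IsObs τ v ∨ v = ⊥

/-! ### Signatures and terms -/

/-- The constants and measures over which terms are built: a set of constants of each type,
each with a denotation, among which a constant `*` of type `unit` and constants `n` for the
integers; and a set of measures on the real line. The constants of type `real` are not listed
here: there is exactly one for each interval `a : IR`, and terms have these built in. -/
structure Sig where
  Const : Ty → Type u
  den : ∀ {τ : Ty}, Const τ → τ.dom
  noReal : IsEmpty (Const .real)
  star : Const .unit
  den_star : den star = starD
  num : ℤ → Const .int
  den_num : ∀ n, den (num n) = intD n
  Meas : Set (Measure ℝ)

/-- Strictly observable first-order constants. -/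
def Sig.StrictlyObservableFirstOrder (S : Sig.{u}) : Prop :=
  ∀ (τ : Ty) (f : S.Const τ), τ.IsFirstOrder ∧ IsStrictlyObs τ (S.den f) ∧
    (τ.IsObservable → τ.IsBasic ∧ IsObs τ (S.den f))

/-- Typed de Bruijn variables. -/
inductive Var : List Ty → Ty → Type
  | zero {Γ : List Ty} {τ : Ty} : Var (τ :: Γ) τ
  | succ {Γ : List Ty} {σ τ : Ty} : Var Γ τ → Var (σ :: Γ) τ

/-- ISPCF terms, up to renaming of bound variables, with their typing derivations. `Tm S R Γ τ`
are the terms of type `τ` whose free variables are in `Γ`, where the constants of type `real`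
are drawn from `R`. -/
inductive Tm (S : Sig.{u}) (R : Type) : List Ty → Ty → Type u
  | var {Γ : List Ty} {τ : Ty} : Var Γ τ → Tm S R Γ τ
  | const {Γ : List Ty} {τ : Ty} : S.Const τ → Tm S R Γ τ
  | real {Γ : List Ty} : R → Tm S R Γ .real
  | sample {Γ : List Ty} : S.Meas → Tm S R Γ (.dist .real)
  | score {Γ : List Ty} : Tm S R Γ .real → Tm S R Γ (.dist .unit)
  | lam {Γ : List Ty} {σ τ : Ty} : Tm S R (σ :: Γ) τ → Tm S R Γ (.arrow σ τ)
  | app {Γ : List Ty} {σ τ : Ty} : Tm S R Γ (.arrow σ τ) → Tm S R Γ σ → Tm S R Γ τ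
  | fix {Γ : List Ty} {σ : Ty} : Tm S R Γ (.arrow σ σ) → Tm S R Γ σ
  | ret {Γ : List Ty} {τ : Ty} : Tm S R Γ τ → Tm S R Γ (.dist τ)
  | bind {Γ : List Ty} {σ τ : Ty} :
      Tm S R Γ (.dist σ) → Tm S R (σ :: Γ) (.dist τ) → Tm S R Γ (.dist τ)
  | pair {Γ : List Ty} {σ τ : Ty} : Tm S R Γ σ → Tm S R Γ τ → Tm S R Γ (.prod σ τ)
  | fst {Γ : List Ty} {σ τ : Ty} : Tm S R Γ (.prod σ τ) → Tm S R Γ σ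
  | snd {Γ : List Ty} {σ τ : Ty} : Tm S R Γ (.prod σ τ) → Tm S R Γ τ
  | inl {Γ : List Ty} {σ τ : Ty} : Tm S R Γ σ → Tm S R Γ (.sum σ τ)
  | inr {Γ : List Ty} {σ τ : Ty} : Tm S R Γ τ → Tm S R Γ (.sum σ τ)
  | case {Γ : List Ty} {σ τ υ : Ty} : Tm S R Γ (.sum σ τ) → Tm S R Γ (.arrow σ υ) →
      Tm S R Γ (.arrow τ υ) → Tm S R Γ υ

namespace Tm
variable {S : Sig.{u}} {R : Type}

/-- Extend a renaming under a binder. -/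
def liftRen {Γ Δ : List Ty} (r : ∀ τ, Var Γ τ → Var Δ τ) (σ : Ty) :
    ∀ τ, Var (σ :: Γ) τ → Var (σ :: Δ) τ
  | _, .zero => .zero
  | τ, .succ v => .succ (r τ v)

/-- Renaming of free variables. -/
def rename : ∀ {Γ Δ : List Ty} {τ : Ty}, (∀ τ, Var Γ τ → Var Δ τ) → Tm S R Γ τ → Tm S R Δ τ
  | _, _, _, r, .var v => .var (r _ v)
  | _, _, _, _, .const c => .const c
  | _, _, _, _, .real a => .real a
  | _, _, _, _, .sample μ => .sample μ
  | _, _, _, r, .score M => .score (M.rename r)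
  | _, _, _, r, .lam M => .lam (M.rename (liftRen r _))
  | _, _, _, r, .app M N => .app (M.rename r) (N.rename r)
  | _, _, _, r, .fix M => .fix (M.rename r)
  | _, _, _, r, .ret M => .ret (M.rename r)
  | _, _, _, r, .bind M N => .bind (M.rename r) (N.rename (liftRen r _))
  | _, _, _, r, .pair M N => .pair (M.rename r) (N.rename r)
  | _, _, _, r, .fst M => .fst (M.rename r)
  | _, _, _, r, .snd M => .snd (M.rename r)
  | _, _, _, r, .inl M => .inl (M.rename r)
  | _, _, _, r, .inr M => .inr (M.rename r)
  | _, _, _, r, .case M N P => .case (M.rename r) (N.rename r) (P.rename r)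

/-- Extend a substitution under a binder. -/
def liftSub {Γ Δ : List Ty} (s : ∀ τ, Var Γ τ → Tm S R Δ τ) (σ : Ty) :
    ∀ τ, Var (σ :: Γ) τ → Tm S R (σ :: Δ) τ
  | _, .zero => .var .zero
  | τ, .succ v => (s τ v).rename fun _ => .succ

/-- Simultaneous capture-avoiding substitution. -/
def subst : ∀ {Γ Δ : List Ty} {τ : Ty}, (∀ τ, Var Γ τ → Tm S R Δ τ) → Tm S R Γ τ → Tm S R Δ τ
  | _, _, _, s, .var v => s _ v
  | _, _, _, _, .const c => .const c
  | _, _, _, _, .real a => .real a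
  | _, _, _, _, .sample μ => .sample μ
  | _, _, _, s, .score M => .score (M.subst s)
  | _, _, _, s, .lam M => .lam (M.subst (liftSub s _))
  | _, _, _, s, .app M N => .app (M.subst s) (N.subst s)
  | _, _, _, s, .fix M => .fix (M.subst s)
  | _, _, _, s, .ret M => .ret (M.subst s)
  | _, _, _, s, .bind M N => .bind (M.subst s) (N.subst (liftSub s _))
  | _, _, _, s, .pair M N => .pair (M.subst s) (N.subst s)
  | _, _, _, s, .fst M => .fst (M.subst s)
  | _, _, _, s, .snd M => .snd (M.subst s)
  | _, _, _, s, .inl M => .inl (M.subst s)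
  | _, _, _, s, .inr M => .inr (M.subst s)
  | _, _, _, s, .case M N P => .case (M.subst s) (N.subst s) (P.subst s)

/-- The substitution `[x := N]` for the last variable. -/
def single {Γ : List Ty} {σ : Ty} (N : Tm S R Γ σ) : ∀ τ, Var (σ :: Γ) τ → Tm S R Γ τ
  | _, .zero => N
  | _, .succ v => .var v

/-- `M [x := N]`. -/
def inst {Γ : List Ty} {σ τ : Ty} (M : Tm S R (σ :: Γ) τ) (N : Tm S R Γ σ) : Tm S R Γ τ :=
  M.subst (single N)

/-- The shape of a term: its constants of type `real` are replaced by anonymous holes. -/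
def shape : ∀ {Γ : List Ty} {τ : Ty}, Tm S R Γ τ → Tm S Unit Γ τ
  | _, _, .var v => .var v
  | _, _, .const c => .const c
  | _, _, .real _ => .real ()
  | _, _, .sample μ => .sample μ
  | _, _, .score M => .score M.shape
  | _, _, .lam M => .lam M.shape
  | _, _, .app M N => .app M.shape N.shape
  | _, _, .fix M => .fix M.shape
  | _, _, .ret M => .ret M.shape
  | _, _, .bind M N => .bind M.shape N.shape
  | _, _, .pair M N => .pair M.shape N.shape
  | _, _, .fst M => .fst M.shape
  | _, _, .snd M => .snd M.shape
  | _, _, .inl M => .inl M.shape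
  | _, _, .inr M => .inr M.shape
  | _, _, .case M N P => .case M.shape N.shape P.shape

/-- The constants of type `real` of a term, from left to right. -/
def reals : ∀ {Γ : List Ty} {τ : Ty}, Tm S R Γ τ → List R
  | _, _, .var _ => []
  | _, _, .const _ => []
  | _, _, .real a => [a]
  | _, _, .sample _ => []
  | _, _, .score M => M.reals
  | _, _, .lam M => M.reals
  | _, _, .app M N => M.reals ++ N.reals
  | _, _, .fix M => M.reals
  | _, _, .ret M => M.reals
  | _, _, .bind M N => M.reals ++ N.reals
  | _, _, .pair M N => M.reals ++ N.reals
  | _, _, .fst M => M.reals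
  | _, _, .snd M => M.reals
  | _, _, .inl M => M.reals
  | _, _, .inr M => M.reals
  | _, _, .case M N P => M.reals ++ (N.reals ++ P.reals)

theorem length_reals_shape {Γ : List Ty} {τ : Ty} (M : Tm S R Γ τ) :
    M.shape.reals.length = M.reals.length := by
  induction M <;> simp_all [shape, reals]

theorem length_reals_eq {Γ : List Ty} {τ : Ty} {M N : Tm S R Γ τ} (h : M.shape = N.shape) :
    M.reals.length = N.reals.length := by
  rw [← length_reals_shape, h, length_reals_shape]

/-- A term is determined by its shape and its real constants. -/
theorem eq_of_shape_reals {Γ : List Ty} {τ : Ty} (M N : Tm S R Γ τ) (h : M.shape = N.shape)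
    (h' : M.reals = N.reals) : M = N := by
  induction M with
  | var | const | sample => cases N <;> simp_all [shape]
  | real => cases N <;> simp_all [shape, reals]
  | score M ih => cases N <;> simp [shape] at h; simp [reals] at h'; rw [ih _ h h']
  | lam M ih => cases N <;> simp [shape] at h; simp [reals] at h'; rw [ih _ h h']
  | fix M ih => cases N <;> simp [shape] at h; simp [reals] at h'; rw [ih _ h h']
  | ret M ih => cases N <;> simp [shape] at h; simp [reals] at h'; rw [ih _ h h']
  | inl M ih => cases N <;> simp [shape] at h; simp [reals] at h'; rw [ih _ h h']
  | inr M ih => cases N <;> simp [shape] at h; simp [reals] at h'; rw [ih _ h h']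
  | fst M ih =>
    cases N <;> simp [shape] at h
    obtain ⟨rfl, h1⟩ := h
    rw [heq_iff_eq] at h1
    rw [ih _ h1 h']
  | snd M ih =>
    cases N <;> simp [shape] at h
    obtain ⟨rfl, h1⟩ := h
    rw [heq_iff_eq] at h1
    rw [ih _ h1 h']
  | app M M' ih ih' =>
    cases N <;> simp [shape] at h
    obtain ⟨rfl, h1, h2⟩ := h
    rw [heq_iff_eq] at *
    obtain ⟨h3, h4⟩ := List.append_inj h' (length_reals_eq h1)
    rw [ih _ h1 h3, ih' _ h2 h4]
  | bind M M' ih ih' =>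
    cases N <;> simp [shape] at h
    obtain ⟨rfl, h1, h2⟩ := h
    rw [heq_iff_eq] at *
    obtain ⟨h3, h4⟩ := List.append_inj h' (length_reals_eq h1)
    rw [ih _ h1 h3, ih' _ h2 h4]
  | pair M M' ih ih' =>
    cases N <;> simp [shape] at h
    obtain ⟨h1, h2⟩ := h
    obtain ⟨h3, h4⟩ := List.append_inj h' (length_reals_eq h1)
    rw [ih _ h1 h3, ih' _ h2 h4]
  | case M M' M'' ih ih' ih'' =>
    cases N <;> simp [shape] at h
    obtain ⟨rfl, rfl, h1, h2, h3⟩ := h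
    rw [heq_iff_eq] at *
    obtain ⟨h4, h5⟩ := List.append_inj h' (length_reals_eq h1)
    obtain ⟨h6, h7⟩ := List.append_inj h5 (length_reals_eq h2)
    rw [ih _ h1 h4, ih' _ h2 h6, ih'' _ h3 h7]
end Tm

/-! ### Configurations -/

/-- Closed generalized terms of type `τ`, that is, the configurations `(shape, θ)` of type `τ`. -/
abbrev Cfg (S : Sig.{u}) (τ : Ty) := Tm S IR [] τ

namespace Tm
variable {S : Sig.{u}} {R : Type}

theorem forall₂_le_trans [PartialOrder R] {l m n : List R} (h : List.Forall₂ (· ≤ ·) l m)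
    (h' : List.Forall₂ (· ≤ ·) m n) : List.Forall₂ (· ≤ ·) l n := by
  induction h generalizing n with
  | nil => exact h'
  | cons h _ ih =>
    cases h' with
    | cons h1 h2 => exact .cons (h.trans h1) (ih h2)

/-- `M ≤ N` if and only if `M` and `N` have the same shape and the real constants of `M` are below
the corresponding ones of `N`. -/
instance [PartialOrder R] {Γ : List Ty} {τ : Ty} : PartialOrder (Tm S R Γ τ) where
  le M N := M.shape = N.shape ∧ List.Forall₂ (· ≤ ·) M.reals N.reals
  le_refl _ := ⟨rfl, List.forall₂_refl _⟩
  le_trans _ _ _ h h' := ⟨h.1.trans h'.1, forall₂_le_trans h.2 h'.2⟩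
  le_antisymm M N h h' := eq_of_shape_reals M N h.1 <| by
    obtain ⟨-, h1⟩ := h
    obtain ⟨-, h2⟩ := h'
    generalize M.reals = l at *
    generalize N.reals = m at *
    induction h1 with
    | nil => rfl
    | cons h _ ih =>
      rw [List.forall₂_cons] at h2
      rw [le_antisymm h h2.1, ih h2.2]

theorem le_def [PartialOrder R] {Γ : List Ty} {τ : Ty} {M N : Tm S R Γ τ} :
    M ≤ N ↔ M.shape = N.shape ∧ List.Forall₂ (· ≤ ·) M.reals N.reals := Iff.rfl

theorem scottContinuous_of_reals [PartialOrder R] {Γ : List Ty} {τ : Ty} (F : R → Tm S R Γ τ)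
    (s : Tm S Unit Γ τ) (l r : List R) (hs : ∀ a, (F a).shape = s)
    (hr : ∀ a, (F a).reals = l ++ a :: r) : ScottContinuous F := by
  refine ScottContinuous.mk' (fun a b h => le_def.2 ⟨(hs a).trans (hs b).symm, ?_⟩)
    fun d hd _ a ha N hN => le_def.2 ⟨?_, ?_⟩
  · rw [hr, hr]
    exact List.rel_append (List.forall₂_refl _) (.cons h (List.forall₂_refl _))
  · obtain ⟨x, hx⟩ := hd
    exact (hs a).trans ((hs x).symm.trans (hN x hx).1)
  · have h := fun x hx => (hN x hx).2
    simp only [hr] at h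
    rw [hr]
    generalize N.reals = m at h
    clear hr hs hN
    obtain ⟨x, hx⟩ := hd
    induction l generalizing m with
    | nil =>
      cases m with
      | nil => have := h x hx; simp at this
      | cons y m =>
        simp only [List.nil_append, List.forall₂_cons] at h ⊢
        exact ⟨ha.2 fun z hz => (h z hz).1, (h x hx).2⟩
    | cons c l ih =>
      cases m with
      | nil => have := h x hx; simp at this
      | cons y m =>
        simp only [List.cons_append, List.forall₂_cons] at h ⊢
        exact ⟨(h x hx).1, ih m fun z hz => (h z hz).2⟩

end Tm

/-! ### Denotational semantics -/

namespace SCont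
section
variable {X Y Z W : Type*} [CompletePartialOrder X] [CompletePartialOrder Y]
  [CompletePartialOrder Z] [CompletePartialOrder W]

/-- Constant maps. -/
def const (y : Y) : SCont X Y := ⟨fun _ => y, ScottContinuous.const y⟩

/-- Composition. -/
def comp (g : SCont Y Z) (f : SCont X Y) : SCont X Z := ⟨fun x => g (f x), f.cont.comp g.cont⟩

/-- Pairing. -/
def pair (f : SCont X Y) (g : SCont X Z) : SCont X (Y × Z) :=
  ⟨fun x => (f x, g x), f.cont.prodMk g.cont⟩

/-- The first projection. -/
def fst : SCont (X × Y) X := ⟨Prod.fst, ScottContinuous.fst⟩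

/-- The second projection. -/
def snd : SCont (X × Y) Y := ⟨Prod.snd, ScottContinuous.snd⟩

/-- Currying. -/
def curry (f : SCont (Y × X) Z) : SCont X (SCont Y Z) :=
  ⟨fun x => ⟨fun y => f (y, x), (ScottContinuous.id.prodMk (ScottContinuous.const x)).comp f.cont⟩,
    cont_of_apply fun y => ((ScottContinuous.const y).prodMk ScottContinuous.id).comp f.cont⟩

/-- Application. -/
def eval : SCont (SCont X Y × X) Y := ⟨fun p => p.1 p.2, eval_cont⟩

/-- Least fixed points. -/
noncomputable def fix : SCont (SCont X X) X := ⟨lfp, lfp_cont⟩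

/-- The unit of the monad of minimal valuations. -/
noncomputable def unit : SCont X (MVal X) := ⟨MVal.unit, MVal.unit_cont⟩

/-- The extension operation of the monad of minimal valuations. -/
noncomputable def bind : SCont (SCont X (MVal Y) × MVal X) (MVal Y) :=
  ⟨fun p => MVal.bind p.1 p.2, MVal.bind_cont⟩

/-- The first injection. -/
def inl : SCont X (WithBot (X ⊕ Y)) := ⟨fun x => (Sum.inl x : X ⊕ Y),
  ScottContinuous.comp (g := fun w : X ⊕ Y => (w : WithBot (X ⊕ Y)))
    (fun _ hd _ _ ha => isLUB_inl hd ha) scottContinuous_coe⟩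

/-- The second injection. -/
def inr : SCont Y (WithBot (X ⊕ Y)) := ⟨fun x => (Sum.inr x : X ⊕ Y),
  ScottContinuous.comp (g := fun w : X ⊕ Y => (w : WithBot (X ⊕ Y)))
    (fun _ hd _ _ ha => isLUB_inr hd ha) scottContinuous_coe⟩

/-- Case analysis. -/
def cases : SCont ((SCont X Z × SCont Y Z) × WithBot (X ⊕ Y)) Z :=
  ⟨fun p => strictExt (Sum.elim p.1.1 p.1.2) p.2, by
    refine ScottContinuous.fromProd (fun p => strictExt_cont (sumElim_cont p.1.cont p.2.cont))
      fun w => ?_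
    induction w with
    | bot => exact ScottContinuous.const ⊥
    | coe w =>
      rcases w with x | y
      · exact ScottContinuous.fst.comp (apply_cont x)
      · exact ScottContinuous.snd.comp (apply_cont y)⟩

/-- The map `a ↦ |a| • δ_y`, with `|⊥| = 0`. -/
noncomputable def score (y : Y) : SCont (WithBot IR) (MVal Y) :=
  ⟨strictExt fun a => ⟨ENNReal.ofReal a.abs • Val.dirac y, .smul_dirac _ _⟩, by
    refine strictExt_cont (MVal.cont_of_apply fun U => ?_)
    have : ScottContinuous fun r : ℝ≥0∞ => r * Val.dirac y U := by
      refine ScottContinuous.mk' (fun a b h => mul_le_mul_left h _) fun d hd _ a ha b hb => ?_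
      rw [← ha.sSup_eq, ENNReal.sSup_mul]
      exact iSup₂_le hb
    exact IR.abs_cont.comp this⟩

end
end SCont

/-- Environments. -/
noncomputable def env : List Ty → Dom
  | [] => ⟨PUnit⟩
  | σ :: Γ => ⟨σ.dom × env Γ⟩

/-- The denotation of a variable. -/
noncomputable def Var.den : ∀ {Γ : List Ty} {τ : Ty}, Var Γ τ → SCont (env Γ) τ.dom
  | σ :: Γ, _, .zero => (SCont.fst : SCont (σ.dom × env Γ) σ.dom)
  | σ :: Γ, τ, .succ v => (SCont.comp v.den SCont.snd : SCont (σ.dom × env Γ) τ.dom)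

namespace Tm
variable {S : Sig.{u}}

/-- The denotation of a generalized term, as a map from environments. -/
noncomputable def den : ∀ {Γ : List Ty} {τ : Ty}, Tm S IR Γ τ → SCont (env Γ) τ.dom
  | _, _, .var v => v.den
  | _, _, .const c => SCont.const (S.den c)
  | _, _, .real a => SCont.const (realD a)
  | Γ, _, .sample μ => (SCont.const
      ⟨Val.ofMeasure μ.1 ⟨((↑) : IR → WithBot IR), scottContinuous_coe⟩,
        Val.isMinimal_ofMeasure μ.1⟩ : SCont (env Γ) (MVal Ty.real.dom))
  | Γ, _, .score M => (SCont.comp (SCont.score starD) (M.den : SCont (env Γ) (WithBot IR)) :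
      SCont (env Γ) (MVal Ty.unit.dom))
  | Γ, _, .lam (σ := σ) (τ := τ) M => (SCont.curry (M.den : SCont (σ.dom × env Γ) τ.dom) :
      SCont (env Γ) (SCont σ.dom τ.dom))
  | Γ, _, .app (σ := σ) (τ := τ) M N =>
      SCont.comp SCont.eval (SCont.pair (M.den : SCont (env Γ) (SCont σ.dom τ.dom)) N.den)
  | Γ, _, .fix (σ := σ) M =>
      SCont.comp SCont.fix (M.den : SCont (env Γ) (SCont σ.dom σ.dom))
  | Γ, _, .ret (τ := τ) M =>
      (SCont.comp SCont.unit M.den : SCont (env Γ) (MVal τ.dom))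
  | Γ, _, .bind (σ := σ) (τ := τ) M N => (SCont.comp SCont.bind (SCont.pair
      (SCont.curry (N.den : SCont (σ.dom × env Γ) (MVal τ.dom)))
      (M.den : SCont (env Γ) (MVal σ.dom))) : SCont (env Γ) (MVal τ.dom))
  | Γ, _, .pair (σ := σ) (τ := τ) M N =>
      (SCont.pair M.den N.den : SCont (env Γ) (σ.dom × τ.dom))
  | Γ, _, .fst (σ := σ) (τ := τ) M =>
      SCont.comp SCont.fst (M.den : SCont (env Γ) (σ.dom × τ.dom))
  | Γ, _, .snd (σ := σ) (τ := τ) M =>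
      SCont.comp SCont.snd (M.den : SCont (env Γ) (σ.dom × τ.dom))
  | Γ, _, .inl (σ := σ) (τ := τ) M =>
      (SCont.comp SCont.inl M.den : SCont (env Γ) (WithBot (σ.dom ⊕ τ.dom)))
  | Γ, _, .inr (σ := σ) (τ := τ) M =>
      (SCont.comp SCont.inr M.den : SCont (env Γ) (WithBot (σ.dom ⊕ τ.dom)))
  | Γ, _, .case (σ := σ) (τ := τ) (υ := υ) M N P =>
      SCont.comp SCont.cases (SCont.pair (SCont.pair (N.den : SCont (env Γ) (SCont σ.dom υ.dom))
        (P.den : SCont (env Γ) (SCont τ.dom υ.dom)))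
        (M.den : SCont (env Γ) (WithBot (σ.dom ⊕ τ.dom))))

end Tm

/-- The denotation of a closed generalized term. -/
noncomputable def sem {S : Sig.{u}} {τ : Ty} (M : Cfg S τ) : τ.dom := M.den PUnit.unit

/-- The denotation of a closed generalized term of type `D τ`, as a minimal valuation. -/
noncomputable def semD {S : Sig.{u}} {τ : Ty} (M : Cfg S (.dist τ)) : MVal τ.dom := sem M

/-! ### Operational semantics -/

/-- The term `a` underlined, for an observable element `a` of the denotation of an observable
type. -/
noncomputable def quote (S : Sig.{u}) : (β : Ty) → (v : β.dom) → IsObs β v → Cfg S β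
  | .unit, _, _ => .const S.star
  | .void, v, h => (WithBot.unbot (α := Flat Empty) v h).val.elim
  | .int, v, h => .const (S.num (WithBot.unbot (α := Flat ℤ) v h).val)
  | .real, v, h => .real (WithBot.unbot (α := IR) v h)
  | .prod σ τ, v, h => .pair (quote S σ v.1 h.1) (quote S τ v.2 h.2)
  | .sum σ τ, v, h =>
      WithBot.recBotCoe
        (C := fun v : WithBot (σ.dom ⊕ τ.dom) => IsObs (.sum σ τ) v → Cfg S (.sum σ τ))
        (fun h => h.elim)
        (fun w => match w with
          | .inl a => fun h => .inl (quote S σ a h)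
          | .inr b => fun h => .inr (quote S τ b h)) v h
  | .arrow _ _, _, h => h.elim
  | .dist _, _, h => h.elim

section
variable {S : Sig.{u}}

/-- The zero-ary constants of basic types. -/
inductive IsAtom : ∀ {τ : Ty}, Cfg S τ → Prop
  | const {τ : Ty} (c : S.Const τ) : τ.IsBasic → IsAtom (.const c)
  | real (a : IR) : IsAtom (.real a)

/-- The terms `f a₁ ⋯ aᵢ`, where `f` is a constant and `a₁, …, aᵢ` are zero-ary constants of basic
types. For a constant of first-order type, `i < α(f)` if and only if the type of this term is an
arrow type, and `i = α(f)` if and only if it is an observable type. -/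
inductive IsConstApp : ∀ {τ : Ty}, Cfg S τ → Prop
  | const {τ : Ty} (c : S.Const τ) : IsConstApp (.const c)
  | app {σ τ : Ty} (M : Cfg S (.arrow σ τ)) (N : Cfg S σ) :
      IsConstApp M → IsAtom N → IsConstApp (.app M N)

/-- Values. -/
inductive IsValue : ∀ {τ : Ty}, Cfg S τ → Prop
  | atom {τ : Ty} (M : Cfg S τ) : IsAtom M → IsValue M
  | lam {σ τ : Ty} (M : Tm S IR [σ] τ) : IsValue (.lam M)
  | ret {τ : Ty} (V : Cfg S τ) : IsValue V → IsValue (.ret V)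
  | pair {σ τ : Ty} (V : Cfg S σ) (W : Cfg S τ) : IsValue V → IsValue W → IsValue (.pair V W)
  | inl {σ τ : Ty} (V : Cfg S σ) : IsValue V → IsValue (.inl V : Cfg S (.sum σ τ))
  | inr {σ τ : Ty} (V : Cfg S τ) : IsValue V → IsValue (.inr V : Cfg S (.sum σ τ))
  | constApp {σ τ : Ty} (M : Cfg S (.arrow σ τ)) : IsConstApp M → IsValue M

end

/-- Weak evaluation contexts of type `σ ⊢ τ`. -/
inductive WCtx (S : Sig.{u}) (σ : Ty) : Ty → Type u
  | hole : WCtx S σ σ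
  | score : WCtx S σ .real → WCtx S σ (.dist .unit)
  | app {υ τ : Ty} : WCtx S σ (.arrow υ τ) → Cfg S υ → WCtx S σ τ
  | bind {υ τ : Ty} : WCtx S σ (.dist υ) → Tm S IR [υ] (.dist τ) → WCtx S σ (.dist τ)
  | arg {υ τ : Ty} (M : Cfg S (.arrow υ τ)) : IsConstApp M → WCtx S σ υ → WCtx S σ τ
  | case {υ₁ υ₂ τ : Ty} : WCtx S σ (.sum υ₁ υ₂) → Cfg S (.arrow υ₁ τ) → Cfg S (.arrow υ₂ τ) →
      WCtx S σ τ
  | fst {τ υ : Ty} : WCtx S σ (.prod τ υ) → WCtx S σ τ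
  | snd {υ τ : Ty} : WCtx S σ (.prod υ τ) → WCtx S σ τ

/-- Evaluation contexts of type `σ ⊢ τ`. -/
inductive ECtx (S : Sig.{u}) (σ : Ty) : Ty → Type u
  | weak {τ : Ty} : WCtx S σ τ → ECtx S σ τ
  | ret {τ : Ty} : ECtx S σ τ → ECtx S σ (.dist τ)
  | pairL {υ τ : Ty} : ECtx S σ υ → Cfg S τ → ECtx S σ (.prod υ τ)
  | pairR {υ τ : Ty} (V : Cfg S υ) : IsValue V → ECtx S σ τ → ECtx S σ (.prod υ τ)
  | inl {υ τ : Ty} : ECtx S σ υ → ECtx S σ (.sum υ τ)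
  | inr {υ τ : Ty} : ECtx S σ τ → ECtx S σ (.sum υ τ)

section
variable {S : Sig.{u}}

/-- `E [M]`. -/
def WCtx.plug {σ : Ty} (M : Cfg S σ) : ∀ {τ : Ty}, WCtx S σ τ → Cfg S τ
  | _, .hole => M
  | _, .score E => .score (E.plug M)
  | _, .app E N => .app (E.plug M) N
  | _, .bind E N => .bind (E.plug M) N
  | _, .arg P _ E => .app P (E.plug M)
  | _, .case E N P => .case (E.plug M) N P
  | _, .fst E => .fst (E.plug M)
  | _, .snd E => .snd (E.plug M)

/-- `E [M]`. -/
def ECtx.plug {σ : Ty} (M : Cfg S σ) : ∀ {τ : Ty}, ECtx S σ τ → Cfg S τ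
  | _, .weak E => E.plug M
  | _, .ret E => .ret (E.plug M)
  | _, .pairL E N => .pair (E.plug M) N
  | _, .pairR V _ E => .pair V (E.plug M)
  | _, .inl E => .inl (E.plug M)
  | _, .inr E => .inr (E.plug M)

theorem WCtx.plug_shape_reals {σ τ : Ty} (E : WCtx S σ τ) (F : IR → Cfg S σ)
    (h : ∃ s l r, ∀ a, (F a).shape = s ∧ (F a).reals = l ++ a :: r) :
    ∃ s l r, ∀ a, (E.plug (F a)).shape = s ∧ (E.plug (F a)).reals = l ++ a :: r := by
  induction E with
  | hole => exact h
  | score E ih =>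
    obtain ⟨s, l, r, h⟩ := ih
    exact ⟨.score s, l, r, fun a => by simp [plug, Tm.shape, Tm.reals, h a]⟩
  | app E N ih =>
    obtain ⟨s, l, r, h⟩ := ih
    exact ⟨.app s N.shape, l, r ++ N.reals, fun a => by simp [plug, Tm.shape, Tm.reals, h a]⟩
  | bind E N ih =>
    obtain ⟨s, l, r, h⟩ := ih
    exact ⟨.bind s N.shape, l, r ++ N.reals, fun a => by simp [plug, Tm.shape, Tm.reals, h a]⟩
  | arg M _ E ih =>
    obtain ⟨s, l, r, h⟩ := ih
    exact ⟨.app M.shape s, M.reals ++ l, r, fun a => by simp [plug, Tm.shape, Tm.reals, h a]⟩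
  | case E N P ih =>
    obtain ⟨s, l, r, h⟩ := ih
    exact ⟨.case s N.shape P.shape, l, r ++ (N.reals ++ P.reals), fun a => by
      simp [plug, Tm.shape, Tm.reals, h a]⟩
  | fst E ih =>
    obtain ⟨s, l, r, h⟩ := ih
    exact ⟨.fst s, l, r, fun a => by simp [plug, Tm.shape, Tm.reals, h a]⟩
  | snd E ih =>
    obtain ⟨s, l, r, h⟩ := ih
    exact ⟨.snd s, l, r, fun a => by simp [plug, Tm.shape, Tm.reals, h a]⟩

/-- The map `a ↦ E [ret a]`. -/
def WCtx.retReal {τ : Ty} (E : WCtx S (.dist .real) τ) : SCont IR (Cfg S τ) :=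
  ⟨fun a => E.plug (.ret (.real a)), by
    obtain ⟨s, l, r, h⟩ := E.plug_shape_reals (fun a => .ret (.real a))
      ⟨.ret (.real ()), [], [], fun a => ⟨rfl, rfl⟩⟩
    exact Tm.scottContinuous_of_reals _ s l r (fun a => (h a).1) fun a => (h a).2⟩

/-- The contractions that may happen under any evaluation context, except the evaluation of
constants. -/
inductive Contract : ∀ {τ : Ty}, Cfg S τ → Cfg S τ → Prop
  | fix {σ : Ty} (M : Cfg S (.arrow σ σ)) : Contract (.fix M) (.app M (.fix M))
  | beta {σ τ : Ty} (M : Tm S IR [σ] τ) (N : Cfg S σ) : Contract (.app (.lam M) N) (M.inst N)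
  | fst {σ τ : Ty} (M : Cfg S σ) (N : Cfg S τ) : Contract (.fst (.pair M N)) M
  | snd {σ τ : Ty} (M : Cfg S σ) (N : Cfg S τ) : Contract (.snd (.pair M N)) N
  | inl {σ τ υ : Ty} (M : Cfg S σ) (N : Cfg S (.arrow σ υ)) (P : Cfg S (.arrow τ υ)) :
      Contract (.case (.inl M) N P) (.app N M)
  | inr {σ τ υ : Ty} (M : Cfg S τ) (N : Cfg S (.arrow σ υ)) (P : Cfg S (.arrow τ υ)) :
      Contract (.case (.inr M) N P) (.app P M)

/-- The graph of the operational semantics on redexes: `NextRel L ν` if and only if `L` is the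
left-hand side of an instance of a rule, and `ν` is the continuous valuation that this instance
assigns to it. In the last rule, `M N` is an application `f a₁ ⋯ aₖ` with `k = α(f) ≠ 0`, whose
denotation is `f(a₁) ⋯ (aₖ)`. -/
inductive NextRel {τ : Ty} : Cfg S τ → Val (Cfg S τ) → Prop
  | sample (E : WCtx S (.dist .real) τ) (μ : S.Meas) :
      NextRel (E.plug (.sample μ)) (Val.ofMeasure μ.1 E.retReal)
  | score (E : WCtx S (.dist .unit) τ) (a : IR) :
      NextRel (E.plug (.score (.real a)))
        (ENNReal.ofReal a.abs • Val.dirac (E.plug (.ret (.const S.star))))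
  | bind {σ υ : Ty} (E : WCtx S (.dist υ) τ) (M : Cfg S σ) (N : Tm S IR [σ] (.dist υ)) :
      NextRel (E.plug (.bind (.ret M) N)) (Val.dirac (E.plug (N.inst M)))
  | contract {σ : Ty} (E : ECtx S σ τ) (M N : Cfg S σ) :
      Contract M N → NextRel (E.plug M) (Val.dirac (E.plug N))
  | const {σ β : Ty} (E : ECtx S β τ) (M : Cfg S (.arrow σ β)) (N : Cfg S σ) :
      IsConstApp M → IsAtom N → β.IsObservable → (h : IsObs β (sem (.app M N))) →
      NextRel (E.plug (.app M N)) (Val.dirac (E.plug (quote S β (sem (.app M N)) h)))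

/-- Redexes. -/
def IsRedex {τ : Ty} (M : Cfg S τ) : Prop := ∃ ν, NextRel M ν

/-- Blocked terms: the terms `E [f a₁ ⋯ aₖ]` with `k = α(f) ≠ 0` and `f(a₁) ⋯ (aₖ)` not
observable. -/
def IsBlocked {τ : Ty} (L : Cfg S τ) : Prop :=
  ∃ (σ β : Ty) (E : ECtx S β τ) (M : Cfg S (.arrow σ β)) (N : Cfg S σ),
    IsConstApp M ∧ IsAtom N ∧ β.IsObservable ∧ ¬ IsObs β (sem (.app M N)) ∧ L = E.plug (.app M N)

/-- Normal forms. -/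
def IsNormal {τ : Ty} (M : Cfg S τ) : Prop := ¬ IsRedex M ∧ ¬ IsBlocked M

open Classical in
/-- The operational semantics. (A term is the left-hand side of at most one instance of a rule.) -/
noncomputable def next {τ : Ty} (M : Cfg S τ) : Val (Cfg S τ) :=
  if h : ∃ ν, NextRel M ν then h.choose else 0

open Classical in
/-- `Next^{≤ 0}`. -/
noncomputable def nextZero {τ : Ty} (M : Cfg S τ) : Val (Cfg S τ) :=
  if IsNormal M then Val.dirac M else 0

/-- `Next^{≤ 1}`. -/
noncomputable def nextOne {τ : Ty} (M : Cfg S τ) : Val (Cfg S τ) := next M + nextZero M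

/-- `Next^{≤ n} (M) (U)`; thus `Next^{≤ n + 1} (M) (U) = ∫ Next^{≤ n} (N) (U) dNext^{≤ 1} (M)`
for `n ≥ 1`. -/
noncomputable def nextLe {τ : Ty} : ℕ → Cfg S τ → SOpens (Cfg S τ) → ℝ≥0∞
  | 0, M, U => nextZero M U
  | 1, M, U => nextOne M U
  | n + 2, M, U => (nextOne M).lint fun N => nextLe (n + 1) N U

/-- The open set of normal forms. (The set of normal forms is open, hence equal to its
interior.) -/
def normOpen (S : Sig.{u}) (τ : Ty) : SOpens (Cfg S τ) :=
  @Opens.interior (Cfg S τ) (Topology.scott (Cfg S τ) univ) {M | IsNormal M}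

/-- The reachability valuation `Next*`, on open sets: the supremum over `n ≥ 1` of the
restrictions of `Next^{≤ n} (M)` to the open set of normal forms. -/
noncomputable def nextStar {τ : Ty} (M : Cfg S τ) (U : SOpens (Cfg S τ)) : ℝ≥0∞ :=
  ⨆ n : ℕ, nextLe (n + 1) M (U ⊓ normOpen S τ)

/-- The set of terms `ret V`, where `V` is a normal form whose denotation lies in `U`. -/
def rover (S : Sig.{u}) {β : Ty} (U : SOpens β.dom) : Set (Cfg S (.dist β)) :=
  {M | ∃ V : Cfg S β, IsNormal V ∧ sem V ∈ U ∧ M = .ret V}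

end

end ISPCF

/-! The equality splits into two inequalities: one by induction on the number of steps, the other by
a logical relation. Both need some control over the operational semantics.

The rules are deterministic. To see this, what a term does is described by recursion on the term
itself (`WAct`, `EAct`) instead of by a choice of context and redex; uniqueness is then an induction
(`WAct.unique`, `EAct.unique`), and the choice made in `next` is harmless (`NextRel.unique`). The
order on terms moves only their real constants, and neither being a normal form nor the rule that
may apply depends on these, except that an application of a constant can pass from blocked to
observable. A map on terms is Scott-continuous once it is so in the assignment of intervals to the
constants of a term (`Tm.scottContinuous_of_map`). Hence integrals against `Next^{≤1}` of
Scott-continuous functions are again Scott-continuous in the term (`lint_nextOne_cont`), and so is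
`Next*`, which satisfies `Next*(M)(U) = ∫ Next*(N)(U) dNext^{≤1}(M)` (`nextStar_eq_lint`).

Soundness, `Next*(M)(U') ≤ ⟦M⟧(U)`, is `nextStar_le`. The function `M ↦ ⟦M⟧(U)` equals `1` on `U'`
and does not grow when it is averaged over one step (`NextRel.lint_le`). For sampling and scoring
this holds because a weak context around a hole of type `D σ` is a stack of binds, so that `⟦E[M]⟧ =
G†(⟦M⟧)` for some kernel `G` (`WCtx.isBind`); the other rules preserve denotations.

Adequacy, `⟦M⟧(U) ≤ Next*(M)(U')`, is `semD_le`. The relation `LR` between domain elements and terms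
is biorthogonal at `D τ`: `ν` is related to `M` if `∫ h dν ≤ Next*(E[M])(W)` for every
Scott-continuous `h` and weak context `E` such that `h(v) ≤ Next*(E[ret N])(W)` for all related `v`
and `N`. With this definition closure under directed suprema, needed for recursion, is immediate at
`D τ`, as integrals commute with directed suprema of valuations (`LR.sup`). The `do` construct is
the identity `∫ h d(f†μ) = ∫ (∫ h df(x)) dμ(x)`, valid for minimal valuations (`MVal.lint_bind`).
The fundamental property `LR.den` then relates every closed term to its denotation. Taking the empty
context and the indicator function of `U` for `h`, it remains to see that a term related to an
observable `v` evaluates to a value with denotation above `v` (`LR.exists_value`). -/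

namespace ISPCF

/-! ### Syntax -/

namespace Tm
variable {S : Sig.{u}} {R R' : Type}

/-- Apply a function to the real constants of a term. -/
def map (f : R → R') : ∀ {Γ : List Ty} {τ : Ty}, Tm S R Γ τ → Tm S R' Γ τ
  | _, _, .var v => .var v
  | _, _, .const c => .const c
  | _, _, .real a => .real (f a)
  | _, _, .sample μ => .sample μ
  | _, _, .score M => .score (M.map f)
  | _, _, .lam M => .lam (M.map f)
  | _, _, .app M N => .app (M.map f) (N.map f)
  | _, _, .fix M => .fix (M.map f)
  | _, _, .ret M => .ret (M.map f)
  | _, _, .bind M N => .bind (M.map f) (N.map f)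
  | _, _, .pair M N => .pair (M.map f) (N.map f)
  | _, _, .fst M => .fst (M.map f)
  | _, _, .snd M => .snd (M.map f)
  | _, _, .inl M => .inl (M.map f)
  | _, _, .inr M => .inr (M.map f)
  | _, _, .case M N P => .case (M.map f) (N.map f) (P.map f)

theorem shape_map (f : R → R') {Γ : List Ty} {τ : Ty} (M : Tm S R Γ τ) :
    (M.map f).shape = M.shape := by
  induction M <;> simp only [map, shape, *]

theorem reals_map (f : R → R') {Γ : List Ty} {τ : Ty} (M : Tm S R Γ τ) :
    (M.map f).reals = M.reals.map f := by
  induction M <;> simp only [map, reals, List.map_append, List.map_cons, List.map_nil, *]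

theorem map_rename (f : R → R') {Γ Δ : List Ty} {τ : Ty} (r : ∀ τ, Var Γ τ → Var Δ τ)
    (M : Tm S R Γ τ) : (M.rename r).map f = (M.map f).rename r := by
  induction M generalizing Δ <;> simp only [map, rename, *]

theorem map_subst (f : R → R') {Γ Δ : List Ty} {τ : Ty} (M : Tm S R Γ τ)
    (s : ∀ τ, Var Γ τ → Tm S R Δ τ) (s' : ∀ τ, Var Γ τ → Tm S R' Δ τ)
    (h : ∀ τ v, (s τ v).map f = s' τ v) : (M.subst s).map f = (M.map f).subst s' := by
  have hl : ∀ {Γ Δ : List Ty} {s : ∀ τ, Var Γ τ → Tm S R Δ τ}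
      {s' : ∀ τ, Var Γ τ → Tm S R' Δ τ}, (∀ τ v, (s τ v).map f = s' τ v) → ∀ σ τ v,
      (liftSub s σ τ v).map f = liftSub s' σ τ v := by
    intro Γ Δ s s' h σ τ v
    cases v with
    | zero => rfl
    | succ v => simp [liftSub, map_rename, h]
  induction M generalizing Δ with
  | lam M ih => simp [map, subst, ih _ _ (hl h _)]
  | bind M N ihM ihN => simp [map, subst, ihM _ _ h, ihN _ _ (hl h _)]
  | var v => simp [map, subst, h]
  | _ => simp only [map, subst, *]

theorem map_inst (f : R → R') {Γ : List Ty} {σ τ : Ty} (M : Tm S R (σ :: Γ) τ)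
    (N : Tm S R Γ σ) : (M.inst N).map f = (M.map f).inst (N.map f) :=
  map_subst f M _ _ fun _ v => by cases v <;> rfl

/-! ### The algebra of renamings and substitutions. -/

/-- Extend a substitution by a term for a new variable. -/
def consSub {Γ Δ : List Ty} {σ : Ty} (N : Tm S R Δ σ) (s : ∀ τ, Var Γ τ → Tm S R Δ τ) :
    ∀ τ, Var (σ :: Γ) τ → Tm S R Δ τ
  | _, .zero => N
  | _, .succ v => s _ v

theorem liftRen_comp {Γ Δ Θ : List Ty} (r : ∀ τ, Var Γ τ → Var Δ τ)
    (r' : ∀ τ, Var Δ τ → Var Θ τ) (σ : Ty) :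
    (fun τ v => liftRen r' σ τ (liftRen r σ τ v)) = liftRen (fun τ v => r' τ (r τ v)) σ := by
  funext τ v
  cases v <;> rfl

theorem rename_rename {Γ Δ Θ : List Ty} {τ : Ty} (M : Tm S R Γ τ) (r : ∀ τ, Var Γ τ → Var Δ τ)
    (r' : ∀ τ, Var Δ τ → Var Θ τ) :
    (M.rename r).rename r' = M.rename fun τ v => r' τ (r τ v) := by
  induction M generalizing Δ Θ <;> simp only [rename, liftRen_comp, *]

theorem liftSub_comp_liftRen {Γ Δ Θ : List Ty} (r : ∀ τ, Var Γ τ → Var Δ τ)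
    (s : ∀ τ, Var Δ τ → Tm S R Θ τ) (σ : Ty) :
    (fun τ v => liftSub s σ τ (liftRen r σ τ v)) = liftSub (fun τ v => s τ (r τ v)) σ := by
  funext τ v
  cases v <;> rfl

theorem subst_rename {Γ Δ Θ : List Ty} {τ : Ty} (M : Tm S R Γ τ) (r : ∀ τ, Var Γ τ → Var Δ τ)
    (s : ∀ τ, Var Δ τ → Tm S R Θ τ) :
    (M.rename r).subst s = M.subst fun τ v => s τ (r τ v) := by
  induction M generalizing Δ Θ <;> simp only [rename, subst, liftSub_comp_liftRen, *]

theorem rename_liftSub {Γ Δ Θ : List Ty} (s : ∀ τ, Var Γ τ → Tm S R Δ τ)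
    (r : ∀ τ, Var Δ τ → Var Θ τ) (σ : Ty) :
    (fun τ v => (liftSub s σ τ v).rename (liftRen r σ))
      = liftSub (fun τ v => (s τ v).rename r) σ := by
  funext τ v
  cases v with
  | zero => rfl
  | succ v => simp [liftSub, rename_rename, liftRen]

theorem rename_subst {Γ Δ Θ : List Ty} {τ : Ty} (M : Tm S R Γ τ)
    (s : ∀ τ, Var Γ τ → Tm S R Δ τ) (r : ∀ τ, Var Δ τ → Var Θ τ) :
    (M.subst s).rename r = M.subst fun τ v => (s τ v).rename r := by
  induction M generalizing Δ Θ <;> simp only [rename, subst, rename_liftSub, *]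

/-- Under a binder the substituted terms are weakened, so composing two lifted substitutions takes
both mixed laws, `subst_rename` and `rename_subst`. -/
theorem subst_liftSub {Γ Δ Θ : List Ty} (s : ∀ τ, Var Γ τ → Tm S R Δ τ)
    (t : ∀ τ, Var Δ τ → Tm S R Θ τ) (σ : Ty) :
    (fun τ v => (liftSub s σ τ v).subst (liftSub t σ))
      = liftSub (fun τ v => (s τ v).subst t) σ := by
  funext τ v
  cases v with
  | zero => rfl
  | succ v => simp [liftSub, subst_rename, rename_subst]

theorem subst_subst {Γ Δ Θ : List Ty} {τ : Ty} (M : Tm S R Γ τ)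
    (s : ∀ τ, Var Γ τ → Tm S R Δ τ) (t : ∀ τ, Var Δ τ → Tm S R Θ τ) :
    (M.subst s).subst t = M.subst fun τ v => (s τ v).subst t := by
  induction M generalizing Δ Θ <;> simp only [subst, subst_liftSub, *]

theorem liftSub_var {Γ : List Ty} (σ : Ty) :
    liftSub (fun τ (v : Var Γ τ) => (.var v : Tm S R Γ τ)) σ = fun _ v => .var v := by
  funext τ v
  cases v <;> rfl

theorem subst_var {Γ : List Ty} {τ : Ty} (M : Tm S R Γ τ) : M.subst (fun _ v => .var v) = M := by
  induction M <;> simp only [subst, liftSub_var, *]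

/-- This is what the cases of abstraction and `do` in the fundamental property need: contracting a
closed instance of a term with a bound variable extends the closing substitution by one term. -/
theorem inst_subst_liftSub {Γ Δ : List Ty} {σ τ : Ty} (M : Tm S R (σ :: Γ) τ)
    (s : ∀ τ, Var Γ τ → Tm S R Δ τ) (N : Tm S R Δ σ) :
    (M.subst (liftSub s σ)).inst N = M.subst (consSub N s) := by
  rw [inst, subst_subst]
  congr 1
  funext τ v
  cases v with
  | zero => rfl
  | succ v =>
    simp only [liftSub, subst_rename, consSub]
    exact subst_var _

/-! Terms of a given shape. -/

section
variable {Γ : List Ty} {σ τ υ : Ty}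

theorem of_shape_const {c : S.Const τ} {N : Tm S R Γ τ} (h : N.shape = .const c) :
    N = .const c := by
  cases N <;> simp_all [shape]

theorem of_shape_real {N : Tm S R Γ .real} (h : N.shape = .real ()) : ∃ a, N = .real a := by
  cases N <;> simp_all [shape]

theorem of_shape_sample {μ : S.Meas} {N : Tm S R Γ (.dist .real)} (h : N.shape = .sample μ) :
    N = .sample μ := by
  cases N <;> simp_all [shape]

theorem of_shape_score {M : Tm S Unit Γ .real} {N : Tm S R Γ (.dist .unit)}
    (h : N.shape = .score M) : ∃ M', N = .score M' ∧ M'.shape = M := by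
  cases N <;> simp_all [shape]

theorem of_shape_lam {M : Tm S Unit (σ :: Γ) τ} {N : Tm S R Γ (.arrow σ τ)}
    (h : N.shape = .lam M) : ∃ M', N = .lam M' ∧ M'.shape = M := by
  cases N <;> simp_all [shape]

theorem of_shape_app {M : Tm S Unit Γ (.arrow σ τ)} {P : Tm S Unit Γ σ} {N : Tm S R Γ τ}
    (h : N.shape = .app M P) : ∃ M' P', N = .app M' P' ∧ M'.shape = M ∧ P'.shape = P := by
  cases N <;> simp [shape] at h
  obtain ⟨rfl, h1, h2⟩ := h
  exact ⟨_, _, rfl, eq_of_heq h1, eq_of_heq h2⟩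

theorem of_shape_fix {M : Tm S Unit Γ (.arrow τ τ)} {N : Tm S R Γ τ}
    (h : N.shape = .fix M) : ∃ M', N = .fix M' ∧ M'.shape = M := by
  cases N <;> simp_all [shape]

theorem of_shape_ret {M : Tm S Unit Γ τ} {N : Tm S R Γ (.dist τ)}
    (h : N.shape = .ret M) : ∃ M', N = .ret M' ∧ M'.shape = M := by
  cases N <;> simp_all [shape]

theorem of_shape_bind {M : Tm S Unit Γ (.dist σ)} {P : Tm S Unit (σ :: Γ) (.dist τ)}
    {N : Tm S R Γ (.dist τ)} (h : N.shape = .bind M P) :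
    ∃ M' P', N = .bind M' P' ∧ M'.shape = M ∧ P'.shape = P := by
  cases N <;> simp [shape] at h
  obtain ⟨rfl, h1, h2⟩ := h
  exact ⟨_, _, rfl, eq_of_heq h1, eq_of_heq h2⟩

theorem of_shape_pair {M : Tm S Unit Γ σ} {P : Tm S Unit Γ τ} {N : Tm S R Γ (.prod σ τ)}
    (h : N.shape = .pair M P) : ∃ M' P', N = .pair M' P' ∧ M'.shape = M ∧ P'.shape = P := by
  cases N <;> simp_all [shape]

theorem of_shape_fst {M : Tm S Unit Γ (.prod σ τ)} {N : Tm S R Γ σ}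
    (h : N.shape = .fst M) : ∃ M', N = .fst M' ∧ M'.shape = M := by
  cases N <;> simp [shape] at h
  obtain ⟨rfl, h1⟩ := h
  exact ⟨_, rfl, eq_of_heq h1⟩

theorem of_shape_snd {M : Tm S Unit Γ (.prod σ τ)} {N : Tm S R Γ τ}
    (h : N.shape = .snd M) : ∃ M', N = .snd M' ∧ M'.shape = M := by
  cases N <;> simp [shape] at h
  obtain ⟨rfl, h1⟩ := h
  exact ⟨_, rfl, eq_of_heq h1⟩

theorem of_shape_inl {M : Tm S Unit Γ σ} {N : Tm S R Γ (.sum σ τ)}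
    (h : N.shape = .inl M) : ∃ M', N = .inl M' ∧ M'.shape = M := by
  cases N <;> simp_all [shape]

theorem of_shape_inr {M : Tm S Unit Γ τ} {N : Tm S R Γ (.sum σ τ)}
    (h : N.shape = .inr M) : ∃ M', N = .inr M' ∧ M'.shape = M := by
  cases N <;> simp_all [shape]

theorem of_shape_case {M : Tm S Unit Γ (.sum σ τ)} {P : Tm S Unit Γ (.arrow σ υ)}
    {Q : Tm S Unit Γ (.arrow τ υ)} {N : Tm S R Γ υ} (h : N.shape = .case M P Q) :
    ∃ M' P' Q', N = .case M' P' Q' ∧ M'.shape = M ∧ P'.shape = P ∧ Q'.shape = Q := by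
  cases N <;> simp [shape] at h
  obtain ⟨rfl, rfl, h1, h2, h3⟩ := h
  exact ⟨_, _, _, rfl, eq_of_heq h1, eq_of_heq h2, eq_of_heq h3⟩

end

/-! The order on terms. -/

section
variable [PartialOrder R] {Γ : List Ty} {σ τ υ : Ty}

theorem real_le_real {a b : R} : (.real a : Tm S R Γ .real) ≤ .real b ↔ a ≤ b := by
  simp [le_def, shape, reals]

theorem score_le_score {M N : Tm S R Γ .real} : M.score ≤ N.score ↔ M ≤ N := by
  simp [le_def, shape, reals]

theorem lam_le_lam {M N : Tm S R (σ :: Γ) τ} : M.lam ≤ N.lam ↔ M ≤ N := by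
  simp [le_def, shape, reals]

theorem fix_le_fix {M N : Tm S R Γ (.arrow τ τ)} : M.fix ≤ N.fix ↔ M ≤ N := by
  simp [le_def, shape, reals]

theorem ret_le_ret {M N : Tm S R Γ τ} : M.ret ≤ N.ret ↔ M ≤ N := by
  simp [le_def, shape, reals]

theorem fst_le_fst {M N : Tm S R Γ (.prod σ τ)} : M.fst ≤ N.fst ↔ M ≤ N := by
  simp [le_def, shape, reals]

theorem snd_le_snd {M N : Tm S R Γ (.prod σ τ)} : M.snd ≤ N.snd ↔ M ≤ N := by
  simp [le_def, shape, reals]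

theorem inl_le_inl {M N : Tm S R Γ σ} : (M.inl : Tm S R Γ (.sum σ τ)) ≤ N.inl ↔ M ≤ N := by
  simp [le_def, shape, reals]

theorem inr_le_inr {M N : Tm S R Γ τ} : (M.inr : Tm S R Γ (.sum σ τ)) ≤ N.inr ↔ M ≤ N := by
  simp [le_def, shape, reals]

/-- The equality of lengths makes the point of division the same on both sides. Below it comes from
equality of shapes, through `length_reals_eq`. -/
theorem forall₂_append_iff {l₁ l₂ m₁ m₂ : List R} (h : l₁.length = m₁.length) :
    List.Forall₂ (· ≤ ·) (l₁ ++ l₂) (m₁ ++ m₂) ↔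
      List.Forall₂ (· ≤ ·) l₁ m₁ ∧ List.Forall₂ (· ≤ ·) l₂ m₂ := by
  refine ⟨fun h' => ?_, fun h' => List.rel_append h'.1 h'.2⟩
  induction l₁ generalizing m₁ with
  | nil =>
    cases m₁ with
    | nil => exact ⟨.nil, h'⟩
    | cons => simp at h
  | cons a l ih =>
    cases m₁ with
    | nil => simp at h
    | cons b m =>
      simp only [List.cons_append, List.forall₂_cons] at h' ⊢
      obtain ⟨h1, h2⟩ := ih (by simpa using h) h'.2
      exact ⟨⟨h'.1, h1⟩, h2⟩

theorem app_le_app {M M' : Tm S R Γ (.arrow σ τ)} {N N' : Tm S R Γ σ} :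
    M.app N ≤ M'.app N' ↔ M ≤ M' ∧ N ≤ N' := by
  simp only [le_def, shape, reals, app.injEq, heq_eq_eq, true_and]
  constructor
  · rintro ⟨⟨h1, h2⟩, h3⟩
    rw [forall₂_append_iff (length_reals_eq h1)] at h3
    exact ⟨⟨h1, h3.1⟩, h2, h3.2⟩
  · rintro ⟨⟨h1, h3⟩, h2, h4⟩
    exact ⟨⟨h1, h2⟩, List.rel_append h3 h4⟩

theorem bind_le_bind {M M' : Tm S R Γ (.dist σ)} {N N' : Tm S R (σ :: Γ) (.dist τ)} :
    M.bind N ≤ M'.bind N' ↔ M ≤ M' ∧ N ≤ N' := by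
  simp only [le_def, shape, reals, bind.injEq, heq_eq_eq, true_and]
  constructor
  · rintro ⟨⟨h1, h2⟩, h3⟩
    rw [forall₂_append_iff (length_reals_eq h1)] at h3
    exact ⟨⟨h1, h3.1⟩, h2, h3.2⟩
  · rintro ⟨⟨h1, h3⟩, h2, h4⟩
    exact ⟨⟨h1, h2⟩, List.rel_append h3 h4⟩

theorem pair_le_pair {M M' : Tm S R Γ σ} {N N' : Tm S R Γ τ} :
    M.pair N ≤ M'.pair N' ↔ M ≤ M' ∧ N ≤ N' := by
  simp only [le_def, shape, reals, pair.injEq]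
  constructor
  · rintro ⟨⟨h1, h2⟩, h3⟩
    rw [forall₂_append_iff (length_reals_eq h1)] at h3
    exact ⟨⟨h1, h3.1⟩, h2, h3.2⟩
  · rintro ⟨⟨h1, h3⟩, h2, h4⟩
    exact ⟨⟨h1, h2⟩, List.rel_append h3 h4⟩

theorem case_le_case {M M' : Tm S R Γ (.sum σ τ)} {N N' : Tm S R Γ (.arrow σ υ)}
    {P P' : Tm S R Γ (.arrow τ υ)} :
    M.case N P ≤ M'.case N' P' ↔ M ≤ M' ∧ N ≤ N' ∧ P ≤ P' := by
  simp only [le_def, shape, reals, case.injEq, heq_eq_eq, true_and]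
  constructor
  · rintro ⟨⟨h1, h2, h3⟩, h4⟩
    rw [forall₂_append_iff (length_reals_eq h1), forall₂_append_iff (length_reals_eq h2)] at h4
    exact ⟨⟨h1, h4.1⟩, ⟨h2, h4.2.1⟩, h3, h4.2.2⟩
  · rintro ⟨⟨h1, h4⟩, ⟨h2, h5⟩, h3, h6⟩
    exact ⟨⟨h1, h2, h3⟩, List.rel_append h4 (List.rel_append h5 h6)⟩

end

end Tm

/-! ### Scott-continuity of the term constructors -/

/-- An upper bound of the image of a nonempty set lies above one value of `C`, hence is itself a
value of `C`, and `C` reflects the order. Term constructors qualify because a term above one with a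
given head constructor has the same head. -/
theorem scottContinuous_of_embedding {A B : Type*} [Preorder A] [Preorder B] (C : A → B)
    (hle : ∀ a a', C a ≤ C a' ↔ a ≤ a') (hinv : ∀ a b, C a ≤ b → ∃ a', b = C a') :
    ScottContinuous C := by
  refine ScottContinuous.mk' (fun a b h => (hle _ _).2 h) fun d hd hd' a ha b hb => ?_
  obtain ⟨x, hx⟩ := hd
  obtain ⟨a', rfl⟩ := hinv x b (hb x hx)
  exact (hle _ _).2 (ha.2 fun y hy => (hle _ _).1 (hb y hy))

namespace Tm
variable {S : Sig.{u}} {Γ : List Ty} {σ τ υ : Ty}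

theorem real_cont : ScottContinuous (fun a => (.real a : Tm S IR Γ .real)) :=
  scottContinuous_of_embedding _ (fun _ _ => real_le_real) fun _ _ h => of_shape_real h.1.symm

theorem score_cont : ScottContinuous (score : Tm S IR Γ .real → _) :=
  scottContinuous_of_embedding _ (fun _ _ => score_le_score) fun _ _ h =>
    (of_shape_score h.1.symm).imp fun _ h => h.1

theorem lam_cont : ScottContinuous (lam : Tm S IR (σ :: Γ) τ → _) :=
  scottContinuous_of_embedding _ (fun _ _ => lam_le_lam) fun _ _ h =>
    (of_shape_lam h.1.symm).imp fun _ h => h.1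

theorem fix_cont : ScottContinuous (fix : Tm S IR Γ (.arrow τ τ) → _) :=
  scottContinuous_of_embedding _ (fun _ _ => fix_le_fix) fun _ _ h =>
    (of_shape_fix h.1.symm).imp fun _ h => h.1

theorem ret_cont : ScottContinuous (ret : Tm S IR Γ τ → _) :=
  scottContinuous_of_embedding _ (fun _ _ => ret_le_ret) fun _ _ h =>
    (of_shape_ret h.1.symm).imp fun _ h => h.1

theorem fst_cont : ScottContinuous (fst : Tm S IR Γ (.prod σ τ) → _) :=
  scottContinuous_of_embedding _ (fun _ _ => fst_le_fst) fun _ _ h =>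
    (of_shape_fst h.1.symm).imp fun _ h => h.1

theorem snd_cont : ScottContinuous (snd : Tm S IR Γ (.prod σ τ) → _) :=
  scottContinuous_of_embedding _ (fun _ _ => snd_le_snd) fun _ _ h =>
    (of_shape_snd h.1.symm).imp fun _ h => h.1

theorem inl_cont : ScottContinuous (inl : Tm S IR Γ σ → Tm S IR Γ (.sum σ τ)) :=
  scottContinuous_of_embedding _ (fun _ _ => inl_le_inl) fun _ _ h =>
    (of_shape_inl h.1.symm).imp fun _ h => h.1

theorem inr_cont : ScottContinuous (inr : Tm S IR Γ τ → Tm S IR Γ (.sum σ τ)) :=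
  scottContinuous_of_embedding _ (fun _ _ => inr_le_inr) fun _ _ h =>
    (of_shape_inr h.1.symm).imp fun _ h => h.1

theorem app_cont : ScottContinuous
    (fun p : Tm S IR Γ (.arrow σ τ) × Tm S IR Γ σ => p.1.app p.2) :=
  scottContinuous_of_embedding _ (fun _ _ => app_le_app) fun _ _ h =>
    let ⟨M, N, h, _⟩ := of_shape_app h.1.symm; ⟨(M, N), h⟩

theorem bind_cont : ScottContinuous
    (fun p : Tm S IR Γ (.dist σ) × Tm S IR (σ :: Γ) (.dist τ) => p.1.bind p.2) :=
  scottContinuous_of_embedding _ (fun _ _ => bind_le_bind) fun _ _ h =>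
    let ⟨M, N, h, _⟩ := of_shape_bind h.1.symm; ⟨(M, N), h⟩

theorem pair_cont : ScottContinuous (fun p : Tm S IR Γ σ × Tm S IR Γ τ => p.1.pair p.2) :=
  scottContinuous_of_embedding _ (fun _ _ => pair_le_pair) fun _ _ h =>
    let ⟨M, N, h, _⟩ := of_shape_pair h.1.symm; ⟨(M, N), h⟩

theorem case_cont : ScottContinuous (fun p : Tm S IR Γ (.sum σ τ) ×
    Tm S IR Γ (.arrow σ υ) × Tm S IR Γ (.arrow τ υ) => p.1.case p.2.1 p.2.2) :=
  scottContinuous_of_embedding _ (fun _ _ => case_le_case) fun _ _ h =>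
    let ⟨M, N, P, h, _⟩ := of_shape_case h.1.symm; ⟨(M, N, P), h⟩

/-! ### Terms of one shape as instances of a linear term. -/

theorem map_cont (M : Tm S IR Γ τ) : ScottContinuous (fun θ : IR → IR => M.map θ) := by
  induction M with
  | var | const | sample => exact ScottContinuous.const _
  | real a =>
    refine ScottContinuous.comp (f := fun θ : IR → IR => θ a) ?_ real_cont
    intro d _ _ θ h
    exact isLUB_pi.1 h a
  | score M ih => exact ih.comp score_cont
  | lam M ih => exact ih.comp lam_cont
  | fix M ih => exact ih.comp fix_cont
  | ret M ih => exact ih.comp ret_cont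
  | fst M ih => exact ih.comp fst_cont
  | snd M ih => exact ih.comp snd_cont
  | inl M ih => exact ih.comp inl_cont
  | inr M ih => exact ih.comp inr_cont
  | app M N ih ih' => exact (ih.prodMk ih').comp app_cont
  | bind M N ih ih' => exact (ih.prodMk ih').comp bind_cont
  | pair M N ih ih' => exact (ih.prodMk ih').comp pair_cont
  | case M N P ih ih' ih'' => exact (ih.prodMk (ih'.prodMk ih'')).comp case_cont

/-- Every list of the right length occurs as the list of reals of a term of a given shape. -/
theorem exists_reals_eq {R R' : Type} (M : Tm S R Γ τ) (l : List R')
    (hl : l.length = M.reals.length) : ∃ N : Tm S R' Γ τ, N.shape = M.shape ∧ N.reals = l := by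
  have split : ∀ {l : List R'} {m n : ℕ}, l.length = m + n →
      ∃ l₁ l₂, l = l₁ ++ l₂ ∧ l₁.length = m ∧ l₂.length = n := fun {l m n} h =>
    ⟨l.take m, l.drop m, (List.take_append_drop _ _).symm, by simp; omega, by simp; omega⟩
  induction M generalizing l with
  | var v => exact ⟨.var v, rfl, (List.length_eq_zero_iff.1 hl).symm⟩
  | const c => exact ⟨.const c, rfl, (List.length_eq_zero_iff.1 hl).symm⟩
  | sample μ => exact ⟨.sample μ, rfl, (List.length_eq_zero_iff.1 hl).symm⟩
  | real a =>
    obtain ⟨b, rfl⟩ := List.length_eq_one_iff.1 hl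
    exact ⟨.real b, rfl, rfl⟩
  | score M ih => obtain ⟨N, h, h'⟩ := ih l hl; exact ⟨.score N, congrArg _ h, h'⟩
  | lam M ih => obtain ⟨N, h, h'⟩ := ih l hl; exact ⟨.lam N, congrArg _ h, h'⟩
  | fix M ih => obtain ⟨N, h, h'⟩ := ih l hl; exact ⟨.fix N, congrArg _ h, h'⟩
  | ret M ih => obtain ⟨N, h, h'⟩ := ih l hl; exact ⟨.ret N, congrArg _ h, h'⟩
  | fst M ih => obtain ⟨N, h, h'⟩ := ih l hl; exact ⟨.fst N, congrArg _ h, h'⟩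
  | snd M ih => obtain ⟨N, h, h'⟩ := ih l hl; exact ⟨.snd N, congrArg _ h, h'⟩
  | inl M ih => obtain ⟨N, h, h'⟩ := ih l hl; exact ⟨.inl N, congrArg _ h, h'⟩
  | inr M ih => obtain ⟨N, h, h'⟩ := ih l hl; exact ⟨.inr N, congrArg _ h, h'⟩
  | app M P ih ih' =>
    obtain ⟨l₁, l₂, rfl, h₁, h₂⟩ := split (hl.trans List.length_append)
    obtain ⟨M', h1, h2⟩ := ih _ h₁
    obtain ⟨P', h3, h4⟩ := ih' _ h₂
    exact ⟨.app M' P', by rw [shape, shape, h1, h3], by rw [reals, h2, h4]⟩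
  | bind M P ih ih' =>
    obtain ⟨l₁, l₂, rfl, h₁, h₂⟩ := split (hl.trans List.length_append)
    obtain ⟨M', h1, h2⟩ := ih _ h₁
    obtain ⟨P', h3, h4⟩ := ih' _ h₂
    exact ⟨.bind M' P', by rw [shape, shape, h1, h3], by rw [reals, h2, h4]⟩
  | pair M P ih ih' =>
    obtain ⟨l₁, l₂, rfl, h₁, h₂⟩ := split (hl.trans List.length_append)
    obtain ⟨M', h1, h2⟩ := ih _ h₁
    obtain ⟨P', h3, h4⟩ := ih' _ h₂
    exact ⟨.pair M' P', by rw [shape, shape, h1, h3], by rw [reals, h2, h4]⟩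
  | case M P Q ih ih' ih'' =>
    obtain ⟨l₁, l₂, rfl, h₁, h₂⟩ := split (hl.trans List.length_append)
    obtain ⟨l₂, l₃, rfl, h₂, h₃⟩ := split (h₂.trans List.length_append)
    obtain ⟨M', h1, h2⟩ := ih _ h₁
    obtain ⟨P', h3, h4⟩ := ih' _ h₂
    obtain ⟨Q', h5, h6⟩ := ih'' _ h₃
    exact ⟨.case M' P' Q', by rw [shape, shape, h1, h3, h5], by rw [reals, h2, h4, h6]⟩

open Classical in
/-- The assignment that sends the interval `[i, i]` to the `i`-th real of `N`. -/
noncomputable def assign (N : Tm S IR Γ τ) (a : IR) : IR :=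
  -- The intervals `[i, i]` with `i` a natural number serve as names of positions. All other
  -- intervals, and names beyond the last position, go to `[0, 0]`, so that the assignments of two
  -- terms of the same shape differ only at names in use.
  if a = IR.point ⌊a.lo⌋₊ then N.reals.getD ⌊a.lo⌋₊ (IR.point 0) else IR.point 0

theorem assign_point (N : Tm S IR Γ τ) (i : ℕ) :
    N.assign (IR.point i) = N.reals.getD i (IR.point 0) := by
  simp [assign]

/-- Terms of a given shape are the instances of a linear term. -/
theorem exists_linear (M : Tm S IR Γ τ) : ∃ M₀ : Tm S IR Γ τ, M₀.shape = M.shape ∧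
    M₀.reals = (List.range M.reals.length).map fun i : ℕ => IR.point i :=
  exists_reals_eq M _ (by simp)

/-- In the linear term `M₀` the constants at different positions are different, so a single function
on intervals can prescribe all of them independently. -/
theorem map_assign {M M₀ N : Tm S IR Γ τ} (h : M₀.shape = M.shape)
    (hM₀ : M₀.reals = (List.range M.reals.length).map fun i : ℕ => IR.point i)
    (hN : N.shape = M.shape) : M₀.map N.assign = N := by
  refine eq_of_shape_reals _ _ (by rw [shape_map, h, hN]) ?_
  rw [reals_map, hM₀, List.map_map]
  have hl := length_reals_eq hN
  refine List.ext_getElem (by simp [hl]) fun i h1 h2 => ?_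
  simp [assign_point, h2]

theorem assign_mono {M N : Tm S IR Γ τ} (h : M ≤ N) : M.assign ≤ N.assign := by
  intro a
  unfold assign
  split_ifs
  · generalize ⌊a.lo⌋₊ = i
    have h2 := h.2
    generalize M.reals = l at h2
    generalize N.reals = m at h2
    induction h2 generalizing i with
    | nil => exact le_rfl
    | cons h _ ih =>
      cases i with
      | zero => exact h
      | succ i => exact ih i
  · exact le_rfl

/-- Scott-continuity of a map on terms, in terms of the assignments to their reals. -/
theorem scottContinuous_of_map {Y : Type*} [Preorder Y] {F : Tm S IR Γ τ → Y}
    (hF : ∀ M : Tm S IR Γ τ, ScottContinuous fun θ : IR → IR => F (M.map θ)) : ScottContinuous F := by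
  intro d hd hd' M hM
  obtain ⟨M₀, h, hM₀⟩ := exists_linear M
  have key : ∀ N ∈ d, M₀.map N.assign = N := fun N hN => map_assign h hM₀ (hM.1 hN).1
  have keyM : M₀.map M.assign = M := map_assign h hM₀ rfl
  -- The directed family of terms becomes a directed family of assignments applied to the fixed term
  -- `M₀`; only its supremum has to be identified.
  have hl : IsLUB (assign '' d) M.assign := by
    refine ⟨?_, fun b hb a => ?_⟩
    · rintro _ ⟨N, hN, rfl⟩
      exact assign_mono (hM.1 hN)
    -- An upper bound `b` of the assignments produces the upper bound `M₀.map b` of `d`. This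
    -- compares `M.assign` with `b` at the constants of `M₀`.
    have hle : M₀.map M.assign ≤ M₀.map b := by
      rw [keyM]
      refine hM.2 fun N hN => ?_
      rw [← key N hN]
      exact (map_cont M₀).monotone (hb ⟨N, hN, rfl⟩)
    have hle := hle.2
    rw [reals_map, reals_map, List.forall₂_map_left_iff, List.forall₂_map_right_iff,
      List.forall₂_same] at hle
    obtain ⟨N, hN⟩ := hd
    by_cases ha : a ∈ M₀.reals
    · exact hle a ha
    -- At the remaining intervals `M.assign` and `N.assign` both take the default value, so a single
    -- member `N` of `d` is enough.
    · refine le_trans (le_of_eq ?_) (hb ⟨N, hN, rfl⟩ a)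
      unfold assign
      split_ifs with hp
      · have hlen := length_reals_eq (hM.1 hN).1
        have : M.reals.length ≤ ⌊a.lo⌋₊ := by
          by_contra! hlt
          refine ha ?_
          rw [hM₀, List.mem_map]
          exact ⟨_, List.mem_range.2 hlt, hp.symm⟩
        rw [List.getD_eq_default _ _ this, List.getD_eq_default _ _ (hlen ▸ this)]
      · rfl
  have := hF M₀ (hd.image _) (hd'.mono_comp fun _ _ h => assign_mono h) hl
  rw [image_image] at this
  dsimp only at this
  rwa [keyM, image_congr fun N hN => by rw [key N hN]] at this

end Tm

/-! ### Evaluation contexts -/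

section
variable {S : Sig.{u}}

theorem IsAtom.of_shape {τ : Ty} {M N : Cfg S τ} (hM : IsAtom M) (h : N.shape = M.shape) :
    IsAtom N := by
  cases hM with
  | const c hc => rw [Tm.of_shape_const h]; exact .const c hc
  | real a => obtain ⟨b, rfl⟩ := Tm.of_shape_real h; exact .real b

theorem IsConstApp.of_shape {τ : Ty} {M N : Cfg S τ} (hM : IsConstApp M)
    (h : N.shape = M.shape) : IsConstApp N := by
  induction hM with
  | const c => rw [Tm.of_shape_const h]; exact .const c
  | app M P _ hP ih =>
    obtain ⟨M', P', rfl, h1, h2⟩ := Tm.of_shape_app h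
    exact .app _ _ (ih h1) (hP.of_shape h2)

theorem IsValue.of_shape {τ : Ty} {M N : Cfg S τ} (hM : IsValue M)
    (h : N.shape = M.shape) : IsValue N := by
  induction hM with
  | atom M hM => exact .atom _ (hM.of_shape h)
  | lam M => obtain ⟨M', rfl, -⟩ := Tm.of_shape_lam h; exact .lam _
  | ret V _ ih => obtain ⟨M', rfl, h1⟩ := Tm.of_shape_ret h; exact .ret _ (ih h1)
  | pair V W _ _ ih ih' =>
    obtain ⟨V', W', rfl, h1, h2⟩ := Tm.of_shape_pair h
    exact .pair _ _ (ih h1) (ih' h2)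
  | inl V _ ih => obtain ⟨M', rfl, h1⟩ := Tm.of_shape_inl h; exact .inl _ (ih h1)
  | inr V _ ih => obtain ⟨M', rfl, h1⟩ := Tm.of_shape_inr h; exact .inr _ (ih h1)
  | constApp M hM => exact .constApp _ (hM.of_shape h)

/-- Apply a function to the real constants of a context. -/
def WCtx.map (θ : IR → IR) {σ : Ty} : ∀ {τ : Ty}, WCtx S σ τ → WCtx S σ τ
  | _, .hole => .hole
  | _, .score E => .score (E.map θ)
  | _, .app E N => .app (E.map θ) (N.map θ)
  | _, .bind E N => .bind (E.map θ) (N.map θ)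
  | _, .arg P h E => .arg (P.map θ) (h.of_shape (P.shape_map θ)) (E.map θ)
  | _, .case E N P => .case (E.map θ) (N.map θ) (P.map θ)
  | _, .fst E => .fst (E.map θ)
  | _, .snd E => .snd (E.map θ)

/-- Apply a function to the real constants of a context. -/
def ECtx.map (θ : IR → IR) {σ : Ty} : ∀ {τ : Ty}, ECtx S σ τ → ECtx S σ τ
  | _, .weak E => .weak (E.map θ)
  | _, .ret E => .ret (E.map θ)
  | _, .pairL E N => .pairL (E.map θ) (N.map θ)
  | _, .pairR V h E => .pairR (V.map θ) (h.of_shape (V.shape_map θ)) (E.map θ)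
  | _, .inl E => .inl (E.map θ)
  | _, .inr E => .inr (E.map θ)

theorem WCtx.map_plug (θ : IR → IR) {σ τ : Ty} (E : WCtx S σ τ) (M : Cfg S σ) :
    (E.plug M).map θ = (E.map θ).plug (M.map θ) := by
  induction E <;> simp only [plug, map, Tm.map, *]

theorem ECtx.map_plug (θ : IR → IR) {σ τ : Ty} (E : ECtx S σ τ) (M : Cfg S σ) :
    (E.plug M).map θ = (E.map θ).plug (M.map θ) := by
  induction E <;> simp only [plug, map, Tm.map, WCtx.map_plug, *]

/-- The constants of the context and the term in its hole vary along the same parameter. In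
`quote_plug_cont` the parameter is a pair, one component for each. -/
theorem WCtx.plug_cont {Θ : Type*} [Preorder Θ] {g : Θ → IR → IR} (hg : ScottContinuous g)
    {σ : Ty} {X : Θ → Cfg S σ} (hX : ScottContinuous X) {τ : Ty} (E : WCtx S σ τ) :
    ScottContinuous fun t => (E.map (g t)).plug (X t) := by
  have hm : ∀ {Γ : List Ty} {τ : Ty} (M : Tm S IR Γ τ), ScottContinuous fun t => M.map (g t) :=
    fun M => hg.comp (Tm.map_cont M)
  induction E with
  | hole => exact hX
  | score E ih => exact ih.comp Tm.score_cont
  | app E N ih => exact (ih.prodMk (hm N)).comp Tm.app_cont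
  | bind E N ih => exact (ih.prodMk (hm N)).comp Tm.bind_cont
  | arg P _ E ih => exact ((hm P).prodMk ih).comp Tm.app_cont
  | case E N P ih => exact (ih.prodMk ((hm N).prodMk (hm P))).comp Tm.case_cont
  | fst E ih => exact ih.comp Tm.fst_cont
  | snd E ih => exact ih.comp Tm.snd_cont

theorem ECtx.plug_cont {Θ : Type*} [Preorder Θ] {g : Θ → IR → IR} (hg : ScottContinuous g)
    {σ : Ty} {X : Θ → Cfg S σ} (hX : ScottContinuous X) {τ : Ty} (E : ECtx S σ τ) :
    ScottContinuous fun t => (E.map (g t)).plug (X t) := by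
  have hm : ∀ {Γ : List Ty} {τ : Ty} (M : Tm S IR Γ τ), ScottContinuous fun t => M.map (g t) :=
    fun M => hg.comp (Tm.map_cont M)
  induction E with
  | weak E => exact E.plug_cont hg hX
  | ret E ih => exact ih.comp Tm.ret_cont
  | pairL E N ih => exact (ih.prodMk (hm N)).comp Tm.pair_cont
  | pairR V _ E ih => exact ((hm V).prodMk ih).comp Tm.pair_cont
  | inl E ih => exact ih.comp Tm.inl_cont
  | inr E ih => exact ih.comp Tm.inr_cont

/-- The terms of the shape of `E [L]` are plugs of terms of the shape of `L`. -/
theorem WCtx.of_shape {σ τ : Ty} (E : WCtx S σ τ) (L : Cfg S σ) {N : Cfg S τ}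
    (h : N.shape = (E.plug L).shape) :
    ∃ (E' : WCtx S σ τ) (L' : Cfg S σ), N = E'.plug L' ∧ L'.shape = L.shape := by
  induction E with
  | hole => exact ⟨.hole, N, rfl, h⟩
  | score E ih =>
    obtain ⟨M, rfl, h1⟩ := Tm.of_shape_score h
    obtain ⟨E', L', rfl, h'⟩ := ih h1
    exact ⟨.score E', L', rfl, h'⟩
  | app E P ih =>
    obtain ⟨M, P', rfl, h, -⟩ := Tm.of_shape_app h
    obtain ⟨E', L', rfl, h'⟩ := ih h
    exact ⟨.app E' P', L', rfl, h'⟩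
  | bind E P ih =>
    obtain ⟨M, P', rfl, h, -⟩ := Tm.of_shape_bind h
    obtain ⟨E', L', rfl, h'⟩ := ih h
    exact ⟨.bind E' P', L', rfl, h'⟩
  | arg P hP E ih =>
    obtain ⟨P', M, rfl, h1, h⟩ := Tm.of_shape_app h
    obtain ⟨E', L', rfl, h'⟩ := ih h
    exact ⟨.arg P' (hP.of_shape h1) E', L', rfl, h'⟩
  | case E P Q ih =>
    obtain ⟨M, P', Q', rfl, h, -⟩ := Tm.of_shape_case h
    obtain ⟨E', L', rfl, h'⟩ := ih h
    exact ⟨.case E' P' Q', L', rfl, h'⟩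
  | fst E ih =>
    obtain ⟨M, rfl, h1⟩ := Tm.of_shape_fst h
    obtain ⟨E', L', rfl, h'⟩ := ih h1
    exact ⟨.fst E', L', rfl, h'⟩
  | snd E ih =>
    obtain ⟨M, rfl, h1⟩ := Tm.of_shape_snd h
    obtain ⟨E', L', rfl, h'⟩ := ih h1
    exact ⟨.snd E', L', rfl, h'⟩

/-- The terms of the shape of `E [L]` are plugs of terms of the shape of `L`. -/
theorem ECtx.of_shape {σ τ : Ty} (E : ECtx S σ τ) (L : Cfg S σ) {N : Cfg S τ}
    (h : N.shape = (E.plug L).shape) :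
    ∃ (E' : ECtx S σ τ) (L' : Cfg S σ), N = E'.plug L' ∧ L'.shape = L.shape := by
  induction E with
  | weak E =>
    obtain ⟨E', L', h⟩ := E.of_shape L h
    exact ⟨.weak E', L', h⟩
  | ret E ih =>
    obtain ⟨M, rfl, h1⟩ := Tm.of_shape_ret h
    obtain ⟨E', L', rfl, h'⟩ := ih h1
    exact ⟨.ret E', L', rfl, h'⟩
  | pairL E P ih =>
    obtain ⟨M, P', rfl, h, -⟩ := Tm.of_shape_pair h
    obtain ⟨E', L', rfl, h'⟩ := ih h
    exact ⟨.pairL E' P', L', rfl, h'⟩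
  | pairR P hP E ih =>
    obtain ⟨P', M, rfl, h1, h⟩ := Tm.of_shape_pair h
    obtain ⟨E', L', rfl, h'⟩ := ih h
    exact ⟨.pairR P' (hP.of_shape h1) E', L', rfl, h'⟩
  | inl E ih =>
    obtain ⟨M, rfl, h1⟩ := Tm.of_shape_inl h
    obtain ⟨E', L', rfl, h'⟩ := ih h1
    exact ⟨.inl E', L', rfl, h'⟩
  | inr E ih =>
    obtain ⟨M, rfl, h1⟩ := Tm.of_shape_inr h
    obtain ⟨E', L', rfl, h'⟩ := ih h1
    exact ⟨.inr E', L', rfl, h'⟩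

/-- Composition of weak contexts. -/
def WCtx.comp {σ τ : Ty} : ∀ {υ : Ty}, WCtx S τ υ → WCtx S σ τ → WCtx S σ υ
  | _, .hole, F => F
  | _, .score E, F => .score (E.comp F)
  | _, .app E N, F => .app (E.comp F) N
  | _, .bind E N, F => .bind (E.comp F) N
  | _, .arg P h E, F => .arg P h (E.comp F)
  | _, .case E N P, F => .case (E.comp F) N P
  | _, .fst E, F => .fst (E.comp F)
  | _, .snd E, F => .snd (E.comp F)

theorem WCtx.comp_plug {σ τ υ : Ty} (E : WCtx S τ υ) (F : WCtx S σ τ) (M : Cfg S σ) :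
    (E.comp F).plug M = E.plug (F.plug M) := by
  induction E <;> simp only [comp, plug, *]

end

/-! ### Determinism of the operational semantics -/

/-- What a term that is not a normal form is about to do. -/
inductive Act (S : Sig.{u}) (τ : Ty) : Type u
  | step (N : Cfg S τ)
  | score (a : IR) (N : Cfg S τ)
  | sample (μ : S.Meas) (K : IR → Cfg S τ)
  | const (β : Ty) (P : Cfg S β) (K : Cfg S β → Cfg S τ)

section
variable {S : Sig.{u}}

/-- The action of a term in a context. -/
def Act.map {σ τ : Ty} (k : Cfg S σ → Cfg S τ) : Act S σ → Act S τ
  | .step N => .step (k N)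
  | .score a N => .score a (k N)
  | .sample μ K => .sample μ fun a => k (K a)
  | .const β P K => .const β P fun Q => k (K Q)

/-- The action of a term, computed under weak contexts. -/
inductive WAct : ∀ {τ : Ty}, Cfg S τ → Act S τ → Prop
  | sample (μ : S.Meas) : WAct (.sample μ) (.sample μ fun a => .ret (.real a))
  | score (a : IR) : WAct (.score (.real a)) (.score a (.ret (.const S.star)))
  | bind {σ υ : Ty} (M : Cfg S σ) (N : Tm S IR [σ] (.dist υ)) :
      WAct (.bind (.ret M) N) (.step (N.inst M))
  | contract {τ : Ty} (M N : Cfg S τ) : Contract M N → WAct M (.step N)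
  -- No condition is put on the denotation here, so that redexes and blocked terms are treated
  -- alike; observability is required only in `Act.Yields`.
  | const {σ β : Ty} (M : Cfg S (.arrow σ β)) (N : Cfg S σ) :
      IsConstApp M → IsAtom N → β.IsObservable → WAct (.app M N) (.const β (.app M N) fun Q => Q)
  | scoreC (M : Cfg S .real) (A : Act S .real) : WAct M A → WAct (.score M) (A.map .score)
  | appC {σ τ : Ty} (M : Cfg S (.arrow σ τ)) (N : Cfg S σ) (A : Act S (.arrow σ τ)) :
      WAct M A → WAct (.app M N) (A.map fun M => .app M N)
  | bindC {σ τ : Ty} (M : Cfg S (.dist σ)) (N : Tm S IR [σ] (.dist τ)) (A : Act S (.dist σ)) :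
      WAct M A → WAct (.bind M N) (A.map fun M => .bind M N)
  | argC {σ τ : Ty} (M : Cfg S (.arrow σ τ)) (N : Cfg S σ) (A : Act S σ) :
      IsConstApp M → WAct N A → WAct (.app M N) (A.map fun N => .app M N)
  | caseC {σ τ υ : Ty} (M : Cfg S (.sum σ τ)) (N : Cfg S (.arrow σ υ)) (P : Cfg S (.arrow τ υ))
      (A : Act S (.sum σ τ)) : WAct M A → WAct (.case M N P) (A.map fun M => .case M N P)
  | fstC {σ τ : Ty} (M : Cfg S (.prod σ τ)) (A : Act S (.prod σ τ)) :
      WAct M A → WAct (.fst M) (A.map .fst)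
  | sndC {σ τ : Ty} (M : Cfg S (.prod σ τ)) (A : Act S (.prod σ τ)) :
      WAct M A → WAct (.snd M) (A.map .snd)

/-- The action of a term. -/
inductive EAct : ∀ {τ : Ty}, Cfg S τ → Act S τ → Prop
  | weak {τ : Ty} (M : Cfg S τ) (A : Act S τ) : WAct M A → EAct M A
  | ret {τ : Ty} (M : Cfg S τ) (A : Act S τ) : EAct M A → EAct (.ret M) (A.map .ret)
  | pairL {σ τ : Ty} (M : Cfg S σ) (N : Cfg S τ) (A : Act S σ) :
      EAct M A → EAct (.pair M N) (A.map fun M => .pair M N)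
  | pairR {σ τ : Ty} (V : Cfg S σ) (N : Cfg S τ) (A : Act S τ) :
      IsValue V → EAct N A → EAct (.pair V N) (A.map fun N => .pair V N)
  | inl {σ τ : Ty} (M : Cfg S σ) (A : Act S σ) :
      EAct M A → EAct (.inl M : Cfg S (.sum σ τ)) (A.map .inl)
  | inr {σ τ : Ty} (M : Cfg S τ) (A : Act S τ) :
      EAct M A → EAct (.inr M : Cfg S (.sum σ τ)) (A.map .inr)

theorem not_wAct_real {a : IR} {A : Act S .real} : ¬ WAct (.real a) A := by
  intro h; cases h with | contract _ _ h => cases h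

theorem not_wAct_const {τ : Ty} {c : S.Const τ} {A : Act S τ} : ¬ WAct (.const c) A := by
  intro h; cases h with | contract _ _ h => cases h

theorem not_wAct_lam {σ τ : Ty} {M : Tm S IR [σ] τ} {A : Act S (.arrow σ τ)} :
    ¬ WAct (.lam M) A := by
  intro h; cases h with | contract _ _ h => cases h

theorem not_wAct_ret {τ : Ty} {M : Cfg S τ} {A : Act S (.dist τ)} : ¬ WAct (.ret M) A := by
  intro h; cases h with | contract _ _ h => cases h

theorem not_wAct_pair {σ τ : Ty} {M : Cfg S σ} {N : Cfg S τ} {A : Act S (.prod σ τ)} :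
    ¬ WAct (.pair M N) A := by
  intro h; cases h with | contract _ _ h => cases h

theorem not_wAct_inl {σ τ : Ty} {M : Cfg S σ} {A : Act S (.sum σ τ)} : ¬ WAct (.inl M) A := by
  intro h; cases h with | contract _ _ h => cases h

theorem not_wAct_inr {σ τ : Ty} {M : Cfg S τ} {A : Act S (.sum σ τ)} : ¬ WAct (.inr M) A := by
  intro h; cases h with | contract _ _ h => cases h

theorem not_wAct_atom {τ : Ty} {M : Cfg S τ} (hM : IsAtom M) {A : Act S τ} : ¬ WAct M A := by
  cases hM with
  | const => exact not_wAct_const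
  | real => exact not_wAct_real

theorem not_isConstApp_lam {σ τ : Ty} {M : Tm S IR [σ] τ} :
    ¬ IsConstApp (.lam M : Cfg S (.arrow σ τ)) := nofun

/-- Partial applications of constants do not act. -/
theorem not_wAct_constApp {τ : Ty} {M : Cfg S τ} (hM : IsConstApp M) :
    ¬ τ.IsObservable → ∀ {A : Act S τ}, ¬ WAct M A := by
  induction hM with
  | const => exact fun _ _ => not_wAct_const
  | app M N hM hN ih =>
    intro hτ A h
    cases h with
    | contract _ _ h => cases h; exact not_isConstApp_lam hM
    | const _ _ _ _ h => exact hτ h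
    | appC _ _ _ h => exact ih (fun h => h) h
    | argC _ _ _ _ h => exact not_wAct_atom hN h

/-- The rules of `WAct` follow the structure of the term, so two derivations can be compared rule by
rule. Overlaps between distinct rules are excluded because zero-ary constants, abstractions,
returns, pairs, injections and partial applications of constants do not act. -/
theorem WAct.unique {τ : Ty} {M : Cfg S τ} {A : Act S τ} (hA : WAct M A) :
    ∀ {B : Act S τ}, WAct M B → A = B := by
  induction hA with
  | sample μ => intro B hB; cases hB with
    | sample => rfl
    | contract _ _ h => cases h
  | score a => intro B hB; cases hB with
    | score => rfl
    | contract _ _ h => cases h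
    | scoreC _ _ h => exact (not_wAct_real h).elim
  | bind M N => intro B hB; cases hB with
    | bind => rfl
    | contract _ _ h => cases h
    | bindC _ _ _ h => exact (not_wAct_ret h).elim
  | contract M N hMN =>
    intro B hB
    cases hMN with
    | fix => cases hB with
      | contract _ _ h => cases h; rfl
    | beta => cases hB with
      | contract _ _ h => cases h; rfl
      | const _ _ h => exact (not_isConstApp_lam h).elim
      | appC _ _ _ h => exact (not_wAct_lam h).elim
      | argC _ _ _ h => exact (not_isConstApp_lam h).elim
    | fst => cases hB with
      | contract _ _ h => cases h; rfl
      | fstC _ _ h => exact (not_wAct_pair h).elim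
    | snd => cases hB with
      | contract _ _ h => cases h; rfl
      | sndC _ _ h => exact (not_wAct_pair h).elim
    | inl => cases hB with
      | contract _ _ h => cases h; rfl
      | caseC _ _ _ _ h => exact (not_wAct_inl h).elim
    | inr => cases hB with
      | contract _ _ h => cases h; rfl
      | caseC _ _ _ _ h => exact (not_wAct_inr h).elim
  | const M N hM hN hβ => intro B hB; cases hB with
    | contract _ _ h => cases h; exact (not_isConstApp_lam hM).elim
    | const => rfl
    | appC _ _ _ h => exact (not_wAct_constApp hM (fun h => h) h).elim
    | argC _ _ _ _ h => exact (not_wAct_atom hN h).elim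
  | scoreC M A hM ih => intro B hB; cases hB with
    | score => exact (not_wAct_real hM).elim
    | contract _ _ h => cases h
    | scoreC _ _ h => rw [ih h]
  | appC M N A hM ih => intro B hB; cases hB with
    | contract _ _ h => cases h; exact (not_wAct_lam hM).elim
    | const _ _ h => exact (not_wAct_constApp h (fun h => h) hM).elim
    | appC _ _ _ h => rw [ih h]
    | argC _ _ _ h => exact (not_wAct_constApp h (fun h => h) hM).elim
  | bindC M N A hM ih => intro B hB; cases hB with
    | bind => exact (not_wAct_ret hM).elim
    | contract _ _ h => cases h
    | bindC _ _ _ h => rw [ih h]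
  | argC M N A hM hN ih => intro B hB; cases hB with
    | contract _ _ h => cases h; exact (not_isConstApp_lam hM).elim
    | const _ _ _ h => exact (not_wAct_atom h hN).elim
    | appC _ _ _ h => exact (not_wAct_constApp hM (fun h => h) h).elim
    | argC _ _ _ _ h => rw [ih h]
  | caseC M N P A hM ih => intro B hB; cases hB with
    | contract _ _ h => cases h with
      | inl => exact (not_wAct_inl hM).elim
      | inr => exact (not_wAct_inr hM).elim
    | caseC _ _ _ _ h => rw [ih h]
  | fstC M A hM ih => intro B hB; cases hB with
    | contract _ _ h => cases h; exact (not_wAct_pair hM).elim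
    | fstC _ _ h => rw [ih h]
  | sndC M A hM ih => intro B hB; cases hB with
    | contract _ _ h => cases h; exact (not_wAct_pair hM).elim
    | sndC _ _ h => rw [ih h]

/-- Values do not act. -/
theorem not_eAct_value {τ : Ty} {V : Cfg S τ} (hV : IsValue V) : ∀ {A : Act S τ}, ¬ EAct V A := by
  induction hV with
  | atom M hM =>
    intro A h
    cases h with
    | weak _ _ h => exact not_wAct_atom hM h
    | _ => cases hM
  | lam M => intro A h; cases h with | weak _ _ h => exact not_wAct_lam h
  | ret V _ ih => intro A h; cases h with
    | weak _ _ h => exact not_wAct_ret h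
    | ret _ _ h => exact ih h
  | pair V W _ _ ih ih' => intro A h; cases h with
    | weak _ _ h => exact not_wAct_pair h
    | pairL _ _ _ h => exact ih h
    | pairR _ _ _ _ h => exact ih' h
  | inl V _ ih => intro A h; cases h with
    | weak _ _ h => exact not_wAct_inl h
    | inl _ _ h => exact ih h
  | inr V _ ih => intro A h; cases h with
    | weak _ _ h => exact not_wAct_inr h
    | inr _ _ h => exact ih h
  | constApp M hM => intro A h; cases h with
    | weak _ _ h => exact not_wAct_constApp hM (fun h => h) h

/-- The one new overlap concerns pairs: the right component may act only when the left one is a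
value, and values do not act. -/
theorem EAct.unique {τ : Ty} {M : Cfg S τ} {A : Act S τ} (hA : EAct M A) :
    ∀ {B : Act S τ}, EAct M B → A = B := by
  induction hA with
  | weak M A hM => intro B hB; cases hB with
    | weak _ _ h => exact hM.unique h
    | ret => exact (not_wAct_ret hM).elim
    | pairL => exact (not_wAct_pair hM).elim
    | pairR => exact (not_wAct_pair hM).elim
    | inl => exact (not_wAct_inl hM).elim
    | inr => exact (not_wAct_inr hM).elim
  | ret M A _ ih => intro B hB; cases hB with
    | weak _ _ h => exact (not_wAct_ret h).elim
    | ret _ _ h => rw [ih h]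
  | pairL M N A hM ih => intro B hB; cases hB with
    | weak _ _ h => exact (not_wAct_pair h).elim
    | pairL _ _ _ h => rw [ih h]
    | pairR _ _ _ h => exact (not_eAct_value h hM).elim
  | pairR M N A hM _ ih => intro B hB; cases hB with
    | weak _ _ h => exact (not_wAct_pair h).elim
    | pairL _ _ _ h => exact (not_eAct_value hM h).elim
    | pairR _ _ _ _ h => rw [ih h]
  | inl M A _ ih => intro B hB; cases hB with
    | weak _ _ h => exact (not_wAct_inl h).elim
    | inl _ _ h => rw [ih h]
  | inr M A _ ih => intro B hB; cases hB with
    | weak _ _ h => exact (not_wAct_inr h).elim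
    | inr _ _ h => rw [ih h]

theorem Act.map_id {τ : Ty} (A : Act S τ) : A.map (fun M => M) = A := by cases A <;> rfl

theorem Act.map_map {σ τ υ : Ty} (A : Act S σ) (k : Cfg S σ → Cfg S τ) (l : Cfg S τ → Cfg S υ) :
    (A.map k).map l = A.map fun M => l (k M) := by cases A <;> rfl

/-- This translates the presentation by contexts, used by `NextRel` and `IsBlocked`, into the
structural one. -/
theorem WAct.plug {σ τ : Ty} (E : WCtx S σ τ) {L : Cfg S σ} {A : Act S σ} (h : WAct L A) :
    WAct (E.plug L) (A.map fun M => E.plug M) := by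
  induction E with
  | hole => exact (A.map_id).symm ▸ h
  | score E ih => exact Act.map_map A _ _ ▸ .scoreC _ _ ih
  | app E N ih => exact Act.map_map A _ (fun M => .app M N) ▸ .appC _ _ _ ih
  | bind E N ih => exact Act.map_map A _ (fun M => .bind M N) ▸ .bindC _ _ _ ih
  | arg P hP E ih => exact Act.map_map A _ (fun M => .app P M) ▸ .argC _ _ _ hP ih
  | case E N P ih => exact Act.map_map A _ (fun M => .case M N P) ▸ .caseC _ _ _ _ ih
  | fst E ih => exact Act.map_map A _ _ ▸ .fstC _ _ ih
  | snd E ih => exact Act.map_map A _ _ ▸ .sndC _ _ ih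

theorem EAct.plug {σ τ : Ty} (E : ECtx S σ τ) {L : Cfg S σ} {A : Act S σ} (h : WAct L A) :
    EAct (E.plug L) (A.map fun M => E.plug M) := by
  induction E with
  | weak E => exact .weak _ _ (h.plug E)
  | ret E ih => exact Act.map_map A _ _ ▸ .ret _ _ ih
  | pairL E N ih => exact Act.map_map A _ (fun M => .pair M N) ▸ .pairL _ _ _ ih
  | pairR V hV E ih => exact Act.map_map A _ (fun M => .pair V M) ▸ .pairR _ _ _ hV ih
  | inl E ih => exact Act.map_map A _ _ ▸ .inl _ _ ih
  | inr E ih => exact Act.map_map A _ _ ▸ .inr _ _ ih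

/-! ### From actions to the valuations `next` and `nextOne`. -/

/-- The valuations that result from an action. -/
def Act.Yields {τ : Ty} : Act S τ → Val (Cfg S τ) → Prop
  | .step N, ν => ν = Val.dirac N
  | .score a N, ν => ν = ENNReal.ofReal a.abs • Val.dirac N
  -- An action carries a bare function `K`. Its continuity is demanded only here, and the resulting
  -- valuation does not depend on the proof.
  | .sample μ K, ν => ∃ hK : ScottContinuous K, ν = Val.ofMeasure μ.1 ⟨K, hK⟩
  | .const β P K, ν => ∃ h : IsObs β (sem P), ν = Val.dirac (K (quote S β (sem P) h))

theorem Act.Yields.unique {τ : Ty} {A : Act S τ} {ν ξ : Val (Cfg S τ)} (h : A.Yields ν)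
    (h' : A.Yields ξ) : ν = ξ := by
  cases A with
  | step => exact Eq.trans h h'.symm
  | score => exact Eq.trans h h'.symm
  | sample => obtain ⟨_, rfl⟩ := h; obtain ⟨_, rfl⟩ := h'; rfl
  | const => obtain ⟨_, rfl⟩ := h; obtain ⟨_, rfl⟩ := h'; rfl

theorem NextRel.exists_eAct {τ : Ty} {M : Cfg S τ} {ν : Val (Cfg S τ)} (h : NextRel M ν) :
    ∃ A, EAct M A ∧ A.Yields ν := by
  cases h with
  | sample E μ => exact ⟨_, .weak _ _ ((WAct.sample μ).plug E), E.retReal.cont, rfl⟩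
  | score E a => exact ⟨_, .weak _ _ ((WAct.score a).plug E), rfl⟩
  | bind E M N => exact ⟨_, .weak _ _ ((WAct.bind M N).plug E), rfl⟩
  | contract E M N h => exact ⟨_, EAct.plug E (.contract M N h), rfl⟩
  | const E M N hM hN hβ h => exact ⟨_, EAct.plug E (.const M N hM hN hβ), h, rfl⟩

/-- Two rules that apply to one term prescribe the same action, and an action yields at most one
valuation. -/
theorem NextRel.unique {τ : Ty} {M : Cfg S τ} {ν ξ : Val (Cfg S τ)} (h : NextRel M ν)
    (h' : NextRel M ξ) : ν = ξ := by
  obtain ⟨A, hA, hν⟩ := h.exists_eAct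
  obtain ⟨B, hB, hξ⟩ := h'.exists_eAct
  obtain rfl := hA.unique hB
  exact hν.unique hξ

theorem IsBlocked.exists_eAct {τ : Ty} {M : Cfg S τ} (h : IsBlocked M) :
    ∃ β P K, EAct M (.const β P K) ∧ ¬ IsObs β (sem P) := by
  obtain ⟨σ, β, E, M, N, hM, hN, hβ, h, rfl⟩ := h
  exact ⟨_, _, _, EAct.plug E (.const M N hM hN hβ), h⟩

theorem next_eq {τ : Ty} {M : Cfg S τ} {ν : Val (Cfg S τ)} (h : NextRel M ν) : next M = ν := by
  have hM : ∃ ν, NextRel M ν := ⟨ν, h⟩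
  rw [next, dif_pos hM]
  exact hM.choose_spec.unique h

theorem nextOne_eq {τ : Ty} {M : Cfg S τ} {ν : Val (Cfg S τ)} (h : NextRel M ν) :
    nextOne M = ν := by
  have : ¬ IsNormal M := fun hM => hM.1 ⟨ν, h⟩
  rw [nextOne, next_eq h, nextZero, if_neg this]
  ext U
  simp

theorem nextOne_of_isNormal {τ : Ty} {M : Cfg S τ} (h : IsNormal M) :
    nextOne M = Val.dirac M := by
  have hM : ¬ ∃ ν, NextRel M ν := h.1
  rw [nextOne, next, dif_neg hM, nextZero, if_pos h]
  ext U
  simp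

/-- A blocked term is not a redex: by determinism its only action is the evaluation of an
application whose denotation is not observable, and such an action yields nothing. -/
theorem nextOne_of_isBlocked {τ : Ty} {M : Cfg S τ} (h : IsBlocked M) : nextOne M = 0 := by
  have hM : ¬ ∃ ν, NextRel M ν := by
    rintro ⟨ν, hν⟩
    obtain ⟨A, hA, hA'⟩ := hν.exists_eAct
    obtain ⟨β, P, K, hP, hP'⟩ := h.exists_eAct
    obtain rfl := hA.unique hP
    exact hP' hA'.1
  rw [nextOne, next, dif_neg hM, nextZero, if_neg fun h' => h'.2 h]
  ext U
  simp

theorem isNormal_of_isValue {τ : Ty} {V : Cfg S τ} (h : IsValue V) : IsNormal V := by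
  constructor
  · rintro ⟨ν, hν⟩
    obtain ⟨A, hA, -⟩ := hν.exists_eAct
    exact not_eAct_value h hA
  · intro hV
    obtain ⟨β, P, K, hP, -⟩ := hV.exists_eAct
    exact not_eAct_value h hP

/-! ### Normal forms are determined by their shape. -/

/-- The terms that act in a weak context only. -/
inductive WeakRedex : ∀ {τ : Ty}, Cfg S τ → Prop
  | sample (μ : S.Meas) : WeakRedex (.sample μ)
  | score (a : IR) : WeakRedex (.score (.real a))
  | bind {σ υ : Ty} (M : Cfg S σ) (N : Tm S IR [σ] (.dist υ)) : WeakRedex (.bind (.ret M) N)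

/-- The terms that act in an evaluation context. -/
inductive StrongRedex : ∀ {τ : Ty}, Cfg S τ → Prop
  | contract {τ : Ty} (M N : Cfg S τ) : Contract M N → StrongRedex M
  | const {σ β : Ty} (M : Cfg S (.arrow σ β)) (N : Cfg S σ) :
      IsConstApp M → IsAtom N → β.IsObservable → StrongRedex (.app M N)

/-- A saturated application of a constant is a redex or blocked according to whether its denotation
is observable. Merging the two cases removes the only condition that depends on the real constants.
-/
theorem not_isNormal_iff {τ : Ty} {M : Cfg S τ} : ¬ IsNormal M ↔
    (∃ (σ : Ty) (E : WCtx S σ τ) (L : Cfg S σ), WeakRedex L ∧ M = E.plug L) ∨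
    (∃ (σ : Ty) (E : ECtx S σ τ) (L : Cfg S σ), StrongRedex L ∧ M = E.plug L) := by
  constructor
  · intro h
    by_cases h1 : IsRedex M
    · obtain ⟨ν, h1⟩ := h1
      cases h1 with
      | sample E μ => exact .inl ⟨_, E, _, .sample μ, rfl⟩
      | score E a => exact .inl ⟨_, E, _, .score a, rfl⟩
      | bind E M N => exact .inl ⟨_, E, _, .bind M N, rfl⟩
      | contract E M N hMN => exact .inr ⟨_, E, _, .contract M N hMN, rfl⟩
      | const E M N hM hN hβ h => exact .inr ⟨_, E, _, .const M N hM hN hβ, rfl⟩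
    · have h2 : IsBlocked M := by
        by_contra h2
        exact h ⟨h1, h2⟩
      obtain ⟨σ, β, E, M, N, hM, hN, hβ, -, rfl⟩ := h2
      exact .inr ⟨_, E, _, .const M N hM hN hβ, rfl⟩
  · rintro (⟨σ, E, L, hL, rfl⟩ | ⟨σ, E, L, hL, rfl⟩) h
    · cases hL with
      | sample μ => exact h.1 ⟨_, .sample E μ⟩
      | score a => exact h.1 ⟨_, .score E a⟩
      | bind M N => exact h.1 ⟨_, .bind E M N⟩
    · cases hL with
      | contract _ _ hL => exact h.1 ⟨_, .contract E _ _ hL⟩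
      | const M N hM hN hβ =>
        by_cases ho : IsObs _ (sem (.app M N))
        · exact h.1 ⟨_, .const E M N hM hN hβ ho⟩
        · exact h.2 ⟨_, _, E, M, N, hM, hN, hβ, ho, rfl⟩

theorem WeakRedex.of_shape {τ : Ty} {M N : Cfg S τ} (hM : WeakRedex M)
    (h : N.shape = M.shape) : WeakRedex N := by
  cases hM with
  | sample μ => rw [Tm.of_shape_sample h]; exact .sample μ
  | score a =>
    obtain ⟨N, rfl, h1⟩ := Tm.of_shape_score h
    obtain ⟨b, rfl⟩ := Tm.of_shape_real h1
    exact .score b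
  | bind M P =>
    obtain ⟨N, P', rfl, h, -⟩ := Tm.of_shape_bind h
    obtain ⟨M', rfl, -⟩ := Tm.of_shape_ret h
    exact .bind M' P'

theorem StrongRedex.of_shape {τ : Ty} {M N : Cfg S τ} (hM : StrongRedex M)
    (h : N.shape = M.shape) : StrongRedex N := by
  cases hM with
  | contract M M' hM =>
    cases hM with
    | fix =>
      obtain ⟨N, rfl, -⟩ := Tm.of_shape_fix h
      exact .contract _ _ (.fix _)
    | beta =>
      obtain ⟨N, P, rfl, h, -⟩ := Tm.of_shape_app h
      obtain ⟨N', rfl, -⟩ := Tm.of_shape_lam h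
      exact .contract _ _ (.beta _ _)
    | fst =>
      obtain ⟨N, rfl, h1⟩ := Tm.of_shape_fst h
      obtain ⟨M, P, rfl, -⟩ := Tm.of_shape_pair h1
      exact .contract _ _ (.fst _ _)
    | snd =>
      obtain ⟨N, rfl, h1⟩ := Tm.of_shape_snd h
      obtain ⟨M, P, rfl, -⟩ := Tm.of_shape_pair h1
      exact .contract _ _ (.snd _ _)
    | inl =>
      obtain ⟨N, P, Q, rfl, h, -⟩ := Tm.of_shape_case h
      obtain ⟨M, rfl, -⟩ := Tm.of_shape_inl h
      exact .contract _ _ (.inl _ _ _)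
    | inr =>
      obtain ⟨N, P, Q, rfl, h, -⟩ := Tm.of_shape_case h
      obtain ⟨M, rfl, -⟩ := Tm.of_shape_inr h
      exact .contract _ _ (.inr _ _ _)
  | const M P hM hP hβ =>
    obtain ⟨M', P', rfl, h1, h2⟩ := Tm.of_shape_app h
    exact .const _ _ (hM.of_shape h1) (hP.of_shape h2) hβ

/-- Whether a term is a normal form depends on its shape only. -/
theorem isNormal_of_shape {τ : Ty} {M N : Cfg S τ} (hM : IsNormal M) (h : N.shape = M.shape) :
    IsNormal N := by
  by_contra hN
  refine not_isNormal_iff.2 ?_ hM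
  rcases not_isNormal_iff.1 hN with ⟨σ, E, L, hL, rfl⟩ | ⟨σ, E, L, hL, rfl⟩
  · obtain ⟨E', L', rfl, h'⟩ := E.of_shape L h.symm
    exact .inl ⟨σ, E', L', hL.of_shape h', rfl⟩
  · obtain ⟨E', L', rfl, h'⟩ := E.of_shape L h.symm
    exact .inr ⟨σ, E', L', hL.of_shape h', rfl⟩

/-- Comparable terms have the same shape, so a union of shape classes is closed both upwards and
downwards; every member of a directed set then has the shape of its supremum. -/
theorem isScottOpen_of_shape {τ : Ty} {s : Set (Cfg S τ)}
    (h : ∀ M ∈ s, ∀ N : Cfg S τ, N.shape = M.shape → N ∈ s) : IsScottOpen s :=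
  isScottOpen_iff.2 ⟨fun _ _ hMN hM => h _ hM _ hMN.1.symm, fun _ ⟨N, hN⟩ _ _ hM hMs =>
    ⟨N, hN, h _ hMs _ (hM.1 hN).1⟩⟩

theorem mem_normOpen {τ : Ty} {M : Cfg S τ} : M ∈ normOpen S τ ↔ IsNormal M := by
  have h : IsScottOpen {M : Cfg S τ | IsNormal M} :=
    isScottOpen_of_shape fun _ hM _ h => isNormal_of_shape hM h
  show M ∈ @interior _ (Topology.scott _ univ) {M : Cfg S τ | IsNormal M} ↔ _
  rw [@IsOpen.interior_eq _ (Topology.scott _ univ) _ h]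
  rfl

end

/-! ### More on integration -/

theorem ScottContinuous.ennreal_mul {X : Type*} [Preorder X] {f g : X → ℝ≥0∞}
    (hf : ScottContinuous f) (hg : ScottContinuous g) : ScottContinuous fun x => f x * g x := by
  refine ScottContinuous.mk' (fun a b h => mul_le_mul' (hf.monotone h) (hg.monotone h))
    fun d hd hd' a ha b hb => ?_
  rw [← (hf hd hd' ha).sSup_eq, ← (hg hd hd' ha).sSup_eq, ENNReal.sSup_mul]
  refine iSup₂_le ?_
  rintro _ ⟨x, hx, rfl⟩
  rw [ENNReal.mul_sSup]
  refine iSup₂_le ?_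
  rintro _ ⟨y, hy, rfl⟩
  obtain ⟨z, hz, h1, h2⟩ := hd' x hx y hy
  exact (mul_le_mul' (hf.monotone h1) (hg.monotone h2)).trans (hb z hz)

theorem scottContinuous_of_iSup {X : Type*} [Preorder X] {f : X → ℝ≥0∞} (hm : Monotone f)
    (h : ∀ d : Set X, d.Nonempty → DirectedOn (· ≤ ·) d → ∀ a, IsLUB d a →
      f a ≤ ⨆ x : d, f x) : ScottContinuous f :=
  ScottContinuous.mk' hm fun d hd hd' a ha _ hb =>
    (h d hd hd' a ha).trans (iSup_le fun x => hb x x.2)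

namespace Val
variable {X Y : Type*} [Preorder X] [Preorder Y]

theorem dirac_cont (U : SOpens X) : ScottContinuous fun x => dirac x U :=
  MVal.unit_cont.comp (MVal.apply_cont U)

theorem dirac_eq_one {x : X} {U : SOpens X} (h : x ∈ U) : dirac x U = 1 := if_pos h

theorem dirac_eq_zero {x : X} {U : SOpens X} (h : x ∉ U) : dirac x U = 0 := if_neg h

theorem level_le (h : X → ℝ≥0∞) (t : ℝ≥0∞) {x : X} (hx : x ∈ level h t) : t < h x :=
  @interior_subset X (Topology.scott X univ) _ _ hx

theorem lint_indicator (ν : Val X) (U : SOpens X) : (ν.lint fun x => dirac x U) = ν U := by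
  -- The level set of the indicator function is `U` for `t < 1` and empty for `t ≥ 1`, so Choquet's
  -- formula integrates the constant `ν U` over the unit interval.
  have : ∀ t ∈ Ioi (0 : ℝ), ν (level (fun x => dirac x U) (ENNReal.ofReal t))
      = (Ioo (0 : ℝ) 1).indicator (fun _ => ν U) t := fun t ht => by
    by_cases h1 : t < 1
    · rw [indicator_of_mem (show t ∈ Ioo (0 : ℝ) 1 from ⟨ht, h1⟩)]
      congr 1
      refine SOpens.ext' fun x => ?_
      rw [mem_level (dirac_cont U)]
      by_cases hx : x ∈ U
      · simp [dirac_eq_one hx, hx, h1]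
      · simp [dirac_eq_zero hx, hx]
    · rw [indicator_of_notMem fun h => h1 h.2, ← ν.empty']
      congr 1
      refine SOpens.ext' fun x => ?_
      rw [mem_level (dirac_cont U)]
      by_cases hx : x ∈ U
      · simpa [dirac_eq_one hx] using h1
      · simp [dirac_eq_zero hx]
  rw [lint, setLIntegral_congr_fun measurableSet_Ioi this,
    lintegral_indicator measurableSet_Ioo, setLIntegral_const,
    Measure.restrict_apply measurableSet_Ioo]
  have : Ioo (0 : ℝ) 1 ∩ Ioi 0 = Ioo 0 1 := inter_eq_left.2 fun t ht => ht.1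
  simp [this]

/-- Since `level h t` is an interior, for `h` not known to be continuous the integral can only be
too small. The bound comes from comparison with the Dirac valuation at `h x` on `[0, ∞]` and the
identity function. -/
theorem lint_dirac_le (x : X) (h : X → ℝ≥0∞) : (dirac x).lint h ≤ h x := by
  have hle : ∀ t ∈ Ioi (0 : ℝ), dirac x (level h (ENNReal.ofReal t))
      ≤ dirac (h x) (level id (ENNReal.ofReal t)) := fun t _ => by
    by_cases hx : x ∈ level h (ENNReal.ofReal t)
    · rw [dirac_eq_one hx, dirac_eq_one]
      exact (mem_level ScottContinuous.id).2 (level_le h _ hx)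
    · rw [dirac_eq_zero hx]
      exact zero_le
  exact (setLIntegral_mono' measurableSet_Ioi hle).trans
    (lint_dirac (h x) (h := id) ScottContinuous.id).le

/-- Comparison of integrals with respect to images of a measure on the real line. -/
theorem lint_ofMeasure_le (μ : Measure ℝ) (f : SCont IR X) (g : SCont IR Y) (h : X → ℝ≥0∞)
    {k : Y → ℝ≥0∞} (hk : ScottContinuous k) (hle : ∀ a, h (f a) ≤ k (g a)) :
    (ofMeasure μ f).lint h ≤ (ofMeasure μ g).lint k :=
  lintegral_mono fun _ => measure_mono fun _ hx =>
    (mem_level hk).2 ((level_le _ _ hx).trans_le (hle _))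

theorem lint_ofMeasure (μ : Measure ℝ) (f : SCont IR X) {h : X → ℝ≥0∞} (hh : ScottContinuous h) :
    (ofMeasure μ f).lint h
      = (ofMeasure μ ⟨fun a => a, ScottContinuous.id⟩).lint fun a => h (f a) :=
  le_antisymm (lint_ofMeasure_le μ _ _ _ (f.cont.comp hh) fun _ => le_rfl)
    (lint_ofMeasure_le μ _ _ _ hh fun _ => le_rfl)

/-- The Scott topology separates points: if `x ≤ y` fails, the complement of the down-set of `y` is
an open set that contains `x` and not `y`. This turns uniqueness of valuations into determinism of
reductions. -/
theorem dirac_injective {X : Type*} [PartialOrder X] : Function.Injective (dirac (X := X)) := by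
  have key : ∀ x y : X, dirac x = dirac y → x ≤ y := fun x y h => by
    by_contra hxy
    have ho : IsScottOpen {z | ¬ z ≤ y} := isScottOpen_iff.2
      ⟨fun a b hab ha hb => ha (hab.trans hb), fun d _ _ a ha hay => by
        by_contra hne
        refine hay (ha.2 fun z hz => ?_)
        by_contra hzy
        exact hne ⟨z, hz, hzy⟩⟩
    let U : SOpens X := @Opens.mk X (Topology.scott X univ) _ ho
    have hx : x ∈ U := hxy
    have hy : y ∉ U := fun h => h le_rfl
    have := congrArg (fun ν : Val X => ν U) h
    simp [dirac_eq_one hx, dirac_eq_zero hy] at this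
  exact fun x y h => le_antisymm (key x y h) (key y x h.symm)

end Val

/-! ### Integration against the extension of a kernel. -/

namespace MVal
variable {X Y : Type*} [Preorder X] [Preorder Y]

theorem lint_cont {h : X → ℝ≥0∞} (hh : ScottContinuous h) :
    ScottContinuous fun ν : MVal X => ν.1.lint h := by
  intro d hd hd' a ha
  have := Val.lint_iSup_val (fun ν : d => ν.1.1) (fun i j => hd'.directed_val i j)
    (fun U => isLUB_apply hd' ha U) hh
  dsimp only
  rw [this, ← sSup_image' (f := fun ν : MVal X => ν.1.lint h)]
  exact isLUB_sSup _

theorem lint_scont (f : SCont X (MVal Y)) {h : Y → ℝ≥0∞} (hh : ScottContinuous h) :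
    ScottContinuous fun x => (f x).1.lint h :=
  ScottContinuous.comp (g := fun ν : MVal Y => ν.1.lint h) f.cont (lint_cont hh)

/-- Here minimality is essential: the identity holds for simple valuations by linearity, and both
sides commute with directed suprema. The valuation `ξ` is arbitrary subject to its values, so that
the induction hypothesis applies to the extension of each member of a directed family. -/
theorem lint_eq_of_bind (f : SCont X (MVal Y)) {h : Y → ℝ≥0∞} (hh : ScottContinuous h)
    {μ : Val X} (hμ : μ.IsMinimal) : ∀ {ξ : Val Y}, (∀ V, ξ V = μ.lint fun x => f x V) →
      ξ.lint h = μ.lint fun x => (f x).1.lint h := by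
  induction hμ with
  | simple μ hμ =>
    obtain ⟨l, rfl⟩ := hμ
    induction l with
    | nil =>
      intro ξ hξ
      obtain rfl : ξ = 0 := Val.ext fun V => (hξ V).trans (Val.lint_zero _)
      rw [Val.lint_zero]
      exact (Val.lint_zero _).symm
    | cons p l ih =>
      intro ξ hξ
      obtain ⟨ζ, -, hζ⟩ := exists_bind f (Val.IsMinimal.simple _ ⟨l, rfl⟩)
      obtain rfl : ξ = (p.1 : ℝ≥0∞) • (f p.2).1 + ζ := Val.ext fun V => by
        rw [hξ, List.map_cons, List.sum_cons, Val.lint_add, Val.lint_smul,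
          Val.lint_dirac _ (eval_scont f V), ← hζ]
        rfl
      rw [List.map_cons, List.sum_cons, Val.lint_add, Val.lint_smul, Val.lint_add, Val.lint_smul,
        Val.lint_dirac _ (lint_scont f hh), ih hζ]
  | sup d μ hd hd' hmin hl ih =>
    intro ξ hξ
    have hex : ∀ ν : d, ∃ ζ : Val Y, ∀ V, ζ V = ν.1.lint fun x => f x V := fun ν =>
      (exists_bind f (hmin ν.1 ν.2)).imp fun _ h => h.2
    choose ζ hζ using hex
    rw [Val.lint_iSup_val (fun ν : d => ν.1) hd'.directed_val (Val.isLUB_apply hd' hl)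
      (lint_scont f hh), Val.lint_iSup_val ζ _ (fun V => ?_) hh]
    · exact iSup_congr fun ν => ih ν.1 ν.2 (hζ ν)
    · intro ν ν'
      obtain ⟨c, h1, h2⟩ := hd'.directed_val ν ν'
      refine ⟨c, fun V => ?_, fun V => ?_⟩ <;> rw [hζ, hζ]
      · exact Val.lint_mono h1 fun _ => le_rfl
      · exact Val.lint_mono h2 fun _ => le_rfl
    · rw [hξ, Val.lint_iSup_val (fun ν : d => ν.1) hd'.directed_val (Val.isLUB_apply hd' hl)
        (eval_scont f V)]
      exact iSup_congr fun ν => (hζ ν V).symm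

/-- Integration with respect to `f† μ`. -/
theorem lint_bind (f : SCont X (MVal Y)) (μ : MVal X) {h : Y → ℝ≥0∞} (hh : ScottContinuous h) :
    (bind f μ).1.lint h = μ.1.lint fun x => (f x).1.lint h :=
  lint_eq_of_bind f hh μ.isMinimal fun V => bind_apply f μ V

end MVal

/-! ### Denotations -/

/-- Application of an element of the denotation of an arrow type. -/
noncomputable def appD {σ τ : Ty} (f : (Ty.arrow σ τ).dom) (x : σ.dom) : τ.dom :=
  SCont.toFun (X := σ.dom) (Y := τ.dom) f x

namespace Tm
variable {S : Sig.{u}}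

/-- Extend an environment. -/
def envCons {Γ : List Ty} {σ : Ty} (x : σ.dom) (ρ : env Γ) : env (σ :: Γ) := (x, ρ)

theorem den_rename {Γ Δ : List Ty} {τ : Ty} (M : Tm S IR Γ τ) (r : ∀ τ, Var Γ τ → Var Δ τ)
    (ρ : env Γ) (ρ' : env Δ) (h : ∀ τ v, (r τ v).den ρ' = v.den ρ) :
    (M.rename r).den ρ' = M.den ρ := by
  have hl : ∀ {Γ Δ : List Ty} {r : ∀ τ, Var Γ τ → Var Δ τ} {ρ : env Γ} {ρ' : env Δ},
      (∀ τ v, (r τ v).den ρ' = v.den ρ) → ∀ (σ : Ty) (x : σ.dom) τ v,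
      (liftRen r σ τ v).den (envCons x ρ') = v.den (envCons x ρ) := by
    intro Γ Δ r ρ ρ' h σ x τ v
    cases v with
    | zero => rfl
    | succ v => exact h τ v
  induction M generalizing Δ with
  | var v => exact h _ v
  | const | real | sample => rfl
  | score M ih => exact congrArg (SCont.score starD).toFun (ih r ρ ρ' h)
  | lam M ih => exact SCont.ext fun x => ih _ _ _ (hl h _ x)
  | app M N ih ih' =>
    exact congrArg₂ appD (ih r ρ ρ' h) (ih' r ρ ρ' h)
  | fix M ih => exact congrArg SCont.fix.toFun (ih r ρ ρ' h)
  | ret M ih => exact congrArg SCont.unit.toFun (ih r ρ ρ' h)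
  | bind M N ih ih' =>
    exact congrArg₂ (fun f x => SCont.bind.toFun (f, x))
      (SCont.ext fun x => ih' _ _ _ (hl h _ x)) (ih r ρ ρ' h)
  | pair M N ih ih' => exact congrArg₂ Prod.mk (ih r ρ ρ' h) (ih' r ρ ρ' h)
  | fst M ih => exact congrArg Prod.fst (ih r ρ ρ' h)
  | snd M ih => exact congrArg Prod.snd (ih r ρ ρ' h)
  | inl M ih => exact congrArg SCont.inl.toFun (ih r ρ ρ' h)
  | inr M ih => exact congrArg SCont.inr.toFun (ih r ρ ρ' h)
  | case M N P ih ih' ih'' =>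
    exact congrArg₂ (fun f x => SCont.cases.toFun (f, x))
      (congrArg₂ Prod.mk (ih' r ρ ρ' h) (ih'' r ρ ρ' h)) (ih r ρ ρ' h)

theorem den_subst {Γ Δ : List Ty} {τ : Ty} (M : Tm S IR Γ τ) (s : ∀ τ, Var Γ τ → Tm S IR Δ τ)
    (ρ : env Γ) (ρ' : env Δ) (h : ∀ τ v, (s τ v).den ρ' = v.den ρ) :
    (M.subst s).den ρ' = M.den ρ := by
  have hl : ∀ {Γ Δ : List Ty} {s : ∀ τ, Var Γ τ → Tm S IR Δ τ} {ρ : env Γ} {ρ' : env Δ},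
      (∀ τ v, (s τ v).den ρ' = v.den ρ) → ∀ (σ : Ty) (x : σ.dom) τ v,
      (liftSub s σ τ v).den (envCons x ρ') = v.den (envCons x ρ) := by
    intro Γ Δ r ρ ρ' h σ x τ v
    cases v with
    | zero => rfl
    | succ v => exact (den_rename _ (fun _ => .succ) _ _ fun _ _ => rfl).trans (h τ v)
  induction M generalizing Δ with
  | var v => exact h _ v
  | const | real | sample => rfl
  | score M ih => exact congrArg (SCont.score starD).toFun (ih s ρ ρ' h)
  | lam M ih => exact SCont.ext fun x => ih _ _ _ (hl h _ x)
  | app M N ih ih' =>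
    exact congrArg₂ appD (ih s ρ ρ' h) (ih' s ρ ρ' h)
  | fix M ih => exact congrArg SCont.fix.toFun (ih s ρ ρ' h)
  | ret M ih => exact congrArg SCont.unit.toFun (ih s ρ ρ' h)
  | bind M N ih ih' =>
    exact congrArg₂ (fun f x => SCont.bind.toFun (f, x))
      (SCont.ext fun x => ih' _ _ _ (hl h _ x)) (ih s ρ ρ' h)
  | pair M N ih ih' => exact congrArg₂ Prod.mk (ih s ρ ρ' h) (ih' s ρ ρ' h)
  | fst M ih => exact congrArg Prod.fst (ih s ρ ρ' h)
  | snd M ih => exact congrArg Prod.snd (ih s ρ ρ' h)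
  | inl M ih => exact congrArg SCont.inl.toFun (ih s ρ ρ' h)
  | inr M ih => exact congrArg SCont.inr.toFun (ih s ρ ρ' h)
  | case M N P ih ih' ih'' =>
    exact congrArg₂ (fun f x => SCont.cases.toFun (f, x))
      (congrArg₂ Prod.mk (ih' s ρ ρ' h) (ih'' s ρ ρ' h)) (ih s ρ ρ' h)

theorem den_inst {Γ : List Ty} {σ τ : Ty} (M : Tm S IR (σ :: Γ) τ) (N : Tm S IR Γ σ)
    (ρ : env Γ) : (M.inst N).den ρ = M.den (envCons (N.den ρ) ρ) :=
  den_subst _ _ _ _ fun _ v => by cases v <;> rfl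

/-- Every construct of the language is interpreted by a Scott-continuous operation, and the
assignment enters only at the real constants. For a binder the environment is extended by a fixed
element and continuity is checked pointwise. -/
theorem den_map_cont {Γ : List Ty} {τ : Ty} (M : Tm S IR Γ τ) (ρ : env Γ) :
    ScottContinuous fun θ : IR → IR => (M.map θ).den ρ := by
  induction M with
  | var v => exact ScottContinuous.const (v.den ρ)
  | const c => exact ScottContinuous.const (S.den c)
  | sample μ => exact ScottContinuous.const ((Tm.sample μ).den ρ)
  | real a =>
    have h : ScottContinuous fun θ : IR → IR => θ a := fun d _ _ θ h => isLUB_pi.1 h a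
    exact h.comp (scottContinuous_coe (X := IR))
  | score M ih => exact (ih ρ).comp (SCont.score starD).cont
  | @lam _ σ τ M ih =>
    exact SCont.cont_of_apply (X := σ.dom) (Y := τ.dom)
      (F := fun θ : IR → IR => (M.map θ).lam.den ρ) fun x => ih (envCons x ρ)
  | app M N ih ih' => exact ((ih ρ).prodMk (ih' ρ)).comp SCont.eval.cont
  | fix M ih => exact (ih ρ).comp SCont.fix.cont
  | ret M ih => exact (ih ρ).comp SCont.unit.cont
  | bind M N ih ih' =>
    exact ScottContinuous.comp (ScottContinuous.prodMk
      (SCont.cont_of_apply fun x => ih' (envCons x ρ)) (ih ρ)) SCont.bind.cont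
  | pair M N ih ih' => exact (ih ρ).prodMk (ih' ρ)
  | fst M ih => exact (ih ρ).comp SCont.fst.cont
  | snd M ih => exact (ih ρ).comp SCont.snd.cont
  | inl M ih => exact (ih ρ).comp SCont.inl.cont
  | inr M ih => exact (ih ρ).comp SCont.inr.cont
  | case M N P ih ih' ih'' =>
    exact (((ih' ρ).prodMk (ih'' ρ)).prodMk (ih ρ)).comp SCont.cases.cont

end Tm

section
variable {S : Sig.{u}}

theorem sem_cont {τ : Ty} : ScottContinuous (sem : Cfg S τ → τ.dom) :=
  Tm.scottContinuous_of_map fun M => M.den_map_cont _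

theorem sem_mono {τ : Ty} {M N : Cfg S τ} (h : M ≤ N) : sem M ≤ sem N := sem_cont.monotone h

theorem Contract.sem_eq {τ : Ty} {M N : Cfg S τ} (h : Contract M N) : sem M = sem N := by
  cases h with
  | fix M =>
    -- The supremum of the iterates is the least prefixed point. Its image under `sem M` is again a
    -- prefixed point, so the two coincide.
    exact le_antisymm (SCont.lfp_le (X := _) (sem M) ((SCont.cont (sem M)).monotone
      (SCont.map_lfp_le _))) (SCont.map_lfp_le (sem M))
  | beta M N => exact (Tm.den_inst M N _).symm
  | fst | snd | inl | inr => rfl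

theorem WCtx.sem_congr {σ τ : Ty} (E : WCtx S σ τ) {M N : Cfg S σ} (h : sem M = sem N) :
    sem (E.plug M) = sem (E.plug N) := by
  have app : ∀ {σ τ : Ty} {M M' : Cfg S (.arrow σ τ)} {N N' : Cfg S σ}, sem M = sem M' →
      sem N = sem N' → sem (M.app N) = sem (M'.app N') := fun h h' =>
    congrArg₂ appD h h'
  induction E with
  | hole => exact h
  | score E ih => exact congrArg (SCont.score starD).toFun ih
  | app E P ih => exact app ih rfl
  | bind E P ih => exact congrArg (fun x => SCont.bind.toFun (_, x)) ih
  | arg P _ E ih => exact app rfl ih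
  | case E P Q ih => exact congrArg (fun x => SCont.cases.toFun (_, x)) ih
  | fst E ih => exact congrArg Prod.fst ih
  | snd E ih => exact congrArg Prod.snd ih

theorem ECtx.sem_congr {σ τ : Ty} (E : ECtx S σ τ) {M N : Cfg S σ} (h : sem M = sem N) :
    sem (E.plug M) = sem (E.plug N) := by
  induction E with
  | weak E => exact E.sem_congr h
  | ret E ih => exact congrArg SCont.unit.toFun ih
  | pairL E P ih => exact congrArg (fun x => (x, sem P)) ih
  | pairR V _ E ih => exact congrArg (fun x => (sem V, x)) ih
  | inl E ih => exact congrArg SCont.inl.toFun ih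
  | inr E ih => exact congrArg SCont.inr.toFun ih

theorem sem_quote : ∀ (β : Ty) (v : β.dom) (h : IsObs β v), sem (quote S β v h) = v
  | .unit, v, h => S.den_star.trans (WithBot.coe_unbot v h)
  | .void, v, h => (WithBot.unbot (α := Flat Empty) v h).val.elim
  | .int, v, h => (S.den_num _).trans (WithBot.coe_unbot v h)
  | .real, v, h => WithBot.coe_unbot v h
  | .prod σ τ, v, h => Prod.ext (sem_quote σ v.1 h.1) (sem_quote τ v.2 h.2)
  | .sum σ τ, v, h => by
    change WithBot (σ.dom ⊕ τ.dom) at v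
    induction v with
    | bot => exact h.elim
    | coe w =>
      rcases w with a | b
      · exact congrArg SCont.inl.toFun (sem_quote σ a h)
      · exact congrArg SCont.inr.toFun (sem_quote τ b h)
  | .arrow _ _, _, h => h.elim
  | .dist _, _, h => h.elim

end

/-! ### Observable elements -/

/-- This identifies the bottom that the dcpo structure of `τ.dom` supplies with the one adjoined by
`WithBot`: least elements are unique. -/
theorem eq_withBot_bot {X : Type*} [PartialOrder X] {v : WithBot X} (h : ∀ w, v ≤ w) : v = ⊥ :=
  le_antisymm (h ⊥) bot_le

theorem dom_bot_le {τ : Ty} (v : τ.dom) : ⊥ ≤ v := bot_le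

theorem unbot_le_unbot {X : Type*} [PartialOrder X] {v w : WithBot X} (hv : v ≠ ⊥) (hw : w ≠ ⊥)
    (h : v ≤ w) : v.unbot hv ≤ w.unbot hw :=
  WithBot.coe_le_coe.1 (by rwa [WithBot.coe_unbot, WithBot.coe_unbot])

theorem not_isObs_bot : ∀ β : Ty, ¬ IsObs β ⊥
  | .unit, h => h (eq_withBot_bot (X := Flat Unit) (dom_bot_le (τ := .unit)))
  | .void, h => h (eq_withBot_bot (X := Flat Empty) (dom_bot_le (τ := .void)))
  | .int, h => h (eq_withBot_bot (X := Flat ℤ) (dom_bot_le (τ := .int)))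
  | .real, h => h (eq_withBot_bot (X := IR) (dom_bot_le (τ := .real)))
  | .prod σ τ, h => by
    have hle : (⊥ : (Ty.prod σ τ).dom) ≤ ((⊥, ⊥) : σ.dom × τ.dom) := bot_le
    have : Prod.fst (α := σ.dom) (β := τ.dom) (⊥ : (Ty.prod σ τ).dom) = ⊥ :=
      le_antisymm hle.1 bot_le
    have h1 : IsObs σ (Prod.fst (α := σ.dom) (β := τ.dom) (⊥ : (Ty.prod σ τ).dom)) := h.1
    rw [this] at h1
    exact not_isObs_bot σ h1
  | .sum σ τ, h => by
    have : (⊥ : (Ty.sum σ τ).dom) = (⊥ : WithBot (σ.dom ⊕ τ.dom)) :=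
      eq_withBot_bot (X := σ.dom ⊕ τ.dom) (dom_bot_le (τ := .sum σ τ))
    rw [this] at h
    exact h
  | .arrow _ _, h => h
  | .dist _, h => h

theorem IsObs.upper : ∀ {β : Ty} {v w : β.dom}, v ≤ w → IsObs β v → IsObs β w
  | .unit, _, _, hvw, h => fun hw => h (le_bot_iff (α := WithBot (Flat Unit)).1 (le_of_le_of_eq hvw hw))
  | .void, _, _, hvw, h => fun hw => h (le_bot_iff (α := WithBot (Flat Empty)).1 (le_of_le_of_eq hvw hw))
  | .int, _, _, hvw, h => fun hw => h (le_bot_iff (α := WithBot (Flat ℤ)).1 (le_of_le_of_eq hvw hw))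
  | .real, _, _, hvw, h => fun hw => h (le_bot_iff (α := WithBot IR).1 (le_of_le_of_eq hvw hw))
  | .prod _ _, _, _, hvw, h => ⟨h.1.upper hvw.1, h.2.upper hvw.2⟩
  | .sum σ τ, v, w, hvw, h => by
    change WithBot (σ.dom ⊕ τ.dom) at v w
    change (v : WithBot (σ.dom ⊕ τ.dom)) ≤ w at hvw
    induction v with
    | bot => exact h.elim
    | coe v =>
      induction w with
      | bot => simp at hvw
      | coe w =>
        rw [WithBot.coe_le_coe] at hvw
        cases hvw with
        | inl hvw => exact IsObs.upper (β := σ) hvw h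
        | inr hvw => exact IsObs.upper (β := τ) hvw h
  | .arrow _ _, _, _, _, h => h
  | .dist _, _, _, _, h => h

theorem isStrictlyObs_iff : ∀ {β : Ty}, β.IsObservable → ∀ {v : β.dom},
    IsStrictlyObs β v ↔ IsObs β v ∨ v = ⊥
  | .unit, _, _ | .void, _, _ | .int, _, _ | .real, _, _ | .prod _ _, _, _ | .sum _ _, _, _ =>
    Iff.rfl

section
variable {S : Sig.{u}}

theorem quote_mono : ∀ {β : Ty} {v w : β.dom} (hv : IsObs β v) (hw : IsObs β w), v ≤ w →
    quote S β v hv ≤ quote S β w hw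
  | .unit, _, _, _, _, _ => le_rfl
  | .void, v, _, hv, _, _ => (WithBot.unbot (α := Flat Empty) v hv).val.elim
  | .int, v, w, hv, hw, h => by
    have : WithBot.unbot (α := Flat ℤ) v hv = WithBot.unbot (α := Flat ℤ) w hw :=
      unbot_le_unbot (X := Flat ℤ) hv hw h
    simp only [quote, this]
    exact le_rfl
  | .real, v, w, hv, hw, h => Tm.real_le_real.2 (unbot_le_unbot (X := IR) hv hw h)
  | .prod _ _, _, _, hv, hw, h =>
    Tm.pair_le_pair.2 ⟨quote_mono hv.1 hw.1 h.1, quote_mono hv.2 hw.2 h.2⟩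
  | .sum σ τ, v, w, hv, hw, h => by
    change WithBot (σ.dom ⊕ τ.dom) at v w
    change (v : WithBot (σ.dom ⊕ τ.dom)) ≤ w at h
    induction v with
    | bot => exact hv.elim
    | coe v =>
      induction w with
      | bot => simp at h
      | coe w =>
        rw [WithBot.coe_le_coe] at h
        cases h with
        | inl h => exact Tm.inl_le_inl.2 (quote_mono (β := σ) hv hw h)
        | inr h => exact Tm.inr_le_inr.2 (quote_mono (β := τ) hv hw h)
  | .arrow _ _, _, _, h, _, _ => h.elim
  | .dist _, _, _, h, _, _ => h.elim

/-- A larger term has the same shape, hence differs only in its intervals, and every interval is an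
observable element. So upper bounds of underlined elements are themselves underlined elements. -/
theorem eq_quote_of_le : ∀ {β : Ty} {v : β.dom} (hv : IsObs β v) {N : Cfg S β},
    quote S β v hv ≤ N → ∃ (w : β.dom) (hw : IsObs β w), N = quote S β w hw
  | .unit, v, hv, N, h => ⟨v, hv, Tm.of_shape_const h.1.symm⟩
  | .void, v, hv, _, _ => (WithBot.unbot (α := Flat Empty) v hv).val.elim
  | .int, v, hv, N, h => ⟨v, hv, Tm.of_shape_const h.1.symm⟩
  | .real, v, hv, N, h => by
    obtain ⟨a, rfl⟩ := Tm.of_shape_real h.1.symm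
    exact ⟨(a : WithBot IR), WithBot.coe_ne_bot, rfl⟩
  | .prod _ _, v, hv, N, h => by
    obtain ⟨M, P, rfl, -⟩ := Tm.of_shape_pair h.1.symm
    obtain ⟨h1, h2⟩ := Tm.pair_le_pair.1 h
    obtain ⟨a, ha, rfl⟩ := eq_quote_of_le hv.1 h1
    obtain ⟨b, hb, rfl⟩ := eq_quote_of_le hv.2 h2
    exact ⟨(a, b), ⟨ha, hb⟩, rfl⟩
  | .sum σ τ, v, hv, N, h => by
    change WithBot (σ.dom ⊕ τ.dom) at v
    induction v with
    | bot => exact hv.elim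
    | coe v =>
      rcases v with v | v
      · obtain ⟨M, rfl, -⟩ := Tm.of_shape_inl h.1.symm
        obtain ⟨a, ha, rfl⟩ := eq_quote_of_le (β := σ) hv (Tm.inl_le_inl.1 h)
        exact ⟨((Sum.inl a : σ.dom ⊕ τ.dom) : WithBot (σ.dom ⊕ τ.dom)), ha, rfl⟩
      · obtain ⟨M, rfl, -⟩ := Tm.of_shape_inr h.1.symm
        obtain ⟨a, ha, rfl⟩ := eq_quote_of_le (β := τ) hv (Tm.inr_le_inr.1 h)
        exact ⟨((Sum.inr a : σ.dom ⊕ τ.dom) : WithBot (σ.dom ⊕ τ.dom)), ha, rfl⟩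
  | .arrow _ _, _, h, _, _ => h.elim
  | .dist _, _, h, _, _ => h.elim

theorem IsConstApp.strictlyObs (hS : S.StrictlyObservableFirstOrder) {τ : Ty} {M : Cfg S τ}
    (hM : IsConstApp M) : τ.IsFirstOrder ∧ IsStrictlyObs τ (sem M) := by
  induction hM with
  | const c => exact ⟨(hS _ c).1, (hS _ c).2.1⟩
  | app M N _ _ ih => exact ⟨ih.1.2, ih.2.1 _⟩

open Classical in
/-- Scott-continuity of the operational semantics at applications of constants. -/
theorem quote_plug_cont {β τ : Ty} {w : (IR → IR) → β.dom} (hw : ScottContinuous w)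
    (hobs : ∀ θ, IsObs β (w θ) ∨ w θ = ⊥) (E : ECtx S β τ) {F : Cfg S τ → ℝ≥0∞}
    (hF : ScottContinuous F) : ScottContinuous fun θ =>
      if h : IsObs β (w θ) then F ((E.map θ).plug (quote S β (w θ) h)) else 0 := by
  have hG : ScottContinuous fun p : (IR → IR) × Cfg S β => F ((E.map p.1).plug p.2) :=
    (E.plug_cont ScottContinuous.fst ScottContinuous.snd).comp hF
  refine ScottContinuous.mk' (fun θ θ' h => ?_) fun d hd hd' a ha b hb => ?_
  · by_cases h1 : IsObs β (w θ)
    · have h2 := h1.upper (hw.monotone h)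
      rw [dif_pos h1, dif_pos h2]
      exact hG.monotone (a := (θ, _)) (b := (θ', _)) ⟨h, quote_mono h1 h2 (hw.monotone h)⟩
    · rw [dif_neg h1]
      exact zero_le
  · by_cases hwa : IsObs β (w a)
    swap
    · rw [dif_neg hwa]
      exact zero_le
    -- Otherwise all `w θ` with `θ` in `d` would be `⊥`, hence also their supremum `w a`, which is
    -- observable.
    obtain ⟨θ₀, h₀, hθ₀⟩ : ∃ θ ∈ d, IsObs β (w θ) := by
      by_contra! hne
      refine not_isObs_bot β (hwa.upper ((hw hd hd' ha).2 ?_))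
      rintro _ ⟨θ, hθ, rfl⟩
      exact ((hobs θ).resolve_left (hne θ hθ)).le
    -- On this cofinal part of `d` all the denotations are observable, since observable elements
    -- form an upper set.
    set e := {θ ∈ d | θ₀ ≤ θ} with he
    have he_obs : ∀ θ ∈ e, IsObs β (w θ) := fun θ hθ => hθ₀.upper (hw.monotone hθ.2)
    have he_ne : e.Nonempty := ⟨θ₀, h₀, le_rfl⟩
    have he_dir : DirectedOn (· ≤ ·) e := fun x hx y hy => by
      obtain ⟨z, hz, h1, h2⟩ := hd' x hx.1 y hy.1
      exact ⟨z, ⟨hz, hx.2.trans h1⟩, h1, h2⟩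
    have he_lub : IsLUB e a := ⟨fun θ hθ => ha.1 hθ.1, fun c hc => ha.2 fun θ hθ => by
      obtain ⟨z, hz, h1, h2⟩ := hd' θ hθ θ₀ h₀
      exact h1.trans (hc ⟨hz, h2⟩)⟩
    -- The value in the second case is irrelevant, as `q` is used only where `w θ` is observable.
    set q : (IR → IR) → Cfg S β := fun θ =>
      if h : IsObs β (w θ) then quote S β (w θ) h else quote S β (w a) hwa with hq
    have hq_eq : ∀ θ (h : IsObs β (w θ)), q θ = quote S β (w θ) h := fun θ h => dif_pos h
    have hq_mono : ∀ θ ∈ e, ∀ θ', θ ≤ θ' → q θ ≤ q θ' := fun θ hθ θ' hle => by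
      rw [hq_eq θ (he_obs θ hθ), hq_eq θ' ((he_obs θ hθ).upper (hw.monotone hle))]
      exact quote_mono _ _ (hw.monotone hle)
    have hq_lub : IsLUB (q '' e) (q a) := by
      refine ⟨?_, fun N hN => ?_⟩
      · rintro _ ⟨θ, hθ, rfl⟩
        exact hq_mono θ hθ a (he_lub.1 hθ)
      -- An upper bound `N` of the underlined elements is the underlining of some `v`. Taking
      -- denotations, `v` bounds all the `w θ`, hence their supremum `w a`.
      · have h1 := hN ⟨θ₀, ⟨h₀, le_rfl⟩, rfl⟩
        rw [hq_eq θ₀ hθ₀] at h1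
        obtain ⟨v, hv, rfl⟩ := eq_quote_of_le hθ₀ h1
        rw [hq_eq a hwa]
        refine quote_mono _ _ ((hw he_ne he_dir he_lub).2 ?_)
        rintro _ ⟨θ, hθ, rfl⟩
        have h2 := hN ⟨θ, hθ, rfl⟩
        rw [hq_eq θ (he_obs θ hθ)] at h2
        simpa only [sem_quote] using sem_mono h2
    have hp_dir : DirectedOn (· ≤ ·) ((fun θ => (θ, q θ)) '' e) := by
      rintro _ ⟨x, hx, rfl⟩ _ ⟨y, hy, rfl⟩
      obtain ⟨z, hz, h1, h2⟩ := he_dir x hx y hy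
      exact ⟨_, ⟨z, hz, rfl⟩, ⟨h1, hq_mono x hx z h1⟩, ⟨h2, hq_mono y hy z h2⟩⟩
    have hp_lub : IsLUB ((fun θ => (θ, q θ)) '' e) (a, q a) := by
      rw [isLUB_prod, image_image, image_image]
      exact ⟨by simpa using he_lub, hq_lub⟩
    rw [dif_pos hwa, ← hq_eq a hwa]
    refine (hG (he_ne.image _) hp_dir hp_lub).2 ?_
    rintro _ ⟨_, ⟨θ, hθ, rfl⟩, rfl⟩
    have := hb θ hθ.1
    rw [dif_pos (he_obs θ hθ)] at this
    dsimp only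
    rwa [hq_eq θ (he_obs θ hθ)]

/-! ### Scott-continuity of the operational semantics -/

theorem Contract.map (θ : IR → IR) {τ : Ty} {M N : Cfg S τ} (h : Contract M N) :
    Contract (M.map θ) (N.map θ) := by
  cases h with
  | fix M => exact .fix _
  | beta M N => rw [Tm.map_inst]; exact .beta _ _
  | fst M N => exact .fst _ _
  | snd M N => exact .snd _ _
  | inl M N P => exact .inl _ _ _
  | inr M N P => exact .inr _ _ _

/-- As `θ` varies, `M.map θ` keeps its shape, so the rule that may apply to it is fixed and only its
constants move. In each case the integral becomes an explicit expression in `θ`. -/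
theorem lint_nextOne_cont (hS : S.StrictlyObservableFirstOrder) {τ : Ty} {F : Cfg S τ → ℝ≥0∞}
    (hF : ScottContinuous F) : ScottContinuous fun M => (nextOne M).lint F := by
  classical
  refine Tm.scottContinuous_of_map fun M => ?_
  by_cases hn : IsNormal M
  · have : ∀ θ, (nextOne (M.map θ)).lint F = F (M.map θ) := fun θ => by
      rw [nextOne_of_isNormal (isNormal_of_shape hn (M.shape_map θ)), Val.lint_dirac _ hF]
    simp only [this]
    exact (Tm.map_cont M).comp hF
  rcases not_isNormal_iff.1 hn with ⟨σ, E, L, hL, rfl⟩ | ⟨σ, E, L, hL, rfl⟩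
  · simp only [E.map_plug]
    cases hL with
    | sample μ =>
      -- Transporting the integral to the image of `μ` on the intervals leaves a valuation
      -- independent of `θ`, so that only the integrand varies.
      have : ∀ θ, (nextOne ((E.map θ).plug (.sample μ))).lint F
          = (Val.ofMeasure μ.1 ⟨fun a => a, ScottContinuous.id⟩).lint
            fun a => F ((E.map θ).plug (.ret (.real a))) := fun θ => by
        rw [nextOne_eq (.sample (E.map θ) μ), Val.lint_ofMeasure _ _ hF]
        rfl
      simp only [Tm.map, this]
      have hc : ∀ a : IR, ScottContinuous fun θ => F ((E.map θ).plug (.ret (.real a))) := fun a =>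
        (E.plug_cont ScottContinuous.id (ScottContinuous.const _)).comp hF
      refine scottContinuous_of_iSup (fun θ θ' h => Val.lint_mono le_rfl fun a =>
        (hc a).monotone h) fun d hd hd' θ hθ => ?_
      have := hd.to_subtype
      refine (Val.lint_iSup_fun _ (fun θ : d => fun a => F ((E.map θ.1).plug (.ret (.real a))))
        (fun θ => (E.map θ.1).retReal.cont.comp hF) (fun x y => ?_)
        ((E.map θ).retReal.cont.comp hF) fun a => ?_).le
      · obtain ⟨z, h1, h2⟩ := hd'.directed_val x y
        exact ⟨z, fun a => (hc a).monotone h1, fun a => (hc a).monotone h2⟩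
      · have := hc a hd hd' hθ
        rw [← sSup_image' (f := fun θ => F ((E.map θ).plug (.ret (.real a))))]
        exact this.sSup_eq.symm
    | score a =>
      have : ∀ θ, (nextOne ((E.map θ).plug (.score (.real (θ a))))).lint F
          = ENNReal.ofReal (θ a).abs * F ((E.map θ).plug (.ret (.const S.star))) := fun θ => by
        rw [nextOne_eq (.score (E.map θ) (θ a)), Val.lint_smul, Val.lint_dirac _ hF]
      simp only [Tm.map, this]
      have ha : ScottContinuous fun θ : IR → IR => θ a := fun d _ _ θ h => isLUB_pi.1 h a
      exact ScottContinuous.ennreal_mul (ha.comp IR.abs_cont)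
        ((E.plug_cont ScottContinuous.id (ScottContinuous.const _)).comp hF)
    | bind M N =>
      have : ∀ θ, (nextOne ((E.map θ).plug (.bind (.ret (M.map θ)) (N.map θ)))).lint F
          = F ((E.plug (N.inst M)).map θ) := fun θ => by
        rw [nextOne_eq (.bind (E.map θ) _ _), Val.lint_dirac _ hF, E.map_plug, Tm.map_inst]
      simp only [Tm.map, this]
      exact (Tm.map_cont _).comp hF
  · simp only [E.map_plug]
    cases hL with
    | contract _ N hL =>
      have : ∀ θ, (nextOne ((E.map θ).plug (L.map θ))).lint F = F ((E.plug N).map θ) := fun θ => by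
        rw [nextOne_eq (.contract (E.map θ) _ _ (hL.map θ)), Val.lint_dirac _ hF, E.map_plug]
      simp only [this]
      exact (Tm.map_cont _).comp hF
    | const M N hM hN hβ =>
      have hM' : ∀ θ, IsConstApp (M.map θ) := fun θ => hM.of_shape (M.shape_map θ)
      have hN' : ∀ θ, IsAtom (N.map θ) := fun θ => hN.of_shape (N.shape_map θ)
      -- This is the only case where a change of constants may alter the behaviour: the term is
      -- blocked, with integral `0`, until the denotation becomes observable.
      have : ∀ θ, (nextOne ((E.map θ).plug (.app (M.map θ) (N.map θ)))).lint F
          = if h : IsObs _ (sem ((Tm.app M N).map θ)) then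
              F ((E.map θ).plug (quote S _ (sem ((Tm.app M N).map θ)) h)) else 0 := fun θ => by
        split_ifs with h
        · rw [nextOne_eq (.const (E.map θ) _ _ (hM' θ) (hN' θ) hβ h), Val.lint_dirac _ hF]
          rfl
        · rw [nextOne_of_isBlocked ⟨_, _, E.map θ, _, _, hM' θ, hN' θ, hβ, h, rfl⟩, Val.lint_zero]
      simp only [Tm.map, this]
      exact quote_plug_cont (w := fun θ => sem ((Tm.app M N).map θ)) ((Tm.map_cont _).comp sem_cont)
        (fun θ => (isStrictlyObs_iff hβ).1 ((IsConstApp.app _ _ (hM' θ) (hN' θ)).strictlyObs hS).2)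
        E hF

/-! ### The reachability valuation -/

theorem nextLe_zero_of_le {τ : Ty} {W : SOpens (Cfg S τ)} (hW : W ≤ normOpen S τ)
    (M : Cfg S τ) : nextLe 0 M W = Val.dirac M W := by
  by_cases hM : IsNormal M
  · rw [nextLe, nextZero, if_pos hM]
  · rw [nextLe, nextZero, if_neg hM, Val.dirac_eq_zero fun h => hM (mem_normOpen.1 (hW h))]
    rfl

/-- On open sets of normal forms the recursion already holds at `n = 0`, where it is integration of
an indicator function. Later inductions can thus start from a Dirac valuation. -/
theorem nextLe_succ {τ : Ty} {W : SOpens (Cfg S τ)} (hW : W ≤ normOpen S τ) (n : ℕ)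
    (M : Cfg S τ) : nextLe (n + 1) M W = (nextOne M).lint fun N => nextLe n N W := by
  cases n with
  | zero =>
    simp only [nextLe_zero_of_le hW, Val.lint_indicator]
    rfl
  | succ n => rfl

theorem nextLe_cont (hS : S.StrictlyObservableFirstOrder) {τ : Ty} {W : SOpens (Cfg S τ)}
    (hW : W ≤ normOpen S τ) (n : ℕ) : ScottContinuous fun M => nextLe n M W := by
  induction n with
  | zero =>
    simp only [nextLe_zero_of_le hW]
    exact Val.dirac_cont W
  | succ n ih =>
    simp only [nextLe_succ hW]
    exact lint_nextOne_cont hS ih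

/-- `Next^{≤1}` leaves normal forms in place, so mass that has reached `W` stays there; integration
propagates the inequality to later steps. -/
theorem nextLe_mono {τ : Ty} {W : SOpens (Cfg S τ)} (hW : W ≤ normOpen S τ) :
    Monotone fun (n : ℕ) M => nextLe n M W := by
  refine monotone_nat_of_le_succ fun n => ?_
  induction n with
  | zero =>
    intro M
    by_cases hM : M ∈ W
    · simp only [nextLe_succ hW, nextLe_zero_of_le hW, Val.lint_indicator]
      rw [nextOne_of_isNormal (mem_normOpen.1 (hW hM))]
    · simp only [nextLe_zero_of_le hW, Val.dirac_eq_zero hM]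
      exact zero_le
  | succ n ih =>
    intro M
    simp only [nextLe_succ hW (n + 1), nextLe_succ hW n]
    exact Val.lint_mono le_rfl fun N => (ih N).trans_eq (nextLe_succ hW n N)

theorem nextStar_cont (hS : S.StrictlyObservableFirstOrder) {τ : Ty} (U : SOpens (Cfg S τ)) :
    ScottContinuous fun M => nextStar M U :=
  ScottContinuous.mk' (fun _ _ h => iSup_mono fun n => (nextLe_cont hS inf_le_right _).monotone h)
    fun _ hd hd' _ ha _ hb => iSup_le fun n =>
      (nextLe_cont hS inf_le_right (n + 1) hd hd' ha).2 (by
        rintro _ ⟨M, hM, rfl⟩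
        exact (le_iSup (fun n => nextLe (n + 1) M _) n).trans (hb M hM))

theorem nextStar_eq_iSup {τ : Ty} (M : Cfg S τ) (U : SOpens (Cfg S τ)) :
    nextStar M U = ⨆ n, nextLe n M (U ⊓ normOpen S τ) :=
  le_antisymm (iSup_le fun n => le_iSup (fun n => nextLe n M _) (n + 1)) (iSup_mono fun n =>
    nextLe_mono inf_le_right n.le_succ M)

/-- Monotone convergence in the recursion for `Next^{≤n}`. The shift of the index is absorbed
because the supremum over `n ≥ 0` agrees with that over `n ≥ 1`. -/
theorem nextStar_eq_lint (hS : S.StrictlyObservableFirstOrder) {τ : Ty} (M : Cfg S τ)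
    (U : SOpens (Cfg S τ)) : nextStar M U = (nextOne M).lint fun N => nextStar N U := by
  rw [Val.lint_iSup_fun (nextOne M) (fun n N => nextLe n N (U ⊓ normOpen S τ))
    (nextLe_cont hS inf_le_right) (nextLe_mono inf_le_right).directed_le (nextStar_cont hS U)
    fun N => nextStar_eq_iSup N U]
  exact iSup_congr fun n => nextLe_succ inf_le_right n M

theorem nextStar_of_isNormal {τ : Ty} {M : Cfg S τ} (hM : IsNormal M) {U : SOpens (Cfg S τ)}
    (h : M ∈ U) : 1 ≤ nextStar M U := by
  rw [nextStar_eq_iSup]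
  refine le_iSup_of_le 0 ?_
  rw [nextLe_zero_of_le inf_le_right, Val.dirac_eq_one]
  exact ⟨h, mem_normOpen.2 hM⟩

end

/-! ### Soundness -/

section
variable {S : Sig.{u}}

theorem MVal.bind_unit {X : Type*} [CompletePartialOrder X] (μ : MVal X) :
    MVal.bind SCont.unit μ = μ :=
  le_antisymm (fun U => (μ.1.lint_indicator U).le) fun U => (μ.1.lint_indicator U).ge

theorem MVal.unit_bind {X Y : Type*} [CompletePartialOrder X] [CompletePartialOrder Y]
    (f : SCont X (MVal Y)) (x : X) : MVal.bind f (MVal.unit x) = f x :=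
  le_antisymm (fun U => (Val.lint_dirac x (MVal.eval_scont f U)).le)
    fun U => (Val.lint_dirac x (MVal.eval_scont f U)).ge

theorem MVal.bind_bind {X Y Z : Type*} [CompletePartialOrder X] [CompletePartialOrder Y]
    [CompletePartialOrder Z] (f : SCont X (MVal Y)) (g : SCont Y (MVal Z)) (μ : MVal X) :
    MVal.bind g (MVal.bind f μ)
      = MVal.bind (SCont.comp SCont.bind (SCont.pair (SCont.const g) f)) μ :=
  le_antisymm (fun U => (MVal.lint_bind f μ (MVal.eval_scont g U)).le)
    fun U => (MVal.lint_bind f μ (MVal.eval_scont g U)).ge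

/-- The denotation of `E [M]` is an integral over that of `M`, if `M` is of a type `D σ`. -/
def WCtx.IsBind {σ : Ty} : ∀ {τ : Ty}, WCtx S (.dist σ) τ → Prop
  | .dist τ, E => ∃ G : SCont σ.dom (MVal τ.dom), ∀ M : Cfg S (.dist σ),
      semD (E.plug M) = MVal.bind G (semD M)
  | _, _ => False

/-- A weak context whose hole has type `D σ` is built from the hole by binds alone. The other
constructors would need an inner context of real, arrow, sum or product type, or of the basic
argument type of a first-order constant, and by induction no such context exists. -/
theorem WCtx.isBind (hS : S.StrictlyObservableFirstOrder) {σ τ : Ty} (E : WCtx S (.dist σ) τ) :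
    E.IsBind := by
  induction E with
  | hole => exact ⟨SCont.unit, fun M => (MVal.bind_unit (semD M)).symm⟩
  | @bind υ τ E N ih =>
    obtain ⟨G, hG⟩ := ih
    let g : SCont υ.dom (MVal τ.dom) := sem N.lam
    refine ⟨SCont.comp SCont.bind (SCont.pair (SCont.const g) G), fun M => ?_⟩
    rw [← MVal.bind_bind, ← hG]
    rfl
  | @arg υ τ P hP E ih =>
    have h := (hP.strictlyObs hS).1.1
    cases υ with
    | unit | void | int | real => exact ih.elim
    | sum | prod | arrow | dist => exact h.elim
  | score _ ih | app _ _ ih | case _ _ _ ih | fst _ ih | snd _ ih => exact ih.elim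

/-- Sampling and scoring act linearly on the valuation in the hole, and `WCtx.isBind` carries this
through the context. All other steps preserve the denotation, so that the integral is over a single
term. -/
theorem NextRel.lint_le (hS : S.StrictlyObservableFirstOrder) {β : Ty} (U : SOpens β.dom)
    {M : Cfg S (.dist β)} {ν : Val (Cfg S (.dist β))} (h : NextRel M ν) :
    (ν.lint fun N => semD N U) ≤ semD M U := by
  have key : ∀ {M N : Cfg S (.dist β)}, sem M = sem N →
      ((Val.dirac N).lint fun N => semD N U) ≤ semD M U := fun {M N} h =>
    (Val.lint_dirac_le _ _).trans (le_of_eq (congrArg (fun ν : MVal β.dom => ν U) h.symm))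
  cases h with
  | sample E μ =>
    obtain ⟨G, hG⟩ := E.isBind hS
    rw [hG, MVal.bind_apply]
    -- Both sides are integrals over images of the same measure. The integrands agree by the unit
    -- law, since `E[ret a]` denotes `G` at the interval `a`.
    refine Val.lint_ofMeasure_le _ _ _ _ (MVal.eval_scont G U) fun a => le_of_eq ?_
    refine (congrArg (fun ν : MVal β.dom => ν U) (hG (.ret (.real a)))).trans ?_
    exact congrArg (fun ν : MVal β.dom => ν U) (MVal.unit_bind G (realD a))
  | score E a =>
    obtain ⟨G, hG⟩ := E.isBind hS
    rw [hG, MVal.bind_apply, Val.lint_smul]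
    refine (mul_le_mul_right (Val.lint_dirac_le _ _) _).trans ?_
    rw [hG, MVal.bind_apply]
    refine le_trans ?_ (Val.lint_smul (ENNReal.ofReal a.abs) (Val.dirac starD) _).ge
    have : semD (.ret (.const S.star) : Cfg S (.dist .unit)) = MVal.unit starD :=
      congrArg MVal.unit S.den_star
    rw [this]
    exact le_rfl
  | bind E M N =>
    refine key (E.sem_congr ?_)
    exact (MVal.unit_bind _ _).trans (Tm.den_inst N M _).symm
  | contract E M N h => exact key (E.sem_congr h.sem_eq)
  | const E M N _ _ _ h => exact key (E.sem_congr (sem_quote _ _ h).symm)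

theorem semD_ret_apply {β : Ty} (V : Cfg S β) (U : SOpens β.dom) :
    semD (.ret V) U = Val.dirac (sem V) U := rfl

theorem semD_cont {β : Ty} (U : SOpens β.dom) :
    ScottContinuous fun M : Cfg S (.dist β) => semD M U :=
  ScottContinuous.comp (f := fun M : Cfg S (.dist β) => semD M) (sem_cont (τ := .dist β))
    (MVal.apply_cont U)

/-- Being of the form `ret V` with `V` normal depends on the shape alone. For such terms `⟦V⟧ ∈ U`
means that `⟦ret V⟧(U)`, which is `0` or `1`, is positive, and this is an open condition. -/
theorem isScottOpen_rover {β : Ty} (U : SOpens β.dom) : IsScottOpen (rover S U) := by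
  have h1 : IsScottOpen {M : Cfg S (.dist β) | ∃ V, IsNormal V ∧ M = .ret V} :=
    isScottOpen_of_shape fun _ ⟨V, hV, hM⟩ N h => by
      subst hM
      obtain ⟨W, rfl, h1⟩ := Tm.of_shape_ret h
      exact ⟨W, isNormal_of_shape hV h1, rfl⟩
  have h2 := isScottOpen_level (semD_cont (S := S) U) 0
  have : rover S U = {M : Cfg S (.dist β) | ∃ V, IsNormal V ∧ M = .ret V} ∩
      {M | 0 < semD M U} := by
    ext M
    constructor
    · rintro ⟨V, hV, hU, rfl⟩
      refine ⟨⟨V, hV, rfl⟩, ?_⟩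
      show 0 < Val.dirac (sem V) U
      simp [Val.dirac_eq_one hU]
    · rintro ⟨⟨V, hV, rfl⟩, h⟩
      refine ⟨V, hV, ?_, rfl⟩
      by_contra hU
      rw [mem_ofPred_eq, semD_ret_apply, Val.dirac_eq_zero hU] at h
      exact lt_irrefl _ h
  rw [this]
  exact @IsOpen.inter _ (Topology.scott _ univ) _ _ h1 h2

/-- The function `M ↦ ⟦M⟧(U)` dominates the indicator of `W` and its own integral against
`Next^{≤1}`, hence every `Next^{≤n}(M)(W ∩ Norm)`. -/
theorem nextStar_le (hS : S.StrictlyObservableFirstOrder) {β : Ty} (U : SOpens β.dom)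
    (W : SOpens (Cfg S (.dist β))) (hW : ∀ M ∈ W, M ∈ rover S U) (M : Cfg S (.dist β)) :
    nextStar M W ≤ semD M U := by
  have key : ∀ n M, nextLe n M (W ⊓ normOpen S (.dist β)) ≤ semD M U := by
    intro n
    induction n with
    | zero =>
      intro M
      rw [nextLe_zero_of_le inf_le_right]
      by_cases hM : M ∈ W ⊓ normOpen S (.dist β)
      · rw [Val.dirac_eq_one hM]
        obtain ⟨V, -, hV, rfl⟩ := hW M hM.1
        rw [semD_ret_apply, Val.dirac_eq_one hV]
      · rw [Val.dirac_eq_zero hM]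
        exact zero_le
    | succ n ih =>
      intro M
      rw [nextLe_succ inf_le_right]
      refine (Val.lint_mono le_rfl ih).trans ?_
      by_cases h1 : IsRedex M
      · obtain ⟨ν, hν⟩ := h1
        rw [nextOne_eq hν]
        exact hν.lint_le hS U
      by_cases h2 : IsBlocked M
      · rw [nextOne_of_isBlocked h2, Val.lint_zero]
        exact zero_le
      · rw [nextOne_of_isNormal ⟨h1, h2⟩]
        exact Val.lint_dirac_le _ _
  exact iSup_le fun n => key (n + 1) M

end

/-! ### Deterministic reductions -/

section
variable {S : Sig.{u}}

/-- The contractions, and the evaluation of constants. -/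
inductive Det : ∀ {τ : Ty}, Cfg S τ → Cfg S τ → Prop
  | contract {τ : Ty} (M N : Cfg S τ) : Contract M N → Det M N
  | const {σ β : Ty} (M : Cfg S (.arrow σ β)) (N : Cfg S σ) : IsConstApp M → IsAtom N →
      β.IsObservable → (h : IsObs β (sem (.app M N))) →
      Det (.app M N) (quote S β (sem (.app M N)) h)

/-- Reductions under weak contexts. -/
def WStep {τ : Ty} (M N : Cfg S τ) : Prop :=
  ∃ (σ : Ty) (E : WCtx S σ τ) (L R : Cfg S σ), Det L R ∧ M = E.plug L ∧ N = E.plug R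

/-- Reductions under evaluation contexts. -/
def EStep {τ : Ty} (M N : Cfg S τ) : Prop :=
  ∃ (σ : Ty) (E : ECtx S σ τ) (L R : Cfg S σ), Det L R ∧ M = E.plug L ∧ N = E.plug R

/-- Iterated reductions under weak contexts. -/
abbrev WSteps {τ : Ty} : Cfg S τ → Cfg S τ → Prop := Relation.ReflTransGen WStep

/-- Iterated reductions under evaluation contexts. -/
abbrev ESteps {τ : Ty} : Cfg S τ → Cfg S τ → Prop := Relation.ReflTransGen EStep

theorem Det.wStep {τ : Ty} {M N : Cfg S τ} (h : Det M N) : WStep M N :=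
  ⟨_, .hole, _, _, h, rfl, rfl⟩

theorem WStep.eStep {τ : Ty} {M N : Cfg S τ} (h : WStep M N) : EStep M N := by
  obtain ⟨σ, E, L, R, h⟩ := h
  exact ⟨σ, .weak E, L, R, h⟩

theorem EStep.nextRel {τ : Ty} {M N : Cfg S τ} (h : EStep M N) : NextRel M (Val.dirac N) := by
  obtain ⟨σ, E, L, R, h, rfl, rfl⟩ := h
  cases h with
  | contract _ _ h => exact .contract E _ _ h
  | const M N hM hN hβ h => exact .const E M N hM hN hβ h

theorem WStep.plug {σ τ : Ty} {M N : Cfg S σ} (h : WStep M N) (E : WCtx S σ τ) :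
    WStep (E.plug M) (E.plug N) := by
  obtain ⟨υ, F, L, R, h, rfl, rfl⟩ := h
  exact ⟨υ, E.comp F, L, R, h, (E.comp_plug F L).symm, (E.comp_plug F R).symm⟩

theorem WSteps.plug {σ τ : Ty} {M N : Cfg S σ} (h : WSteps M N) (E : WCtx S σ τ) :
    WSteps (E.plug M) (E.plug N) :=
  h.lift _ fun _ _ h => h.plug E

theorem WStep.exists_wAct {τ : Ty} {M N : Cfg S τ} (h : WStep M N) : ∃ A, WAct M A := by
  obtain ⟨σ, E, L, R, h, rfl, rfl⟩ := h
  cases h with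
  | contract _ _ h => exact ⟨_, (WAct.contract _ _ h).plug E⟩
  | const M N hM hN hβ h => exact ⟨_, (WAct.const M N hM hN hβ).plug E⟩

/-- The terms that do not act under a weak context. -/
def IsWeakNormal {τ : Ty} (M : Cfg S τ) : Prop := ∀ A, ¬ WAct M A

/-- By determinism one of two reduction sequences from `M` continues the other, and the end of the
shorter one does not act. Hence the witnesses in the definition of `LR` are unique. -/
theorem WSteps.unique {τ : Ty} {M V W : Cfg S τ} (hV : WSteps M V) (hW : WSteps M W)
    (hV' : IsWeakNormal V) (hW' : IsWeakNormal W) : V = W := by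
  -- Two reducts of a term give the same Dirac valuation as `Next`, hence are equal.
  have hu : Relator.RightUnique (WStep (S := S) (τ := τ)) := fun _ _ _ h h' =>
    Val.dirac_injective (h.eStep.nextRel.unique h'.eStep.nextRel)
  rcases Relation.ReflTransGen.total_of_right_unique hu hV hW with h | h
  · rcases h.cases_head with h | ⟨N, h, -⟩
    · exact h
    · obtain ⟨A, hA⟩ := h.exists_wAct
      exact (hV' A hA).elim
  · rcases h.cases_head with h | ⟨N, h, -⟩
    · exact h.symm
    · obtain ⟨A, hA⟩ := h.exists_wAct
      exact (hW' A hA).elim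

theorem EStep.ret {τ : Ty} {M N : Cfg S τ} (h : EStep M N) : EStep M.ret N.ret := by
  obtain ⟨σ, E, L, R, h, rfl, rfl⟩ := h
  exact ⟨σ, .ret E, L, R, h, rfl, rfl⟩

theorem EStep.pairL {σ τ : Ty} {M N : Cfg S σ} (h : EStep M N) (P : Cfg S τ) :
    EStep (M.pair P) (N.pair P) := by
  obtain ⟨σ, E, L, R, h, rfl, rfl⟩ := h
  exact ⟨σ, .pairL E P, L, R, h, rfl, rfl⟩

theorem EStep.pairR {σ τ : Ty} {V : Cfg S σ} (hV : IsValue V) {M N : Cfg S τ} (h : EStep M N) :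
    EStep (V.pair M) (V.pair N) := by
  obtain ⟨σ, E, L, R, h, rfl, rfl⟩ := h
  exact ⟨σ, .pairR V hV E, L, R, h, rfl, rfl⟩

theorem EStep.inl {σ τ : Ty} {M N : Cfg S σ} (h : EStep M N) :
    EStep (M.inl : Cfg S (.sum σ τ)) N.inl := by
  obtain ⟨σ, E, L, R, h, rfl, rfl⟩ := h
  exact ⟨σ, .inl E, L, R, h, rfl, rfl⟩

theorem EStep.inr {σ τ : Ty} {M N : Cfg S τ} (h : EStep M N) :
    EStep (M.inr : Cfg S (.sum σ τ)) N.inr := by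
  obtain ⟨σ, E, L, R, h, rfl, rfl⟩ := h
  exact ⟨σ, .inr E, L, R, h, rfl, rfl⟩

theorem EStep.nextStar_eq (hS : S.StrictlyObservableFirstOrder) {τ : Ty} {M N : Cfg S τ}
    (h : EStep M N) (W : SOpens (Cfg S τ)) : nextStar M W = nextStar N W := by
  rw [nextStar_eq_lint hS, nextOne_eq h.nextRel, Val.lint_dirac _ (nextStar_cont hS W)]

theorem ESteps.nextStar_eq (hS : S.StrictlyObservableFirstOrder) {τ : Ty} {M N : Cfg S τ}
    (h : ESteps M N) (W : SOpens (Cfg S τ)) : nextStar M W = nextStar N W := by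
  induction h with
  | refl => rfl
  | tail _ h ih => rw [ih, h.nextStar_eq hS]

theorem WSteps.eSteps {τ : Ty} {M N : Cfg S τ} (h : WSteps M N) : ESteps M N :=
  h.lift id fun _ _ h => h.eStep

/-! ### The logical relation -/

/-- The first injection. -/
def inlD {σ τ : Ty} (a : σ.dom) : (Ty.sum σ τ).dom :=
  ((Sum.inl a : σ.dom ⊕ τ.dom) : WithBot (σ.dom ⊕ τ.dom))

/-- The second injection. -/
def inrD {σ τ : Ty} (b : τ.dom) : (Ty.sum σ τ).dom :=
  ((Sum.inr b : σ.dom ⊕ τ.dom) : WithBot (σ.dom ⊕ τ.dom))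

/-- The first projection. -/
def fstD {σ τ : Ty} (v : (Ty.prod σ τ).dom) : σ.dom := Prod.fst (α := σ.dom) (β := τ.dom) v

/-- The second projection. -/
def sndD {σ τ : Ty} (v : (Ty.prod σ τ).dom) : τ.dom := Prod.snd (α := σ.dom) (β := τ.dom) v

/-- Elements of type `D τ` as minimal valuations. -/
def distD {τ : Ty} (ν : (Ty.dist τ).dom) : MVal τ.dom := ν

/-- The logical relation at basic types. -/
def BasicRel {τ : Ty} (v : τ.dom) (M : Cfg S τ) : Prop :=
  v = ⊥ ∨ ∃ V : Cfg S τ, IsAtom V ∧ WSteps M V ∧ v ≤ sem V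

/-- The logical relation between elements of domains and terms; at types `D τ`, it is defined by
biorthogonality, with the probabilities to reach a given open set as observations. -/
def LR {β : Ty} (W : SOpens (Cfg S (.dist β))) : (τ : Ty) → τ.dom → Cfg S τ → Prop
  | .unit, v, M => BasicRel v M
  | .void, v, M => BasicRel v M
  | .int, v, M => BasicRel v M
  | .real, v, M => BasicRel v M
  | .sum σ τ, v, M => v = ⊥ ∨ (∃ a N, v = inlD a ∧ WSteps M (.inl N) ∧ LR W σ a N) ∨
      (∃ b N, v = inrD b ∧ WSteps M (.inr N) ∧ LR W τ b N)
  | .prod σ τ, v, M => v = ⊥ ∨ ∃ N P, WSteps M (.pair N P) ∧ LR W σ (fstD v) N ∧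
      LR W τ (sndD v) P
  | .arrow σ τ, f, M => ∀ v N, LR W σ v N → LR W τ (appD f v) (.app M N)
  | .dist τ, ν, M => ∀ h : τ.dom → ℝ≥0∞, ScottContinuous h → ∀ E : WCtx S (.dist τ) (.dist β),
      (∀ v N, LR W τ v N → h v ≤ nextStar (E.plug (.ret N)) W) →
      (distD ν).1.lint h ≤ nextStar (E.plug M) W

theorem lR_of_isBasic {β : Ty} (W : SOpens (Cfg S (.dist β))) {τ : Ty} (hτ : τ.IsBasic)
    {v : τ.dom} {M : Cfg S τ} : LR W τ v M ↔ BasicRel v M := by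
  cases τ with
  | unit | void | int | real => rfl
  | sum | prod | arrow | dist => exact hτ.elim

theorem sum_cases {σ τ : Ty} (v : (Ty.sum σ τ).dom) :
    v = ⊥ ∨ (∃ a, v = inlD a) ∨ ∃ b, v = inrD b := by
  have hbot := eq_withBot_bot (X := σ.dom ⊕ τ.dom) (dom_bot_le (τ := .sum σ τ))
  rw [hbot]
  change WithBot (σ.dom ⊕ τ.dom) at v
  induction v with
  | bot => exact .inl rfl
  | coe v =>
    rcases v with a | b
    · exact .inr (.inl ⟨a, rfl⟩)
    · exact .inr (.inr ⟨b, rfl⟩)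

theorem inlD_le_inlD {σ τ : Ty} {a b : σ.dom} :
    (inlD a : (Ty.sum σ τ).dom) ≤ inlD b ↔ a ≤ b :=
  WithBot.coe_le_coe.trans Sum.inl_le_inl_iff

theorem inrD_le_inrD {σ τ : Ty} {a b : τ.dom} :
    (inrD a : (Ty.sum σ τ).dom) ≤ inrD b ↔ a ≤ b :=
  WithBot.coe_le_coe.trans Sum.inr_le_inr_iff

theorem not_inlD_le_inrD {σ τ : Ty} {a : σ.dom} {b : τ.dom} :
    ¬ (inlD a : (Ty.sum σ τ).dom) ≤ inrD b := fun h =>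
  Sum.not_inl_le_inr (WithBot.coe_le_coe.1 h)

theorem not_inrD_le_inlD {σ τ : Ty} {a : σ.dom} {b : τ.dom} :
    ¬ (inrD b : (Ty.sum σ τ).dom) ≤ inlD a := fun h =>
  Sum.not_inr_le_inl (WithBot.coe_le_coe.1 h)

theorem not_inlD_le_bot {σ τ : Ty} {a : σ.dom} : ¬ (inlD a : (Ty.sum σ τ).dom) ≤ ⊥ := by
  rw [eq_withBot_bot (X := σ.dom ⊕ τ.dom) (dom_bot_le (τ := .sum σ τ))]
  exact WithBot.not_coe_le_bot _

theorem not_inrD_le_bot {σ τ : Ty} {b : τ.dom} : ¬ (inrD b : (Ty.sum σ τ).dom) ≤ ⊥ := by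
  rw [eq_withBot_bot (X := σ.dom ⊕ τ.dom) (dom_bot_le (τ := .sum σ τ))]
  exact WithBot.not_coe_le_bot _

theorem appD_mono {σ τ : Ty} {f g : (Ty.arrow σ τ).dom} (h : f ≤ g) (x : σ.dom) :
    appD f x ≤ appD g x := h x

theorem appD_bot {σ τ : Ty} (x : σ.dom) : appD (⊥ : (Ty.arrow σ τ).dom) x = ⊥ :=
  le_bot_iff.1 (appD_mono (g := (SCont.const ⊥ : SCont σ.dom τ.dom)) bot_le x)

theorem fstD_mono {σ τ : Ty} {v w : (Ty.prod σ τ).dom} (h : v ≤ w) : fstD v ≤ fstD w := h.1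

theorem sndD_mono {σ τ : Ty} {v w : (Ty.prod σ τ).dom} (h : v ≤ w) : sndD v ≤ sndD w := h.2

theorem fstD_bot {σ τ : Ty} : fstD (⊥ : (Ty.prod σ τ).dom) = ⊥ :=
  le_bot_iff.1 (fstD_mono (w := ((⊥, ⊥) : σ.dom × τ.dom)) bot_le)

theorem sndD_bot {σ τ : Ty} : sndD (⊥ : (Ty.prod σ τ).dom) = ⊥ :=
  le_bot_iff.1 (sndD_mono (w := ((⊥, ⊥) : σ.dom × τ.dom)) bot_le)

/-! ### Closure properties of the logical relation. -/

theorem LR.bot {β : Ty} (W : SOpens (Cfg S (.dist β))) : ∀ (τ : Ty) (M : Cfg S τ), LR W τ ⊥ M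
  | .unit, _ | .void, _ | .int, _ | .real, _ | .sum _ _, _ | .prod _ _, _ => .inl rfl
  | .arrow σ τ, M => fun v N _ => by rw [appD_bot]; exact LR.bot W τ _
  | .dist τ, M => fun h _ E _ => by
    have h1 : distD (⊥ : (Ty.dist τ).dom) ≤ (⟨0, .simple _ Val.isSimple_zero⟩ : MVal τ.dom) :=
      dom_bot_le (τ := .dist τ) _
    exact (Val.lint_mono h1 fun _ => le_rfl).trans ((Val.lint_zero h).le.trans zero_le)

theorem BasicRel.down {τ : Ty} {v w : τ.dom} {M : Cfg S τ} (hvw : v ≤ w) (h : BasicRel w M) :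
    BasicRel v M := by
  rcases h with rfl | ⟨V, hV, hM, hw⟩
  · exact .inl (le_bot_iff.1 hvw)
  · exact .inr ⟨V, hV, hM, hvw.trans hw⟩

theorem LR.down {β : Ty} (W : SOpens (Cfg S (.dist β))) : ∀ {τ : Ty} {v w : τ.dom} {M : Cfg S τ},
    v ≤ w → LR W τ w M → LR W τ v M
  | .unit, _, _, _, hvw, h => BasicRel.down hvw h
  | .void, _, _, _, hvw, h => BasicRel.down hvw h
  | .int, _, _, _, hvw, h => BasicRel.down hvw h
  | .real, _, _, _, hvw, h => BasicRel.down hvw h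
  | .sum σ τ, v, w, M, hvw, h => by
    rcases sum_cases v with rfl | ⟨a, rfl⟩ | ⟨b, rfl⟩
    · exact LR.bot W _ M
    · rcases h with rfl | ⟨a', N, rfl, hM, hN⟩ | ⟨b', N, rfl, hM, hN⟩
      · exact (not_inlD_le_bot hvw).elim
      · exact .inr (.inl ⟨a, N, rfl, hM, LR.down W (inlD_le_inlD.1 hvw) hN⟩)
      · exact (not_inlD_le_inrD hvw).elim
    · rcases h with rfl | ⟨a', N, rfl, hM, hN⟩ | ⟨b', N, rfl, hM, hN⟩
      · exact (not_inrD_le_bot hvw).elim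
      · exact (not_inrD_le_inlD hvw).elim
      · exact .inr (.inr ⟨b, N, rfl, hM, LR.down W (inrD_le_inrD.1 hvw) hN⟩)
  | .prod σ τ, v, w, M, hvw, h => by
    rcases h with rfl | ⟨N, P, hM, hN, hP⟩
    · exact .inl (le_bot_iff.1 hvw)
    · exact .inr ⟨N, P, hM, LR.down W (fstD_mono hvw) hN, LR.down W (sndD_mono hvw) hP⟩
  | .arrow σ τ, f, g, M, hvw, h => fun x N hN => LR.down W (appD_mono hvw x) (h x N hN)
  | .dist τ, ν, ξ, M, hvw, h => fun k hk E hE => by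
    have h1 : distD ν ≤ distD ξ := hvw
    exact (Val.lint_mono h1 fun _ => le_rfl).trans (h k hk E hE)

theorem BasicRel.expand {τ : Ty} {v : τ.dom} {M N : Cfg S τ} (hMN : WSteps M N)
    (h : BasicRel v N) : BasicRel v M :=
  h.imp id fun ⟨V, hV, hN, hv⟩ => ⟨V, hV, hMN.trans hN, hv⟩

/-- Reductions under weak contexts can be prefixed to the one in the definition. At arrow types they
are moved into function position, and at `D τ` a deterministic step inside `E` leaves `Next*`
unchanged. -/
theorem LR.expand (hS : S.StrictlyObservableFirstOrder) {β : Ty} (W : SOpens (Cfg S (.dist β))) :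
    ∀ {τ : Ty} {v : τ.dom} {M N : Cfg S τ}, WSteps M N → LR W τ v N → LR W τ v M
  | .unit, _, _, _, hMN, h => BasicRel.expand hMN h
  | .void, _, _, _, hMN, h => BasicRel.expand hMN h
  | .int, _, _, _, hMN, h => BasicRel.expand hMN h
  | .real, _, _, _, hMN, h => BasicRel.expand hMN h
  | .sum σ τ, v, M, N, hMN, h => by
    rcases h with rfl | ⟨a, P, rfl, hN, hP⟩ | ⟨b, P, rfl, hN, hP⟩
    · exact LR.bot W _ M
    · exact .inr (.inl ⟨a, P, rfl, hMN.trans hN, hP⟩)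
    · exact .inr (.inr ⟨b, P, rfl, hMN.trans hN, hP⟩)
  | .prod σ τ, v, M, N, hMN, h =>
    h.imp id fun ⟨P, Q, hN, hP, hQ⟩ => ⟨P, Q, hMN.trans hN, hP, hQ⟩
  | .arrow σ τ, f, M, N, hMN, h => fun x P hP =>
    LR.expand hS W (hMN.plug (.app .hole P)) (h x P hP)
  | .dist τ, ν, M, N, hMN, h => fun k hk E hE => by
    rw [(hMN.plug E).eSteps.nextStar_eq hS]
    exact h k hk E hE

/-- All members of `d` other than `⊥` share one witness, the constant to which `M` reduces, so its
denotation bounds the whole of `d`. -/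
theorem BasicRel.sup {τ : Ty} {d : Set τ.dom} {a : τ.dom} (ha : IsLUB d a) {M : Cfg S τ}
    (h : ∀ v ∈ d, BasicRel v M) : BasicRel a M := by
  by_cases hd : ∀ v ∈ d, v = ⊥
  · exact .inl (le_bot_iff.1 (ha.2 fun v hv => (hd v hv).le))
  push Not at hd
  obtain ⟨v, hv, hv'⟩ := hd
  obtain ⟨V, hV, hMV, -⟩ := (h v hv).resolve_left hv'
  refine .inr ⟨V, hV, hMV, ha.2 fun w hw => ?_⟩
  rcases h w hw with rfl | ⟨V', hV', hMV', hwV⟩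
  · exact bot_le
  · rwa [hMV.unique hMV' (fun _ => not_wAct_atom hV) fun _ => not_wAct_atom hV']

/-- The logical relation is closed under directed suprema. -/
theorem LR.sup {β : Ty} (W : SOpens (Cfg S (.dist β))) : ∀ {τ : Ty} {d : Set τ.dom} {a : τ.dom},
    d.Nonempty → DirectedOn (· ≤ ·) d → IsLUB d a → ∀ {M : Cfg S τ}, (∀ v ∈ d, LR W τ v M) →
      LR W τ a M
  | .unit, _, _, _, _, ha, _, h => BasicRel.sup ha h
  | .void, _, _, _, _, ha, _, h => BasicRel.sup ha h
  | .int, _, _, _, _, ha, _, h => BasicRel.sup ha h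
  | .real, _, _, _, _, ha, _, h => BasicRel.sup ha h
  | .sum σ τ, d, a, hd, hd', ha, M, h => by
    rcases sum_cases a with rfl | ⟨a, rfl⟩ | ⟨a, rfl⟩
    · exact LR.bot W _ M
    -- The supremum is a left injection, so the members of `d` are `⊥` or left injections, and they
    -- are not all `⊥`.
    · obtain ⟨x₀, hx₀⟩ : ∃ x, inlD x ∈ d := by
        by_contra! hne
        refine not_inlD_le_bot (ha.2 fun v hv => ?_)
        rcases sum_cases v with rfl | ⟨x, rfl⟩ | ⟨y, rfl⟩
        · exact le_rfl
        · exact (hne x hv).elim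
        · exact (not_inrD_le_inlD (ha.1 hv)).elim
      have key : ∀ x, inlD x ∈ d → ∃ N, WSteps M (.inl N) ∧ LR W σ x N := fun x hx => by
        rcases h _ hx with hb | ⟨a', N, h1, h2⟩ | ⟨a', N, h1, -⟩
        · exact (not_inlD_le_bot hb.le).elim
        · rw [le_antisymm (inlD_le_inlD.1 h1.le) (inlD_le_inlD.1 h1.ge)]
          exact ⟨N, h2⟩
        · exact (not_inlD_le_inrD h1.le).elim
      obtain ⟨N, hN, -⟩ := key x₀ hx₀
      refine .inr (.inl ⟨a, N, rfl, hN, LR.sup W (d := {x | inlD x ∈ d}) ⟨x₀, hx₀⟩ ?_ ?_ ?_⟩)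
      · intro x hx y hy
        obtain ⟨z, hz, h1, h2⟩ := hd' _ hx _ hy
        rcases sum_cases z with rfl | ⟨z, rfl⟩ | ⟨z, rfl⟩
        · exact (not_inlD_le_bot h1).elim
        · exact ⟨z, hz, inlD_le_inlD.1 h1, inlD_le_inlD.1 h2⟩
        · exact (not_inlD_le_inrD h1).elim
      · refine ⟨fun x hx => inlD_le_inlD.1 (ha.1 hx), fun b hb => inlD_le_inlD.1
          (ha.2 fun v hv => ?_)⟩
        rcases sum_cases v with rfl | ⟨x, rfl⟩ | ⟨y, rfl⟩
        · exact bot_le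
        · exact inlD_le_inlD.2 (hb hv)
        · exact (not_inrD_le_inlD (ha.1 hv)).elim
      · intro x hx
        -- The term under the injection does not depend on `x`, by uniqueness of weak normal forms;
        -- so the induction hypothesis applies to one fixed `N`.
        obtain ⟨N', hN', hx'⟩ := key x hx
        have := hN.unique hN' (fun _ => not_wAct_inl) fun _ => not_wAct_inl
        simp only [Tm.inl.injEq] at this
        rwa [this]
    · obtain ⟨x₀, hx₀⟩ : ∃ x, inrD x ∈ d := by
        by_contra! hne
        refine not_inrD_le_bot (ha.2 fun v hv => ?_)
        rcases sum_cases v with rfl | ⟨x, rfl⟩ | ⟨y, rfl⟩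
        · exact le_rfl
        · exact (not_inlD_le_inrD (ha.1 hv)).elim
        · exact (hne y hv).elim
      have key : ∀ x, inrD x ∈ d → ∃ N, WSteps M (.inr N) ∧ LR W τ x N := fun x hx => by
        rcases h _ hx with hb | ⟨a', N, h1, -⟩ | ⟨a', N, h1, h2⟩
        · exact (not_inrD_le_bot hb.le).elim
        · exact (not_inrD_le_inlD h1.le).elim
        · rw [le_antisymm (inrD_le_inrD.1 h1.le) (inrD_le_inrD.1 h1.ge)]
          exact ⟨N, h2⟩
      obtain ⟨N, hN, -⟩ := key x₀ hx₀
      refine .inr (.inr ⟨a, N, rfl, hN, LR.sup W (d := {x | inrD x ∈ d}) ⟨x₀, hx₀⟩ ?_ ?_ ?_⟩)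
      · intro x hx y hy
        obtain ⟨z, hz, h1, h2⟩ := hd' _ hx _ hy
        rcases sum_cases z with rfl | ⟨z, rfl⟩ | ⟨z, rfl⟩
        · exact (not_inrD_le_bot h1).elim
        · exact (not_inrD_le_inlD h1).elim
        · exact ⟨z, hz, inrD_le_inrD.1 h1, inrD_le_inrD.1 h2⟩
      · refine ⟨fun x hx => inrD_le_inrD.1 (ha.1 hx), fun b hb => inrD_le_inrD.1
          (ha.2 fun v hv => ?_)⟩
        rcases sum_cases v with rfl | ⟨x, rfl⟩ | ⟨y, rfl⟩
        · exact bot_le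
        · exact (not_inlD_le_inrD (ha.1 hv)).elim
        · exact inrD_le_inrD.2 (hb hv)
      · intro x hx
        obtain ⟨N', hN', hx'⟩ := key x hx
        have := hN.unique hN' (fun _ => not_wAct_inr) fun _ => not_wAct_inr
        simp only [Tm.inr.injEq] at this
        rwa [this]
  | .prod σ τ, d, a, hd, hd', ha, M, h => by
    by_cases hb : ∀ v ∈ d, v = ⊥
    · exact .inl (le_bot_iff.1 (ha.2 fun v hv => (hb v hv).le))
    push Not at hb
    obtain ⟨v, hv, hv'⟩ := hb
    obtain ⟨N, P, hM, -⟩ := (h v hv).resolve_left hv'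
    -- Again one pair serves for all members of `d`; the member `⊥` reduces to nothing in
    -- particular, but its components are `⊥` and related to every term.
    have key : ∀ w ∈ d, LR W σ (fstD w) N ∧ LR W τ (sndD w) P := fun w hw => by
      rcases h w hw with rfl | ⟨N', P', hM', hN', hP'⟩
      · rw [fstD_bot, sndD_bot]
        exact ⟨LR.bot W _ _, LR.bot W _ _⟩
      · have := hM.unique hM' (fun _ => not_wAct_pair) fun _ => not_wAct_pair
        simp only [Tm.pair.injEq] at this
        rw [this.1, this.2]
        exact ⟨hN', hP'⟩
    have hl := isLUB_prod.1 ha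
    refine .inr ⟨N, P, hM, LR.sup W (d := fstD '' d) (hd.image _)
      (hd'.mono_comp fun _ _ h => fstD_mono h) hl.1 ?_, LR.sup W (d := sndD '' d) (hd.image _)
      (hd'.mono_comp fun _ _ h => sndD_mono h) hl.2 ?_⟩
    · rintro _ ⟨w, hw, rfl⟩
      exact (key w hw).1
    · rintro _ ⟨w, hw, rfl⟩
      exact (key w hw).2
  | .arrow σ τ, d, f, hd, hd', hf, M, h => fun x N hN => by
    have hl := SCont.apply_cont (X := σ.dom) (Y := τ.dom) x hd hd' hf
    refine LR.sup W (hd.image _) (SCont.directedOn_apply hd' x) hl ?_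
    rintro _ ⟨g, hg, rfl⟩
    exact h g hg x N hN
  | .dist τ, d, ν, hd, hd', hν, M, h => fun k hk E hE => by
    refine (MVal.lint_cont (X := τ.dom) hk hd hd' hν).2 ?_
    rintro _ ⟨ξ, hξ, rfl⟩
    exact h ξ hξ k hk E hE

end

section
variable {S : Sig.{u}}

/-! ### The fundamental property of the logical relation -/

theorem LR.quote {β : Ty} (W : SOpens (Cfg S (.dist β))) : ∀ (τ : Ty) (v : τ.dom) (h : IsObs τ v),
    LR W τ v (quote S τ v h)
  | .unit, v, h => .inr ⟨_, .const _ trivial, .refl, (sem_quote (S := S) .unit v h).ge⟩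
  | .void, v, h => (WithBot.unbot (α := Flat Empty) v h).val.elim
  | .int, v, h => .inr ⟨_, .const _ trivial, .refl, (sem_quote (S := S) .int v h).ge⟩
  | .real, v, h => .inr ⟨_, .real _, .refl, (sem_quote (S := S) .real v h).ge⟩
  | .prod σ τ, v, h => .inr ⟨_, _, .refl, LR.quote W σ _ h.1, LR.quote W τ _ h.2⟩
  | .sum σ τ, v, h => by
    rcases sum_cases v with rfl | ⟨a, rfl⟩ | ⟨b, rfl⟩
    · exact (not_isObs_bot _ h).elim
    · exact .inr (.inl ⟨a, _, rfl, .refl, LR.quote W σ a h⟩)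
    · exact .inr (.inr ⟨b, _, rfl, .refl, LR.quote W τ b h⟩)
  | .arrow _ _, _, h => h.elim
  | .dist _, _, h => h.elim

theorem LR.constApp (hS : S.StrictlyObservableFirstOrder) {β : Ty} (W : SOpens (Cfg S (.dist β))) :
    ∀ {σ τ : Ty} {M : Cfg S (.arrow σ τ)}, IsConstApp M → LR W (.arrow σ τ) (sem M) M := by
  -- The induction on the type runs over the arguments still missing.
  have key : ∀ (τ : Ty) (M : Cfg S τ), IsConstApp M → ¬ τ.IsObservable → LR W τ (sem M) M := by
    intro τ
    induction τ with
    | unit | void | int | real => exact fun _ _ h => (h trivial).elim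
    | sum | prod => exact fun M hM h => (h (hM.strictlyObs hS).1).elim
    | dist => exact fun M hM h => (hM.strictlyObs hS).1.elim
    | arrow σ τ _ ih =>
      intro M hM _ v N hN
      obtain ⟨hfo, hso⟩ := hM.strictlyObs hS
      rcases (lR_of_isBasic W hfo.1).1 hN with rfl | ⟨V, hV, hNV, hv⟩
      -- Nothing is known about the evaluation of an argument related to `⊥`; strictness of the
      -- constant settles this case.
      · rw [show appD (sem M) (⊥ : σ.dom) = ⊥ from hso.2]
        exact LR.bot W τ _
      have hMV := IsConstApp.app M V hM hV
      -- The argument is first reduced to a constant `V` in place. Its denotation may lie strictly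
      -- above `v`, which downward closure allows.
      refine LR.expand hS W (hNV.plug (.arg M hM .hole)) (LR.down W (w := sem (Tm.app M V))
        ((SCont.cont (X := σ.dom) (Y := τ.dom) (sem M)).monotone hv) ?_)
      by_cases hτ : τ.IsObservable
      · rcases (isStrictlyObs_iff hτ).1 (hMV.strictlyObs hS).2 with h | h
        · exact LR.expand hS W (.single (Det.const M V hM hV hτ h).wStep) (LR.quote W τ _ h)
        · rw [h]
          exact LR.bot W τ _
      · exact ih _ hMV hτ
  intro σ τ M hM
  exact key _ _ hM id

theorem LR.const (hS : S.StrictlyObservableFirstOrder) {β : Ty} (W : SOpens (Cfg S (.dist β)))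
    {τ : Ty} (c : S.Const τ) : LR W τ (S.den c) (.const c) := by
  cases τ with
  | unit | void | int | real => exact .inr ⟨_, .const c trivial, .refl, le_rfl⟩
  -- A zero-ary constant of observable type has a basic type, so these types do not occur.
  | sum | prod => exact ((hS _ c).2.2 (hS _ c).1).1.elim
  | arrow => exact LR.constApp hS W (.const c)
  | dist => exact (hS _ c).1.elim

/-- After one unfolding of `Next*` both sides are integrals over images of `μ`, and the hypothesis
on `h` and `E` compares the integrands at each interval. -/
theorem LR.sample (hS : S.StrictlyObservableFirstOrder) {β : Ty} (W : SOpens (Cfg S (.dist β)))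
    (μ : S.Meas) : LR W (.dist .real) (sem (.sample μ : Cfg S (.dist .real))) (.sample μ) := by
  intro h _ E hE
  rw [nextStar_eq_lint hS, nextOne_eq (.sample E μ)]
  exact Val.lint_ofMeasure_le μ.1 _ _ h (nextStar_cont hS W) fun a =>
    hE (realD a) (.real a) (.inr ⟨_, .real a, .refl, le_rfl⟩)

theorem LR.score (hS : S.StrictlyObservableFirstOrder) {β : Ty} (W : SOpens (Cfg S (.dist β)))
    (a : IR) : LR W (.dist .unit) (sem (.score (.real a) : Cfg S (.dist .unit)))
      (.score (.real a)) := by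
  intro h hh E hE
  have hsem : (distD (sem (.score (.real a) : Cfg S (.dist .unit)))).1
      = ENNReal.ofReal a.abs • Val.dirac starD := rfl
  rw [nextStar_eq_lint hS, nextOne_eq (.score E a), hsem, Val.lint_smul, Val.lint_smul,
    Val.lint_dirac _ hh, Val.lint_dirac _ (nextStar_cont hS W)]
  gcongr
  exact hE starD (.const S.star) (.inr ⟨_, .const _ trivial, .refl, S.den_star.ge⟩)

/-- The fundamental property of the logical relation. -/
theorem LR.den (hS : S.StrictlyObservableFirstOrder) {β : Ty} (W : SOpens (Cfg S (.dist β)))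
    {Γ : List Ty} {τ : Ty} (M : Tm S IR Γ τ) (ρ : env Γ) (s : ∀ τ, Var Γ τ → Cfg S τ)
    (hs : ∀ τ v, LR W τ (v.den ρ) (s τ v)) : LR W τ (M.den ρ) (M.subst s) := by
  have hcons : ∀ {Γ : List Ty} {ρ : env Γ} {s : ∀ τ, Var Γ τ → Cfg S τ},
      (∀ τ v, LR W τ (v.den ρ) (s τ v)) → ∀ {σ : Ty} {x : σ.dom} {N : Cfg S σ}, LR W σ x N →
      ∀ τ v, LR W τ (v.den (Tm.envCons x ρ)) (Tm.consSub N s τ v) := by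
    intro Γ ρ s hs σ x N hN τ v
    cases v with
    | zero => exact hN
    | succ v => exact hs _ v
  induction M with
  | var v => exact hs _ v
  | const c => exact LR.const hS W c
  | real a => exact .inr ⟨_, .real a, .refl, le_rfl⟩
  | sample μ => exact LR.sample hS W μ
  | score M ih =>
    rcases ih ρ s hs with h | ⟨V, hV, hMV, hv⟩
    -- Scoring is strict, as `|⊥| = 0`.
    · have h0 : (Tm.score M).den ρ = ⊥ := by
        have h' : M.den ρ = (⊥ : WithBot IR) :=
          h.trans (eq_withBot_bot (X := IR) (dom_bot_le (τ := .real)))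
        exact congrArg (SCont.score starD).toFun h'
      rw [h0]
      exact LR.bot W _ _
    · cases hV with
      | const c => exact (S.noReal.false c).elim
      | real a =>
        exact LR.expand hS W (hMV.plug (.score .hole)) (LR.down W
          ((SCont.score starD).cont.monotone hv) (LR.score hS W a))
  | lam M ih =>
    intro v N hN
    -- After a beta step the argument joins the closing substitution, as its denotation joins the
    -- environment.
    refine LR.expand hS W (.single (Det.contract _ _ (.beta _ N)).wStep) ?_
    rw [Tm.inst_subst_liftSub]
    exact ih _ _ (hcons hs hN)
  | app M N ih ih' => exact ih ρ s hs _ _ (ih' ρ s hs)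
  | @fix _ σ M ih =>
    -- Every iterate from `⊥` is related to the recursive term, by unfolding that term once per
    -- iterate; closure under directed suprema gives the fixed point.
    have hl := SCont.lfp_isLUB (X := σ.dom) (M.den ρ)
    refine LR.sup W (range_nonempty _) (Directed.directedOn_range (monotone_nat_of_le_succ
      fun n => ?_).directed_le) hl ?_
    · rw [Function.iterate_succ_apply]
      exact ((SCont.cont (X := σ.dom) (Y := σ.dom) (M.den ρ)).monotone.iterate n) bot_le
    · rintro _ ⟨n, rfl⟩
      induction n with
      | zero => exact LR.bot W σ _
      | succ n ihn =>
        dsimp only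
        rw [Function.iterate_succ_apply']
        exact LR.expand hS W (.single (Det.contract _ _ (.fix _)).wStep)
          (ih ρ s hs _ _ ihn)
  | ret M ih =>
    intro h hh E hE
    exact (Val.lint_dirac_le _ h).trans (hE _ _ (ih ρ s hs))
  | @bind _ σ τ M N ih ih' =>
    intro h hh E hE
    let f : SCont σ.dom (MVal τ.dom) := (Tm.lam N).den ρ
    have hb : (distD ((Tm.bind M N).den ρ)).1.lint h
        = (distD (M.den ρ)).1.lint fun x => (f x).1.lint h :=
      MVal.lint_bind f (distD (M.den ρ)) hh
    have hp : E.plug ((Tm.bind M N).subst s)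
        = (E.comp (.bind .hole (N.subst (Tm.liftSub s σ)))).plug (M.subst s) :=
      (E.comp_plug (.bind .hole (N.subst (Tm.liftSub s σ))) (M.subst s)).symm
    rw [hb, hp]
    -- The relation for `M` is used with the context `E[do x ← []; N]` and the inner integral `x ↦ ∫
    -- h df(x)` as test function. Its hypothesis is the relation for `N` after one bind step.
    refine ih ρ s hs _ (MVal.lint_scont f hh) _ fun v P hP => ?_
    have hn : nextOne (E.plug ((WCtx.bind .hole (N.subst (Tm.liftSub s σ))).plug P.ret))
        = Val.dirac (E.plug ((N.subst (Tm.liftSub s σ)).inst P)) :=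
      nextOne_eq (.bind E P (N.subst (Tm.liftSub s σ)))
    rw [E.comp_plug, nextStar_eq_lint hS, hn, Val.lint_dirac _ (nextStar_cont hS W), Tm.inst_subst_liftSub]
    exact ih' (Tm.envCons v ρ) _ (hcons hs hP) h hh E hE
  | pair M N ih ih' => exact .inr ⟨_, _, .refl, ih ρ s hs, ih' ρ s hs⟩
  | @fst _ σ τ M ih =>
    change LR W σ (fstD (M.den ρ)) _
    rcases ih ρ s hs with h | ⟨N, P, hM, hN, -⟩
    · rw [h, fstD_bot]
      exact LR.bot W σ _
    · exact LR.expand hS W ((hM.plug (.fst .hole)).tail (Det.contract _ _ (.fst N P)).wStep) hN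
  | @snd _ σ τ M ih =>
    change LR W τ (sndD (M.den ρ)) _
    rcases ih ρ s hs with h | ⟨N, P, hM, -, hP⟩
    · rw [h, sndD_bot]
      exact LR.bot W τ _
    · exact LR.expand hS W ((hM.plug (.snd .hole)).tail (Det.contract _ _ (.snd N P)).wStep) hP
  | inl M ih => exact .inr (.inl ⟨_, _, rfl, .refl, ih ρ s hs⟩)
  | inr M ih => exact .inr (.inr ⟨_, _, rfl, .refl, ih ρ s hs⟩)
  | @case _ σ τ υ M N P ih ih' ih'' =>
    have hred : ∀ {Q : Cfg S (.sum σ τ)}, WSteps (M.subst s) Q →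
        WSteps ((Tm.case M N P).subst s) (.case Q (N.subst s) (P.subst s)) :=
      fun h => h.plug (.case .hole (N.subst s) (P.subst s))
    have hden : (Tm.case M N P).den ρ = (SCont.cases : SCont ((SCont σ.dom υ.dom ×
        SCont τ.dom υ.dom) × WithBot (σ.dom ⊕ τ.dom)) υ.dom).toFun
        ((N.den ρ, P.den ρ), M.den ρ) := rfl
    rcases ih ρ s hs with h | ⟨a, Q, h, hM, hQ⟩ | ⟨b, Q, h, hM, hQ⟩
    · have h' : M.den ρ = (⊥ : WithBot (σ.dom ⊕ τ.dom)) :=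
        h.trans (eq_withBot_bot (X := σ.dom ⊕ τ.dom) (dom_bot_le (τ := .sum σ τ)))
      rw [hden, h']
      exact LR.bot W υ _
    · rw [hden, h]
      exact LR.expand hS W ((hred hM).tail (Det.contract _ _ (.inl Q _ _)).wStep)
        (ih' ρ s hs _ _ hQ)
    · rw [hden, h]
      exact LR.expand hS W ((hred hM).tail (Det.contract _ _ (.inr Q _ _)).wStep)
        (ih'' ρ s hs _ _ hQ)

theorem LR.sem_self (hS : S.StrictlyObservableFirstOrder) {β : Ty} (W : SOpens (Cfg S (.dist β)))
    {τ : Ty} (M : Cfg S τ) : LR W τ (sem M) M := by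
  have := LR.den hS W M PUnit.unit (fun _ v => .var v) fun _ v => nomatch v
  rwa [Tm.subst_var] at this

/-! ### Adequacy -/

/-- Terms of observable types that are related to observable elements reduce to values. -/
theorem LR.exists_value {β : Ty} (W : SOpens (Cfg S (.dist β))) : ∀ {τ : Ty} {v : τ.dom}
    {N : Cfg S τ}, LR W τ v N → IsObs τ v → ∃ V, IsValue V ∧ ESteps N V ∧ v ≤ sem V := by
  have basic : ∀ {τ : Ty} {v : τ.dom} {N : Cfg S τ}, BasicRel v N → IsObs τ v →
      ∃ V, IsValue V ∧ ESteps N V ∧ v ≤ sem V := by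
    rintro τ v N (rfl | ⟨V, hV, hNV, hv⟩) h
    · exact (not_isObs_bot τ h).elim
    · exact ⟨V, .atom V hV, hNV.eSteps, hv⟩
  intro τ
  induction τ with
  | unit | void | int | real => exact fun hN h => basic hN h
  | sum σ τ ih ih' =>
    rintro v N (rfl | ⟨a, P, rfl, hP, ha⟩ | ⟨b, P, rfl, hP, hb⟩) h
    · exact (not_isObs_bot _ h).elim
    · obtain ⟨V, hV, hPV, hv⟩ := ih ha h
      exact ⟨V.inl, .inl V hV, hP.eSteps.trans (hPV.lift _ fun _ _ h => h.inl),
        inlD_le_inlD.2 hv⟩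
    · obtain ⟨V, hV, hPV, hv⟩ := ih' hb h
      exact ⟨V.inr, .inr V hV, hP.eSteps.trans (hPV.lift _ fun _ _ h => h.inr),
        inrD_le_inrD.2 hv⟩
  | prod σ τ ih ih' =>
    rintro v N (rfl | ⟨P, Q, hN, hP, hQ⟩) h
    · exact (not_isObs_bot _ h).elim
    · obtain ⟨V, hV, hPV, hv⟩ := ih hP h.1
      obtain ⟨V', hV', hQV, hv'⟩ := ih' hQ h.2
      -- The left component is evaluated first, because contexts reach the right one only past a
      -- value.
      exact ⟨V.pair V', .pair V V' hV hV', (hN.eSteps.trans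
        (hPV.lift (fun P => P.pair Q) fun _ _ h => h.pairL Q)).trans
        (hQV.lift _ fun _ _ h => h.pairR hV), ⟨hv, hv'⟩⟩
  | arrow | dist => exact fun _ h => h.elim

/-- The fundamental property at `D β`, with the empty context and the indicator of `U` as test
function. Observability of the elements of `U` makes related terms terminate. -/
theorem semD_le (hS : S.StrictlyObservableFirstOrder) {β : Ty} (U : SOpens β.dom)
    (hU : ∀ b ∈ U, IsObs β b) (W : SOpens (Cfg S (.dist β))) (hW : ∀ M ∈ rover S U, M ∈ W)
    (M : Cfg S (.dist β)) : semD M U ≤ nextStar M W := by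
  have := LR.sem_self hS W M (fun x => Val.dirac x U) (Val.dirac_cont U) .hole fun v N hN => ?_
  · rwa [Val.lint_indicator] at this
  · by_cases hv : v ∈ U
    · obtain ⟨V, hV, hNV, hvV⟩ := hN.exists_value W (hU v hv)
      have hred : ESteps N.ret V.ret := hNV.lift _ fun _ _ h => h.ret
      rw [Val.dirac_eq_one hv]
      -- The value lies in the right set because `U` is an upper set and `v ≤ ⟦V⟧`; the steps from
      -- `ret N` to `ret V` do not change `Next*`.
      refine (nextStar_of_isNormal (isNormal_of_isValue (.ret V hV)) (hW _ ⟨V,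
        isNormal_of_isValue hV, U.upper hvV hv, rfl⟩)).trans_eq (hred.nextStar_eq hS W).symm
    · rw [Val.dirac_eq_zero hv]
      exact zero_le

end

end ISPCF
theorem mainTheorem4 (S : ISPCF.Sig.{u}) (hS : S.StrictlyObservableFirstOrder)
    (β : ISPCF.Ty) (hβ : β.IsObservable) (M : ISPCF.Cfg S (.dist β))
    (U : ISPCF.SOpens β.dom) (hU : ∀ b ∈ U, ISPCF.IsObs β b) :
    ∃ hr : ISPCF.IsScottOpen (ISPCF.rover S U),
      (ISPCF.semD M) U = ISPCF.nextStar M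
        (@TopologicalSpace.Opens.mk _ (Topology.scott (ISPCF.Cfg S (.dist β)) Set.univ)
          (ISPCF.rover S U) hr) :=
  ⟨ISPCF.isScottOpen_rover U, le_antisymm (ISPCF.semD_le hS U hU _ (fun _ h => h) M)
    (ISPCF.nextStar_le hS U _ (fun _ h => h) M)⟩
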